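/- Manifolds are connected, paracompact, Hausdorff and smooth ($C^\infty$), without boundary. Let $M$ be a manifold with a smooth linear connection $\nabla$ (an affine connection on $TM$, possibly with torsion). A geodesic is a smooth curve $\gamma$ on an open interval with $\nabla_{\gamma'}\gamma'=0$, inextendible (maximally extended) as such; constant ones are allowed. Call $(M,\nabla)$ - *nonreturning* if every neighbourhood of every point $p\in M$ contains a neighbourhood $U$ of $p$ such that no geodesic, having been in $U$ and then left $U$, ever returns to $U$; - *pseudoconvex* if for every compact $K\subseteq M$ there is a compact $K'\subseteq M$ such that every geodesic segment with both endpoints in $K$ lies entirely in $K'$. Let $T'M$ be $TM$ without its zero section, let $PM$ be the quotient space of $T'M$ by proportionality of vectors at each point (the space of tangent lines), and let the space of geodesics $G(M)$ be the quotient space of $PM$ obtained by identifying points that lie on the lift $t\mapsto \mathbb R\,\gamma'(t)$ of a common nonconstant geodesic $\gamma$. **Theorem.** Let $(M_1,\nabla_1)$ and $(M_2,\nabla_2)$ be manifolds with smooth linear connections, of dimensions $n_1$ and $n_2$ with $n_1+n_2\ge 1$, and give $M_1\times M_2$ the product connection $\nabla_1\times\nabla_2$. If $(M_1,\nabla_1)$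 and $(M_2,\nabla_2)$ are both nonreturning and pseudoconvex, then $G(M_1\times M_2)$ is a manifold: it is Hausdorff, paracompact and connected, and it has a smooth structure of dimension $2(n_1+n_2)-2$, compatible with its quotient topology, for which the natural projection $T'(M_1\times M_2)\to G(M_1\times M_2)$ is a smooth submersion. -/

import Mathlib

open Bundle Set Topology
open scoped Manifold ContDiff

noncomputable section

namespace Geod

section Geodesics

variable {E : Type*} [NormedAddCommGroup E] [NormedSpace ℝ E]
  {H : Type*} [TopologicalSpace H] {I : ModelWithCorners ℝ E H}
  {M : Type*} [TopologicalSpace M] [ChartedSpace H M] [IsManifold I ∞ M]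

/-- The velocity `γ'(t)` of a curve `γ` in `M`. -/
def velocity (I : ModelWithCorners ℝ E H) (γ : ℝ → M) (t : ℝ) : TangentSpace I (γ t) :=
  mfderiv 𝓘(ℝ, ℝ) I γ t (1 : ℝ)

/-- The local vector field near `x` which has constant components, equal to those of `v`,
in the preferred chart at `x`; its value at `x` is `v`. -/
def constExtension (x : M) (v : TangentSpace I x) : Π y : M, TangentSpace I y :=
  let e := trivializationAt E (TangentSpace I : M → Type _) x
  fun y => e.symmL ℝ y (e.continuousLinearMapAt ℝ x v)

/-- The covariant derivative at time `t` of a vector field `V` along a curve `γ`: if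
`V = ∑ Vᵏ ∂ₖ` in the preferred chart at `γ t`, this is `∑ (Vᵏ)' ∂ₖ + ∑ Vᵏ ∇_{γ'} ∂ₖ` at `t`. -/
def covDerivAlong (cov : CovariantDerivative I E (TangentSpace I : M → Type _))
    (γ : ℝ → M) (V : Π s : ℝ, TangentSpace I (γ s)) (t : ℝ) : TangentSpace I (γ t) :=
  let e := trivializationAt E (TangentSpace I : M → Type _) (γ t)
  e.symmL ℝ (γ t) (deriv (fun s => (e (⟨γ s, V s⟩ : TangentBundle I M)).2) t) +
    cov (constExtension (γ t) (V t)) (γ t) (velocity I γ t)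

/-- `γ`, restricted to the nonempty open interval `J` (the values of `γ` outside `J` play no
role), is a geodesic: a smooth curve with `∇_{γ'} γ' = 0`. Constant curves are included. -/
structure IsGeodesicOn (cov : CovariantDerivative I E (TangentSpace I : M → Type _))
    (γ : ℝ → M) (J : Set ℝ) : Prop where
  isOpen : IsOpen J
  ordConnected : J.OrdConnected
  nonempty : J.Nonempty
  contMDiffOn : ContMDiffOn 𝓘(ℝ, ℝ) I ∞ γ J
  geodesic_eq : ∀ t ∈ J, covDerivAlong cov γ (velocity I γ) t = 0

/-- An inextendible (maximally extended) geodesic `γ : J → M`. -/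
structure IsInextendibleGeodesic (cov : CovariantDerivative I E (TangentSpace I : M → Type _))
    (γ : ℝ → M) (J : Set ℝ) : Prop extends IsGeodesicOn cov γ J where
  maximal : ∀ (γ' : ℝ → M) (J' : Set ℝ),
    IsGeodesicOn cov γ' J' → J ⊆ J' → EqOn γ γ' J → J' = J

/-- Every point has arbitrarily small neighbourhoods to which no geodesic ever returns
after having left them. -/
def Nonreturning (cov : CovariantDerivative I E (TangentSpace I : M → Type _)) : Prop :=
  ∀ p : M, ∀ V ∈ 𝓝 p, ∃ U ∈ 𝓝 p, U ⊆ V ∧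
    ∀ (γ : ℝ → M) (J : Set ℝ), IsInextendibleGeodesic cov γ J →
      ∀ r ∈ J, ∀ s ∈ J, ∀ t ∈ J, r < s → s < t → γ r ∈ U → γ s ∉ U → γ t ∉ U

/-- For every compact `K` there is a compact `K'` such that every geodesic segment with both
endpoints in `K` lies in `K'`. -/
def Pseudoconvex (cov : CovariantDerivative I E (TangentSpace I : M → Type _)) : Prop :=
  ∀ K : Set M, IsCompact K → ∃ K' : Set M, IsCompact K' ∧
    ∀ (γ : ℝ → M) (J : Set ℝ), IsInextendibleGeodesic cov γ J →
      ∀ a ∈ J, ∀ b ∈ J, a ≤ b → γ a ∈ K → γ b ∈ K → ∀ t ∈ Icc a b, γ t ∈ K'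

variable (I M) in
theorem isOpen_ne_zero : IsOpen {v : TangentBundle I M | v.2 ≠ 0} := by
  rw [isOpen_iff_mem_nhds]
  intro v hv
  let e := trivializationAt E (TangentSpace I : M → Type _) v.1
  have hvs : v ∈ e.source := by
    rw [e.mem_source]
    exact FiberBundle.mem_baseSet_trivializationAt' v.1
  have key : ∀ w ∈ e.source, ((e w).2 ≠ 0 ↔ w.2 ≠ 0) := by
    intro w hw
    have hb : w.1 ∈ e.baseSet := e.mem_source.1 hw
    have h1 : (e w).2 = e.continuousLinearEquivAt ℝ w.1 hb w.2 := rfl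
    rw [h1, ne_eq, ne_eq, EmbeddingLike.map_eq_zero_iff]
  have hcont : ContinuousAt (fun w => (e w).2) v :=
    continuous_snd.continuousAt.comp (e.continuousOn.continuousAt (e.open_source.mem_nhds hvs))
  have h0 : {x : E | x ≠ 0} ∈ 𝓝 (e v).2 := isOpen_ne.mem_nhds ((key v hvs).2 hv)
  filter_upwards [hcont.preimage_mem_nhds h0, e.open_source.mem_nhds hvs] with w hw hws
  exact (key w hws).1 hw

variable (I M) in
/-- The reduced tangent bundle `T'M`: `TM` less the zero section, as an open submanifold
of `TM`. -/
def ReducedTangentBundle : TopologicalSpace.Opens (TangentBundle I M) :=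
  ⟨{v | v.2 ≠ 0}, isOpen_ne_zero I M⟩

variable (I M) in
/-- Two nonzero tangent vectors at the same point are identified if they are proportional. -/
def proportional : Setoid (ReducedTangentBundle I M) where
  r v w := ∃ c : ℝ, c ≠ 0 ∧ (w : TangentBundle I M) = ⟨v.1.1, c • v.1.2⟩
  iseqv :=
    { refl := fun v => ⟨1, one_ne_zero, by rw [one_smul]⟩
      symm := by
        rintro ⟨⟨x, v⟩, hv⟩ ⟨w, hw⟩ ⟨c, hc, h⟩
        dsimp only at h
        subst h
        refine ⟨c⁻¹, inv_ne_zero hc, ?_⟩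
        dsimp only
        rw [inv_smul_smul₀ hc]
      trans := by
        rintro ⟨⟨x, u⟩, hu⟩ ⟨v, hv⟩ ⟨w, hw⟩ ⟨c, hc, h⟩ ⟨d, hd, h'⟩
        dsimp only at h h'
        subst h
        subst h'
        refine ⟨d * c, mul_ne_zero hd hc, ?_⟩
        dsimp only
        rw [mul_smul] }

variable (I M) in
/-- The projectivized tangent bundle `PM`, the space of tangent lines, with the quotient
topology from `T'M`. -/
abbrev ProjTangentBundle : Type _ := Quotient (proportional I M)

/-- The point `ℓ` of `PM` lies on the lift to `PM` of the curve `γ : J → M`, that is,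
`ℓ` is the tangent line spanned by some `γ'(s) ≠ 0` with `s ∈ J`. -/
def LiesOnLift (γ : ℝ → M) (J : Set ℝ) (ℓ : ProjTangentBundle I M) : Prop :=
  ∃ s ∈ J, ∃ h : velocity I γ s ≠ 0,
    ℓ = Quotient.mk (proportional I M) ⟨(⟨γ s, velocity I γ s⟩ : TangentBundle I M), h⟩

/-- Two points of `PM` that lie on the lift of a common geodesic. -/
def OnCommonGeodesic (cov : CovariantDerivative I E (TangentSpace I : M → Type _))
    (ℓ m : ProjTangentBundle I M) : Prop :=
  ∃ (γ : ℝ → M) (J : Set ℝ), IsInextendibleGeodesic cov γ J ∧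
    LiesOnLift γ J ℓ ∧ LiesOnLift γ J m

/-- The space of (unoriented) geodesics `G(M)`: the quotient of `PM`, with the quotient topology,
obtained by identifying points that lie on the lift of a common geodesic. -/
abbrev SpaceOfGeodesics (cov : CovariantDerivative I E (TangentSpace I : M → Type _)) : Type _ :=
  Quot (OnCommonGeodesic cov)

/-- The natural projection `T'M → PM → G(M)`, taking a nonzero tangent vector to the geodesic
it determines. -/
def geodesicProj (cov : CovariantDerivative I E (TangentSpace I : M → Type _))
    (v : ReducedTangentBundle I M) : SpaceOfGeodesics cov :=
  Quot.mk _ (Quotient.mk (proportional I M) v)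

end Geodesics

section Product

variable {E₁ : Type*} [NormedAddCommGroup E₁] [NormedSpace ℝ E₁]
  {H₁ : Type*} [TopologicalSpace H₁] {I₁ : ModelWithCorners ℝ E₁ H₁}
  {M₁ : Type*} [TopologicalSpace M₁] [ChartedSpace H₁ M₁]
  {E₂ : Type*} [NormedAddCommGroup E₂] [NormedSpace ℝ E₂]
  {H₂ : Type*} [TopologicalSpace H₂] {I₂ : ModelWithCorners ℝ E₂ H₂}
  {M₂ : Type*} [TopologicalSpace M₂] [ChartedSpace H₂ M₂]

/-- First component of a vector under `T_(x,y)(M₁ × M₂) = T_x M₁ × T_y M₂`. -/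
def tfst (p : M₁ × M₂) : TangentSpace (I₁.prod I₂) p →L[ℝ] TangentSpace I₁ p.1 :=
  ContinuousLinearMap.fst ℝ E₁ E₂

/-- Second component of a vector under `T_(x,y)(M₁ × M₂) = T_x M₁ × T_y M₂`. -/
def tsnd (p : M₁ × M₂) : TangentSpace (I₁.prod I₂) p →L[ℝ] TangentSpace I₂ p.2 :=
  ContinuousLinearMap.snd ℝ E₁ E₂

/-- The vector with `M₁`-component given and `M₂`-component zero. -/
def tinl (p : M₁ × M₂) : TangentSpace I₁ p.1 →L[ℝ] TangentSpace (I₁.prod I₂) p :=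
  ContinuousLinearMap.inl ℝ E₁ E₂

/-- The vector with `M₂`-component given and `M₁`-component zero. -/
def tinr (p : M₁ × M₂) : TangentSpace I₂ p.2 →L[ℝ] TangentSpace (I₁.prod I₂) p :=
  ContinuousLinearMap.inr ℝ E₁ E₂

/-- For `p = (x, y)`: the derivative at `y` of `y' ↦ σ₁(x, y')`, a map from `M₂` to the fixed
vector space `T_x M₁`, where `σ₁` is the `M₁`-component of the vector field `σ`. -/
def dFiberFst (σ : Π p : M₁ × M₂, TangentSpace (I₁.prod I₂) p) (p : M₁ × M₂) :
    TangentSpace I₂ p.2 →L[ℝ] TangentSpace I₁ p.1 :=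
  mvfderiv I₂ (F := E₁) (fun y : M₂ => tfst (p.1, y) (σ (p.1, y))) p.2

/-- For `p = (x, y)`: the derivative at `x` of `x' ↦ σ₂(x', y)`, a map from `M₁` to the fixed
vector space `T_y M₂`, where `σ₂` is the `M₂`-component of the vector field `σ`. -/
def dFiberSnd (σ : Π p : M₁ × M₂, TangentSpace (I₁.prod I₂) p) (p : M₁ × M₂) :
    TangentSpace I₁ p.1 →L[ℝ] TangentSpace I₂ p.2 :=
  mvfderiv I₁ (F := E₂) (fun x : M₁ => tsnd (x, p.2) (σ (x, p.2))) p.1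

theorem mdiffAt_left {g : M₁ × M₂ → ℝ} {p : M₁ × M₂} (hg : MDiffAt g p) :
    MDiffAt (fun x : M₁ => g (x, p.2)) p.1 :=
  MDifferentiableAt.comp (f := fun x : M₁ => (x, p.2)) p.1 hg
    (mdifferentiableAt_id.prodMk mdifferentiableAt_const)

theorem mdiffAt_right {g : M₁ × M₂ → ℝ} {p : M₁ × M₂} (hg : MDiffAt g p) :
    MDiffAt (fun y : M₂ => g (p.1, y)) p.2 :=
  MDifferentiableAt.comp (f := fun y : M₂ => (p.1, y)) p.2 hg
    (mdifferentiableAt_const.prodMk mdifferentiableAt_id)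

theorem mvfderiv_prod_apply {g : M₁ × M₂ → ℝ} {p : M₁ × M₂} (hg : MDiffAt g p)
    (u : TangentSpace (I₁.prod I₂) p) :
    d% g p u = d% (fun x : M₁ => g (x, p.2)) p.1 (tfst p u) +
      d% (fun y : M₂ => g (p.1, y)) p.2 (tsnd p u) :=
  mfderiv_prod_eq_add_apply hg

theorem tinl_add_tinr (p : M₁ × M₂) (u : TangentSpace (I₁.prod I₂) p) :
    tinl p (tfst p u) + tinr p (tsnd p u) = u := by
  change ((u.1, (0 : E₂)) + ((0 : E₁), u.2) : E₁ × E₂) = (u.1, u.2)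
  rw [Prod.mk_add_mk, add_zero, zero_add]

variable [IsManifold I₁ ∞ M₁] [IsManifold I₂ ∞ M₂]

theorem mdiffAt_fst_slice {σ : Π p : M₁ × M₂, TangentSpace (I₁.prod I₂) p} {p : M₁ × M₂}
    (hσ : MDiffAt (T% σ) p) : MDiffAt (T% (fun x : M₁ => tfst (x, p.2) (σ (x, p.2)))) p.1 := by
  have h1 : MDiffAt (fun x : M₁ => (x, p.2)) p.1 :=
    mdifferentiableAt_id.prodMk mdifferentiableAt_const
  have h2 := (contMDiff_equivTangentBundleProd (n := 1) (I := I₁) (I' := I₂) (M := M₁)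
    (M' := M₂)).mdifferentiable one_ne_zero
  have h3 := (h2 _).fst.comp p.1 (hσ.comp p.1 h1)
  exact h3

theorem mdiffAt_snd_slice {σ : Π p : M₁ × M₂, TangentSpace (I₁.prod I₂) p} {p : M₁ × M₂}
    (hσ : MDiffAt (T% σ) p) : MDiffAt (T% (fun y : M₂ => tsnd (p.1, y) (σ (p.1, y)))) p.2 := by
  have h1 : MDiffAt (fun y : M₂ => (p.1, y)) p.2 :=
    mdifferentiableAt_const.prodMk mdifferentiableAt_id
  have h2 := (contMDiff_equivTangentBundleProd (n := 1) (I := I₁) (I' := I₂) (M := M₁)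
    (M' := M₂)).mdifferentiable one_ne_zero
  have h3 := (h2 _).snd.comp p.2 (hσ.comp p.2 h1)
  exact h3

theorem trivializationAt_self {E H M : Type*} [NormedAddCommGroup E] [NormedSpace ℝ E]
    [TopologicalSpace H] {I : ModelWithCorners ℝ E H} [TopologicalSpace M] [ChartedSpace H M]
    [IsManifold I ∞ M] (x : M) (v : TangentSpace I x) :
    (trivializationAt E (TangentSpace I : M → Type _) x (⟨x, v⟩ : TangentBundle I M)).2 = v := by
  rw [TangentBundle.trivializationAt_apply]
  exact tangentCoordChange_self (I := I) (mem_extChartAt_source x)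

theorem mdiffAt_fst_vertical {σ : Π p : M₁ × M₂, TangentSpace (I₁.prod I₂) p} {p : M₁ × M₂}
    (hσ : MDiffAt (T% σ) p) :
    MDifferentiableAt I₂ 𝓘(ℝ, E₁) (fun y : M₂ => (tfst (p.1, y) (σ (p.1, y)) : E₁)) p.2 := by
  have h1 : MDiffAt (fun y : M₂ => (p.1, y)) p.2 :=
    mdifferentiableAt_const.prodMk mdifferentiableAt_id
  have h2 := (contMDiff_equivTangentBundleProd (n := 1) (I := I₁) (I' := I₂) (M := M₁)
    (M' := M₂)).mdifferentiable one_ne_zero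
  have h3 := (h2 _).fst.comp p.2 (hσ.comp p.2 h1)
  have h4 := ((mdifferentiableAt_totalSpace _ _).1 h3).2
  refine h4.congr_of_eventuallyEq (Filter.Eventually.of_forall fun y => ?_)
  exact (trivializationAt_self (I := I₁) p.1 (tfst (p.1, y) (σ (p.1, y)))).symm

theorem mdiffAt_snd_vertical {σ : Π p : M₁ × M₂, TangentSpace (I₁.prod I₂) p} {p : M₁ × M₂}
    (hσ : MDiffAt (T% σ) p) :
    MDifferentiableAt I₁ 𝓘(ℝ, E₂) (fun x : M₁ => (tsnd (x, p.2) (σ (x, p.2)) : E₂)) p.1 := by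
  have h1 : MDiffAt (fun x : M₁ => (x, p.2)) p.1 :=
    mdifferentiableAt_id.prodMk mdifferentiableAt_const
  have h2 := (contMDiff_equivTangentBundleProd (n := 1) (I := I₁) (I' := I₂) (M := M₁)
    (M' := M₂)).mdifferentiable one_ne_zero
  have h3 := (h2 _).snd.comp p.1 (hσ.comp p.1 h1)
  have h4 := ((mdifferentiableAt_totalSpace _ _).1 h3).2
  refine h4.congr_of_eventuallyEq (Filter.Eventually.of_forall fun x => ?_)
  exact (trivializationAt_self (I := I₂) p.2 (tsnd (x, p.2) (σ (x, p.2)))).symm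

/-- The operator of the product connection: for `u = (u₁, u₂)` tangent at `p = (x, y)`, the
`M₁`-component of `∇_u σ` is `∇¹_{u₁} σ₁(·, y) + d/du₂ σ₁(x, ·)`, and symmetrically for `M₂`. -/
def prodFun (cov₁ : CovariantDerivative I₁ E₁ (TangentSpace I₁ : M₁ → Type _))
    (cov₂ : CovariantDerivative I₂ E₂ (TangentSpace I₂ : M₂ → Type _))
    (σ : Π p : M₁ × M₂, TangentSpace (I₁.prod I₂) p) (p : M₁ × M₂) :
    TangentSpace (I₁.prod I₂) p →L[ℝ] TangentSpace (I₁.prod I₂) p :=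
  (tinl p).comp ((cov₁ (fun x => tfst (x, p.2) (σ (x, p.2))) p.1).comp (tfst p) +
    (dFiberFst σ p).comp (tsnd p)) +
  (tinr p).comp ((cov₂ (fun y => tsnd (p.1, y) (σ (p.1, y))) p.2).comp (tsnd p) +
    (dFiberSnd σ p).comp (tfst p))

theorem isCovariantDerivativeOn_prodFun
    (cov₁ : CovariantDerivative I₁ E₁ (TangentSpace I₁ : M₁ → Type _))
    (cov₂ : CovariantDerivative I₂ E₂ (TangentSpace I₂ : M₂ → Type _)) :
    IsCovariantDerivativeOn (I := I₁.prod I₂) (E₁ × E₂) (prodFun cov₁ cov₂) where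
  add {σ σ' p} hσ hσ' _ := by
    have a1 := cov₁.isCovariantDerivativeOnUniv.add (mdiffAt_fst_slice hσ) (mdiffAt_fst_slice hσ')
    have a2 := cov₂.isCovariantDerivativeOnUniv.add (mdiffAt_snd_slice hσ) (mdiffAt_snd_slice hσ')
    have b1 : dFiberFst (σ + σ') p = dFiberFst σ p + dFiberFst σ' p :=
      mvfderiv_add (mdiffAt_fst_vertical hσ) (mdiffAt_fst_vertical hσ')
    have b2 : dFiberSnd (σ + σ') p = dFiberSnd σ p + dFiberSnd σ' p :=
      mvfderiv_add (mdiffAt_snd_vertical hσ) (mdiffAt_snd_vertical hσ')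
    have e1 : (fun x => tfst (x, p.2) ((σ + σ') (x, p.2))) =
        (fun x => tfst (x, p.2) (σ (x, p.2))) + fun x => tfst (x, p.2) (σ' (x, p.2)) := by
      funext x; exact map_add _ _ _
    have e2 : (fun y => tsnd (p.1, y) ((σ + σ') (p.1, y))) =
        (fun y => tsnd (p.1, y) (σ (p.1, y))) + fun y => tsnd (p.1, y) (σ' (p.1, y)) := by
      funext y; exact map_add _ _ _
    unfold prodFun
    rw [e1, e2, a1, a2, b1, b2]
    ext1 u
    simp only [add_apply, ContinuousLinearMap.comp_apply, map_add]
    abel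
  leibniz {σ g p} hσ hg _ := by
    have a1 := cov₁.isCovariantDerivativeOnUniv.leibniz (mdiffAt_fst_slice hσ) (mdiffAt_left hg)
    have a2 := cov₂.isCovariantDerivativeOnUniv.leibniz (mdiffAt_snd_slice hσ) (mdiffAt_right hg)
    have b1 : dFiberFst (g • σ) p = g p • dFiberFst σ p +
        (d% (fun y : M₂ => g (p.1, y)) p.2).smulRight (tfst p (σ p)) :=
      mvfderiv_smul (mdiffAt_right hg) (mdiffAt_fst_vertical hσ)
    have b2 : dFiberSnd (g • σ) p = g p • dFiberSnd σ p +
        (d% (fun x : M₁ => g (x, p.2)) p.1).smulRight (tsnd p (σ p)) :=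
      mvfderiv_smul (mdiffAt_left hg) (mdiffAt_snd_vertical hσ)
    have e1 : (fun x => tfst (x, p.2) ((g • σ) (x, p.2))) =
        (fun x => g (x, p.2)) • fun x => tfst (x, p.2) (σ (x, p.2)) := by
      funext x; exact (tfst (x, p.2)).map_smul (g (x, p.2)) (σ (x, p.2))
    have e2 : (fun y => tsnd (p.1, y) ((g • σ) (p.1, y))) =
        (fun y => g (p.1, y)) • fun y => tsnd (p.1, y) (σ (p.1, y)) := by
      funext y; exact (tsnd (p.1, y)).map_smul (g (p.1, y)) (σ (p.1, y))
    have hσp := tinl_add_tinr p (σ p)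
    ext1 u
    simp only [add_apply, smul_apply,
      ContinuousLinearMap.smulRight_apply]
    rw [mvfderiv_prod_apply hg u]
    conv_rhs => rw [← hσp]
    unfold prodFun
    rw [e1, e2, a1, a2, b1, b2]
    simp only [add_apply, ContinuousLinearMap.comp_apply, map_add,
      smul_apply, ContinuousLinearMap.smulRight_apply, map_smul]
    module

/-- The product connection `∇₁ × ∇₂` on `M₁ × M₂`. -/
def prodConnection (cov₁ : CovariantDerivative I₁ E₁ (TangentSpace I₁ : M₁ → Type _))
    (cov₂ : CovariantDerivative I₂ E₂ (TangentSpace I₂ : M₂ → Type _)) :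
    CovariantDerivative (I₁.prod I₂) (E₁ × E₂)
      (TangentSpace (I₁.prod I₂) : M₁ × M₂ → Type _) where
  toFun := prodFun cov₁ cov₂
  isCovariantDerivativeOnUniv := isCovariantDerivativeOn_prodFun cov₁ cov₂

end Product

end Geod

end

open Bundle Set Topology
open scoped Manifold ContDiff

noncomputable section

set_option linter.unusedSectionVars false

/-! ### Smooth dependence of solutions of ODEs on the initial value -/

namespace ContinuousMap

/-! Both hypotheses pass to products, and they make the space of geodesics of any manifold of
positive dimension a manifold. A geodesic of the product has geodesics as components. Leaving a box
`U₁ ×ˢ U₂` therefore means that some component leaves its factor and cannot return. Compact sets of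
the factors that control segments have a product that controls segments of the product
(`Nonreturning.prod`, `Pseudoconvex.prod`).

For a single manifold, let q be the projection from T'M to the space of geodesics. Two vectors have
the same image exactly when one is a nonzero multiple of a velocity of the maximal geodesic of the
other (`geodesicProj_eq_iff`). The maps "flow for time t, then multiply by c" are smooth near a
vector whose geodesic reaches time t, preserve the fibres of q, and move any vector to any other of
its fibre (`exists_local_map`). Hence q is open, and local data on T'M can be carried along its
fibres.

Charts come from transversals. In a chart at v₀, base points in a hyperplane and velocities in a
parallel affine hyperplane form a family of dimension 2n - 2, transverse to the flow and to scaling.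
By the inverse function theorem it parametrizes all nearby lines of vectors and geodesics; because
geodesics do not return, a small transversal meets each geodesic at most once
(`Nonreturning.exists_transversal`, `exists_localSlice`). The resulting slices glue to a smooth
structure for which q is a submersion (`exists_quotient_manifold`).

Hausdorffness uses both hypotheses (`t2Space_spaceOfGeodesics`). A nonconstant geodesic of a
nonreturning manifold leaves every compact set in both directions. Pseudoconvexity then bounds the
times at which nearby vectors can be related, so that being unrelated is an open condition by
compactness of a time interval. Paracompactness follows from second countability, and connectedness
from that of M.

All of this rests on a smooth geodesic flow with open domain, which is built from the local flow of
the spray. That local flow comes from the inverse function theorem on a space of continuous curves.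
-/

theorem exists_dist_comp_lt {K : Type*} [TopologicalSpace K] [CompactSpace K]
    {E F : Type*} [NormedAddCommGroup E] [NormedAddCommGroup F] (g : C(E, F)) (u : C(K, E)) {ε : ℝ} (hε : 0 < ε) :
    ∃ δ > 0, ∀ v : C(K, E), dist v u < δ → dist (g.comp v) (g.comp u) < ε :=
  Metric.continuous_iff.1 (ContinuousMap.continuous_postcomp g) u ε hε

set_option synthInstance.maxHeartbeats 200000

variable {K : Type*} [TopologicalSpace K] [CompactSpace K]
  {E F : Type*} [NormedAddCommGroup E] [NormedSpace ℝ E] [NormedAddCommGroup F] [NormedSpace ℝ F]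

/-- Pointwise application of a continuous family of operators to a continuous family of vectors. -/
def applyFun (A : C(K, E →L[ℝ] F)) (u : C(K, E)) : C(K, F) := ⟨fun s => A s (u s), by fun_prop⟩

/-- `ContinuousMap.applyFun` as a continuous bilinear map. -/
def applyL : C(K, E →L[ℝ] F) →L[ℝ] C(K, E) →L[ℝ] C(K, F) :=
  LinearMap.mkContinuous₂ (E := C(K, E →L[ℝ] F)) (F := C(K, E)) (G := C(K, F))
    (LinearMap.mk₂ ℝ applyFun
      (fun A B u => by ext; simp [applyFun]) (fun c A u => by ext; simp [applyFun])
      (fun A u v => by ext; simp [applyFun]) (fun c A u => by ext; simp [applyFun])) 1 <| by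
    intro A u
    rw [ContinuousMap.norm_le _ (by positivity)]
    intro s
    rw [one_mul]
    exact ((A s).le_opNorm _).trans (mul_le_mul (A.norm_coe_le_norm s) (u.norm_coe_le_norm s)
      (norm_nonneg _) (norm_nonneg A))

/-- The map `v ↦ fderiv ℝ f ∘ v` is continuous in the uniform norm, so the mean value estimate at
each parameter has the same error `ε * ‖k‖`. -/
theorem hasFDerivAt_comp_left {f : E → F} (hf : ContDiff ℝ 1 f) (u : C(K, E)) :
    HasFDerivAt (fun u : C(K, E) => (⟨f, hf.continuous⟩ : C(E, F)).comp u)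
      (applyL ((⟨fderiv ℝ f, hf.continuous_fderiv one_ne_zero⟩ : C(E, E →L[ℝ] F)).comp u)) u := by
  rw [hasFDerivAt_iff_isLittleO_nhds_zero, Asymptotics.isLittleO_iff]
  intro ε hε
  obtain ⟨δ, hδ, h⟩ := exists_dist_comp_lt
    (⟨fderiv ℝ f, hf.continuous_fderiv one_ne_zero⟩ : C(E, E →L[ℝ] F)) u hε
  filter_upwards [Metric.ball_mem_nhds 0 hδ] with k hk
  rw [mem_ball_zero_iff] at hk
  rw [ContinuousMap.norm_le _ (by positivity)]
  intro s
  have hd : ∀ θ ∈ Icc (0 : ℝ) 1,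
      ‖fderiv ℝ f (u s + θ • k s) - fderiv ℝ f (u s)‖ ≤ ε := by
    intro θ hθ
    have h1 : dist (u + θ • k) u < δ := by
      rw [dist_eq_norm, add_sub_cancel_left, norm_smul, Real.norm_of_nonneg hθ.1]
      exact (mul_le_of_le_one_left (norm_nonneg _) hθ.2).trans_lt hk
    have h2 := (h _ h1).le
    have h3 := (ContinuousMap.dist_apply_le_dist s).trans h2
    rwa [dist_eq_norm] at h3
  -- With the linear term subtracted, the increment of this function over `[0, 1]` is exactly the
  -- remainder of the first-order expansion.
  have hder : ∀ θ ∈ Icc (0 : ℝ) 1,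
      HasDerivWithinAt (fun θ : ℝ => f (u s + θ • k s) - θ • fderiv ℝ f (u s) (k s))
        (fderiv ℝ f (u s + θ • k s) (k s) - fderiv ℝ f (u s) (k s)) (Icc 0 1) θ := by
    intro θ _
    have h1 : HasDerivAt (fun θ : ℝ => u s + θ • k s) (k s) θ := by
      simpa using ((hasDerivAt_id θ).smul_const (k s)).const_add (u s)
    have h2 := ((hf.differentiable one_ne_zero _).hasFDerivAt.comp_hasDerivAt θ h1).sub
      ((hasDerivAt_id θ).smul_const (fderiv ℝ f (u s) (k s)))
    rw [one_smul] at h2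
    exact h2.hasDerivWithinAt
  have := norm_image_sub_le_of_norm_deriv_le_segment_01' hder (C := ε * ‖k‖) (by
    intro θ hθ
    exact (ContinuousLinearMap.le_opNorm
      (fderiv ℝ f (u s + θ • k s) - fderiv ℝ f (u s)) (k s)).trans (mul_le_mul (hd θ (Ico_subset_Icc_self hθ))
      (k.norm_coe_le_norm s) (norm_nonneg _) hε.le))
  simp only [one_smul, zero_smul, add_zero, sub_zero] at this
  have hs : f (u s + k s) - fderiv ℝ f (u s) (k s) - f (u s) =
      f (u s + k s) - f (u s) - fderiv ℝ f (u s) (k s) := by abel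
  rw [hs] at this
  exact this

/-- Induction on `n`: the derivative of composition with `f` is composition with `fderiv ℝ f`
followed by the continuous linear map `applyL`. The spaces share a universe so that the induction
hypothesis applies to the target `E →L[ℝ] F`. -/
theorem contDiff_comp_left_nat {K : Type*} [TopologicalSpace K] [CompactSpace K]
    {E : Type u} [NormedAddCommGroup E] [NormedSpace ℝ E] (n : ℕ) :
    ∀ {F : Type u} [NormedAddCommGroup F] [NormedSpace ℝ F] {f : E → F} (hf : ContDiff ℝ n f),
    ContDiff ℝ n (fun u : C(K, E) => (⟨f, hf.continuous⟩ : C(E, F)).comp u) := by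
  induction n with
  | zero =>
    intro F _ _ f hf
    exact contDiff_zero.2 (ContinuousMap.continuous_postcomp _)
  | succ n ih =>
    intro F _ _ f hf
    have hf1 : ContDiff ℝ 1 f := hf.of_le (by exact_mod_cast Nat.le_add_left 1 n)
    have hf' : ContDiff ℝ n (fderiv ℝ f) := hf.fderiv_right (m := n) le_rfl
    push_cast
    rw [contDiff_succ_iff_hasFDerivAt]
    refine ⟨fun u => applyL ((⟨fderiv ℝ f, hf'.continuous⟩ : C(E, E →L[ℝ] F)).comp u), ?_,
      fun u => hasFDerivAt_comp_left hf1 u⟩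
    exact applyL.contDiff.comp (ih hf')

/-- Composition from the left with a smooth map is smooth on spaces of continuous maps. -/
theorem contDiff_comp_left {K : Type*} [TopologicalSpace K] [CompactSpace K]
    {E F : Type u} [NormedAddCommGroup E] [NormedSpace ℝ E]
    [NormedAddCommGroup F] [NormedSpace ℝ F] {f : E → F} (hf : ContDiff ℝ ∞ f) :
    ContDiff ℝ ∞ (fun u : C(K, E) => (⟨f, hf.continuous⟩ : C(E, F)).comp u) :=
  contDiff_infty.2 fun n => contDiff_comp_left_nat n (contDiff_infty.1 hf n)

end ContinuousMap

/-! ### The local flow of a smooth vector field on a vector space -/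

namespace SmoothFlow

/-- The time interval `[-1, 1]`. -/
abbrev UI : Type := Icc (-1 : ℝ) 1

theorem neg_one_le_one : (-1 : ℝ) ≤ 1 := by norm_num

section

variable {E : Type*} [NormedAddCommGroup E]

/-- The extension of a curve on `[-1, 1]` by constants. -/
abbrev ext (g : C(UI, E)) : ℝ → E := g.IccExtend neg_one_le_one

theorem ext_continuous (g : C(UI, E)) : Continuous (ext g) :=
  (g.IccExtend neg_one_le_one).continuous

theorem ext_apply (g : C(UI, E)) (s : UI) : ext g s = g s := by
  simp [ext, ContinuousMap.IccExtend, IccExtend]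

theorem norm_ext_le (g : C(UI, E)) (s : ℝ) : ‖ext g s‖ ≤ ‖g‖ := g.norm_coe_le_norm _

/-- A curve is reparametrized by the multiplication with `r`. -/
def rescale (r : ℝ) (hr : |r| ≤ 1) (u : C(UI, E)) : C(UI, E) :=
  ⟨fun s => u ⟨r * s, abs_le.1 <| by
    rw [abs_mul]; exact mul_le_one₀ hr (abs_nonneg _) (abs_le.2 s.2)⟩, by fun_prop⟩

theorem ext_rescale (r : ℝ) (hr : |r| ≤ 1) (u : C(UI, E)) {s : ℝ} (hs : s ∈ Icc (-1 : ℝ) 1) :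
    ext (rescale r hr u) s = ext u (r * s) := by
  have h : r * s ∈ Icc (-1 : ℝ) 1 := abs_le.1 <| by
    rw [abs_mul]; exact mul_le_one₀ hr (abs_nonneg _) (abs_le.2 hs)
  rw [ext_apply _ ⟨s, hs⟩, ext_apply u ⟨r * s, h⟩]
  rfl

end

section

variable {E : Type*} [NormedAddCommGroup E] [NormedSpace ℝ E]

theorem continuous_integral_ext (g : C(UI, E)) :
    Continuous fun s : ℝ => ∫ σ in (0 : ℝ)..s, ext g σ :=
  intervalIntegral.continuous_primitive
    (fun a b => (ext_continuous g).intervalIntegrable a b) 0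

/-- The integration operator `g ↦ ∫₀ˢ g` on curves on `[-1, 1]`. -/
def integral : C(UI, E) →L[ℝ] C(UI, E) :=
  LinearMap.mkContinuous
    { toFun := fun g => ⟨fun s : UI => ∫ σ in (0 : ℝ)..s, ext g σ,
        (continuous_integral_ext g).comp continuous_subtype_val⟩
      map_add' := fun g g' => by
        ext s
        exact intervalIntegral.integral_add ((ext_continuous g).intervalIntegrable _ _)
          ((ext_continuous g').intervalIntegrable _ _)
      map_smul' := fun c g => by
        ext s
        exact intervalIntegral.integral_smul c _ } 1 <| by
    intro g
    rw [ContinuousMap.norm_le _ (by positivity)]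
    intro s
    have h := intervalIntegral.norm_integral_le_of_norm_le_const (a := 0) (b := s) (f := ext g)
      (C := ‖g‖) fun σ _ => norm_ext_le g σ
    refine h.trans ?_
    rw [one_mul, sub_zero]
    exact mul_le_of_le_one_right (norm_nonneg _) (abs_le.2 s.2)

theorem integral_apply (g : C(UI, E)) (s : UI) : integral g s = ∫ σ in (0 : ℝ)..s, ext g σ := rfl

/-- The substitution `σ ↦ r * σ`. It makes the rescaling of a solution of the integral equation a
solution for the proportionally shorter time. -/
theorem smul_integral_comp_rescale (g : C(E, E)) (r : ℝ) (hr : |r| ≤ 1) (u : C(UI, E)) (s : UI) :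
    r • integral (g.comp (rescale r hr u)) s = ∫ σ in (0 : ℝ)..(r * s), ext (g.comp u) σ := by
  rw [integral_apply]
  have h : ∫ σ in (0 : ℝ)..s, ext (g.comp (rescale r hr u)) σ =
      ∫ σ in (0 : ℝ)..s, ext (g.comp u) (r * σ) := by
    refine intervalIntegral.integral_congr fun σ hσ => ?_
    have hσ' : σ ∈ Icc (-1 : ℝ) 1 := by
      refine (uIcc_subset_Icc ?_ s.2) hσ
      exact ⟨by norm_num, by norm_num⟩
    change g (ext (rescale r hr u) σ) = g (ext u (r * σ))
    rw [ext_rescale r hr u hσ']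
  rw [h, intervalIntegral.smul_integral_comp_mul_left, mul_zero]

end

/-- The smooth flow of a smooth vector field near a point. -/
theorem exists_flow_of_contDiff {E : Type u} [NormedAddCommGroup E] [NormedSpace ℝ E]
    [CompleteSpace E] {f : E → E} (hf : ContDiff ℝ ∞ f) (x₀ : E) :
    ∃ ε > 0, ∃ r > 0, ∃ Φ : ℝ × E → E,
      ContDiffOn ℝ ∞ Φ (Ioo (-ε) ε ×ˢ Metric.ball x₀ r) ∧
      ∀ x ∈ Metric.ball x₀ r, Φ (0, x) = x ∧
        ∀ t ∈ Ioo (-ε) ε, HasDerivAt (fun t => Φ (t, x)) (f (Φ (t, x))) t := by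
  let f' : C(E, E) := ⟨f, hf.continuous⟩
  let X := C(UI, E)
  let N : X → X := fun u => f'.comp u
  have hN : ContDiff ℝ ∞ N := ContinuousMap.contDiff_comp_left hf
  -- The equation `G (τ, u) = (τ, c x)` says `u s = x + τ ∫₀ˢ f (u)`, so `u s` is the solution from
  -- `x` at time `τ * s`. Time has become a parameter and all curves live on the same interval, so
  -- one inverse function theorem gives smoothness in time and initial value together.
  let G : ℝ × X → ℝ × X := fun p => (p.1, p.2 - p.1 • integral (N p.2))
  have hG : ContDiff ℝ ∞ G :=
    contDiff_fst.prodMk (contDiff_snd.sub (contDiff_fst.smul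
      (integral.contDiff.comp (hN.comp contDiff_snd))))
  let c : E →L[ℝ] X := ContinuousLinearMap.const ℝ UI
  have hc : ∀ x s, c x s = x := fun _ _ => rfl
  let p₀ : ℝ × X := (0, c x₀)
  -- At `τ = 0` the integral term contributes only through its derivative in `τ`. The derivative of
  -- `G` is thus triangular with identities on the diagonal, and invertible.
  let A : (ℝ × X) ≃L[ℝ] (ℝ × X) := ContinuousLinearEquiv.skewProd
    (ContinuousLinearEquiv.refl ℝ ℝ) (ContinuousLinearEquiv.refl ℝ X)
    (-(ContinuousLinearMap.id ℝ ℝ).smulRight (integral (N (c x₀))))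
  have hA : HasFDerivAt G (A : (ℝ × X) →L[ℝ] (ℝ × X)) p₀ := by
    have h1 : HasFDerivAt (fun p : ℝ × X => integral (N p.2))
        (fderiv ℝ (fun p : ℝ × X => integral (N p.2)) p₀) p₀ :=
      (((integral (E := E)).contDiff.comp (n := ∞)
        (hN.comp (contDiff_snd (E := ℝ)))).differentiable (by simp) p₀).hasFDerivAt
    have h2 := hasFDerivAt_fst (𝕜 := ℝ) (p := p₀) |>.prodMk
      ((hasFDerivAt_snd (𝕜 := ℝ) (p := p₀)).sub ((hasFDerivAt_fst (𝕜 := ℝ) (p := p₀)).smul h1))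
    refine h2.congr_fderiv ?_
    ext1
    · ext <;> simp [A, p₀]
    · ext <;> simp [A, p₀]
  let h := hG.contDiffAt.toOpenPartialHomeomorph G hA (by simp)
  have hh : ∀ q, h q = G q := fun q => rfl
  have hp₀ : G p₀ = p₀ := by simp [G, p₀]
  have hGd : Continuous (fderiv ℝ G) := hG.continuous_fderiv (by simp)
  -- The inverse of `G` is smooth wherever the derivative of `G` is invertible. This is an open
  -- condition, and `δ` is chosen so that it holds on the whole ball.
  have hD : IsOpen (fderiv ℝ G ⁻¹' range ContinuousLinearEquiv.toContinuousLinearMap) :=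
    ContinuousLinearEquiv.isOpen.preimage hGd
  have hp₀D : p₀ ∈ fderiv ℝ G ⁻¹' range ContinuousLinearEquiv.toContinuousLinearMap :=
    ⟨A, hA.fderiv.symm⟩
  have hp₀s : p₀ ∈ h.source := hG.contDiffAt.mem_toOpenPartialHomeomorph_source hA (by simp)
  obtain ⟨δ, hδ, hδW⟩ := Metric.mem_nhds_iff.1
    (Filter.inter_mem (h.open_source.mem_nhds hp₀s) (hD.mem_nhds hp₀D))
  have hS : IsOpen (h.target ∩ h.symm ⁻¹' Metric.ball p₀ δ) :=
    h.isOpen_inter_preimage_symm Metric.isOpen_ball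
  have hp₀S : p₀ ∈ h.target ∩ h.symm ⁻¹' Metric.ball p₀ δ := by
    have h1 : h p₀ = p₀ := hp₀
    refine ⟨h1 ▸ h.map_source hp₀s, ?_⟩
    have h2 := h.left_inv hp₀s
    rw [h1] at h2
    rw [mem_preimage, h2]
    exact Metric.mem_ball_self hδ
  obtain ⟨η, hη, hηS⟩ := Metric.isOpen_iff.1 hS p₀ hp₀S
  have hmem : ∀ τ ∈ Ioo (-η) η, ∀ x ∈ Metric.ball x₀ η,
      (τ, c x) ∈ h.target ∩ h.symm ⁻¹' Metric.ball p₀ δ := by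
    intro τ hτ x hx
    refine hηS ?_
    rw [Metric.mem_ball, Prod.dist_eq, max_lt_iff]
    refine ⟨?_, (ContinuousMap.dist_lt_iff hη).2 fun s => hx⟩
    simpa [p₀, abs_lt] using hτ
  have hsol : ∀ τ ∈ Ioo (-η) η, ∀ x ∈ Metric.ball x₀ η, (h.symm (τ, c x)).1 = τ ∧
      (h.symm (τ, c x)).2 - τ • integral (N (h.symm (τ, c x)).2) = c x := by
    intro τ hτ x hx
    have h1 := h.right_inv (hmem τ hτ x hx).1
    rw [hh] at h1
    have h2 : (h.symm (τ, c x)).1 = τ := congrArg Prod.fst h1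
    have h3 := congrArg Prod.snd h1
    refine ⟨h2, ?_⟩
    nth_rw 2 [← h2]
    exact h3
  have huniq : ∀ τ x v, (τ, v) ∈ Metric.ball p₀ δ → v - τ • integral (N v) = c x →
      h.symm (τ, c x) = (τ, v) := by
    intro τ x v hv he
    have h1 : h (τ, v) = (τ, c x) := by rw [hh, ← he]
    rw [← h1, h.left_inv (hδW hv).1]
  let one : UI := ⟨1, by norm_num, le_rfl⟩
  refine ⟨η, hη, η, hη, fun p => (h.symm (p.1, c p.2)).2 one, ?_, ?_⟩
  · rintro ⟨τ, x⟩ ⟨hτ, hx⟩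
    have h1 := hmem τ hτ x hx
    obtain ⟨B, hB⟩ := (hδW h1.2).2
    have h2 : ContDiffAt ℝ ∞ h.symm (τ, c x) := by
      refine h.contDiffAt_symm h1.1 (f₀' := B) ?_ hG.contDiffAt
      rw [hB]
      exact (hG.differentiable (by simp) _).hasFDerivAt
    have h3 : ContDiffAt ℝ ∞ (fun p : ℝ × E => (p.1, c p.2)) (τ, x) :=
      contDiffAt_fst.prodMk (c.contDiff.contDiffAt.comp _ contDiffAt_snd)
    have h4 : ContDiffAt ℝ ∞ (fun p : ℝ × E => (h.symm (p.1, c p.2)).2) (τ, x) :=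
      contDiffAt_snd.comp (τ, x) (ContDiffAt.comp (τ, x) h2 h3)
    exact ((ContinuousMap.evalCLM ℝ one).contDiff.contDiffAt.comp (τ, x) h4).contDiffWithinAt
  intro x hx
  have hval : ∀ τ ∈ Ioo (-η) η, ∀ s : UI, (h.symm (τ, c x)).2 s =
      x + τ • ∫ σ in (0 : ℝ)..s, ext (N (h.symm (τ, c x)).2) σ := by
    intro τ hτ s
    have h1 := sub_eq_iff_eq_add.1 (hsol τ hτ x hx).2
    have h2 := congrArg (fun v : X => v s) h1
    exact h2
  constructor
  · have h0 : (0 : ℝ) ∈ Ioo (-η) η := ⟨by linarith, hη⟩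
    simpa using hval 0 h0 one
  intro t₀ ht₀
  -- To differentiate in time, one solution `u` for a longer time `τ₁` is fixed. Its rescalings
  -- solve the equation for every `|t| < τ₁` and stay in the ball where `G` is injective, so they
  -- are the solutions selected by the inverse. Hence the flow at time `t` is `u (t / τ₁)`, an
  -- explicit integral.
  obtain ⟨τ₁, hτ₁, hτ₁η⟩ : ∃ τ₁, |t₀| < τ₁ ∧ τ₁ < η := exists_between (abs_lt.2 ht₀)
  have hτ₁0 : 0 < τ₁ := (abs_nonneg _).trans_lt hτ₁
  have hτ₁m : τ₁ ∈ Ioo (-η) η := ⟨by linarith, hτ₁η⟩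
  set u : X := (h.symm (τ₁, c x)).2 with hu
  have hball : (τ₁, u) ∈ Metric.ball p₀ δ := by
    have h1 := (hmem τ₁ hτ₁m x hx).2
    rw [mem_preimage] at h1
    have h2 : h.symm (τ₁, c x) = (τ₁, u) := Prod.ext (hsol τ₁ hτ₁m x hx).1 rfl
    rwa [h2] at h1
  have hEq : ∀ t ∈ Ioo (-τ₁) τ₁, (h.symm (t, c x)).2 one =
      x + τ₁ • ∫ σ in (0 : ℝ)..(t / τ₁), ext (N u) σ := by
    intro t ht
    have hr : |t / τ₁| ≤ 1 := by
      rw [abs_div, abs_of_pos hτ₁0]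
      exact (div_le_one hτ₁0).2 (abs_lt.2 ht).le
    have hv1 : (t, rescale (t / τ₁) hr u) ∈ Metric.ball p₀ δ := by
      rw [Metric.mem_ball, Prod.dist_eq, max_lt_iff] at hball ⊢
      constructor
      · have h1 : |τ₁| < δ := by simpa [p₀] using hball.1
        have h2 : |t| < δ := ((abs_lt.2 ht).trans_le (le_abs_self τ₁)).trans h1
        simpa [p₀] using h2
      · refine (ContinuousMap.dist_lt_iff hδ).2 fun s => ?_
        exact (ContinuousMap.dist_lt_iff hδ).1 hball.2 ⟨t / τ₁ * s, _⟩
    have hts : t = τ₁ * (t / τ₁) := by field_simp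
    have hv2 : rescale (t / τ₁) hr u - t • integral (N (rescale (t / τ₁) hr u)) = c x := by
      ext s
      have h1 := smul_integral_comp_rescale f' (t / τ₁) hr u s
      have h2 := hval τ₁ hτ₁m ⟨t / τ₁ * s, abs_le.1 <| by
        rw [abs_mul]; exact mul_le_one₀ hr (abs_nonneg _) (abs_le.2 s.2)⟩
      rw [← hu] at h2
      change rescale (t / τ₁) hr u s - t • integral (N (rescale (t / τ₁) hr u)) s = x
      have hsm : ∀ w : E, t • w = τ₁ • (t / τ₁) • w := fun w => by rw [smul_smul, ← hts]
      rw [hsm]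
      change u _ - τ₁ • (t / τ₁) • integral (f'.comp (rescale (t / τ₁) hr u)) s = x
      rw [h1, h2]
      exact add_sub_cancel_right _ _
    rw [huniq t x _ hv1 hv2]
    have h2 := hval τ₁ hτ₁m ⟨t / τ₁, abs_le.1 hr⟩
    rw [← hu] at h2
    rw [← h2]
    change u _ = _
    congr 1
    exact Subtype.ext (mul_one _)
  have ht₀' : t₀ ∈ Ioo (-τ₁) τ₁ := abs_lt.1 hτ₁
  have hder : HasDerivAt (fun t => x + τ₁ • ∫ σ in (0 : ℝ)..(t / τ₁), ext (N u) σ)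
      (ext (N u) (t₀ / τ₁)) t₀ := by
    have hcont := ext_continuous (N u)
    have h1 := intervalIntegral.integral_hasDerivAt_right
      (hcont.intervalIntegrable 0 (t₀ / τ₁)) (hcont.stronglyMeasurableAtFilter _ _)
      hcont.continuousAt
    have h2 := ((h1.scomp t₀ ((hasDerivAt_id t₀).div_const τ₁)).const_smul τ₁).const_add x
    rw [smul_smul, mul_one_div_cancel hτ₁0.ne', one_smul] at h2
    exact h2
  have hfin : ext (N u) (t₀ / τ₁) = f ((h.symm (t₀, c x)).2 one) := by
    have hr : |t₀ / τ₁| ≤ 1 := by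
      rw [abs_div, abs_of_pos hτ₁0]
      exact (div_le_one hτ₁0).2 hτ₁.le
    rw [hEq t₀ ht₀', ext_apply (N u) ⟨t₀ / τ₁, abs_le.1 hr⟩,
      ← hval τ₁ hτ₁m ⟨t₀ / τ₁, abs_le.1 hr⟩]
    rfl
  rw [hfin] at hder
  refine hder.congr_of_eventuallyEq ?_
  filter_upwards [isOpen_Ioo.mem_nhds ht₀'] with t ht using hEq t ht

/-- The smooth flow of a vector field that is smooth on an open set. -/
theorem exists_flow_of_contDiffOn {E : Type u} [NormedAddCommGroup E] [NormedSpace ℝ E]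
    [FiniteDimensional ℝ E] {f : E → E} {U : Set E} (hU : IsOpen U) (hf : ContDiffOn ℝ ∞ f U)
    {x₀ : E} (hx₀ : x₀ ∈ U) :
    ∃ ε > 0, ∃ V : Set E, IsOpen V ∧ x₀ ∈ V ∧ ∃ Φ : ℝ × E → E,
      ContDiffOn ℝ ∞ Φ (Ioo (-ε) ε ×ˢ V) ∧
      ∀ x ∈ V, Φ (0, x) = x ∧ ∀ t ∈ Ioo (-ε) ε, Φ (t, x) ∈ U ∧
        HasDerivAt (fun t => Φ (t, x)) (f (Φ (t, x))) t := by
  have : CompleteSpace E := FiniteDimensional.complete ℝ E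
  obtain ⟨R, hR, hRU⟩ := Metric.isOpen_iff.1 hU x₀ hx₀
  -- The bump is 1 on the ball of radius `R / 4`, to which the flow will be confined, and its
  -- support lies in `U`. So `b • f` is smooth everywhere, whatever `f` is outside `U`.
  let b : ContDiffBump x₀ := ⟨R / 4, R / 2, by positivity, by linarith⟩
  have hb : ∀ x ∈ Metric.ball x₀ (R / 4), b x = 1 := fun x hx =>
    b.one_of_mem_closedBall (Metric.ball_subset_closedBall hx)
  have hg : ContDiff ℝ ∞ fun x => b x • f x := by
    refine contDiff_iff_contDiffAt.2 fun x => ?_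
    by_cases hx : x ∈ U
    · exact b.contDiffAt.smul (hf.contDiffAt (hU.mem_nhds hx))
    · have hx' : x ∉ tsupport b := by
        rw [b.tsupport_eq]
        exact fun h => hx (hRU (Metric.closedBall_subset_ball (half_lt_self hR) h))
      refine (contDiffAt_const (c := (0 : E))).congr_of_eventuallyEq ?_
      filter_upwards [(isClosed_tsupport b).isOpen_compl.mem_nhds hx'] with y hy
      rw [image_eq_zero_of_notMem_tsupport hy, zero_smul]
  obtain ⟨ε, hε, r, hr, Φ, hΦ, hsol⟩ := exists_flow_of_contDiff hg x₀
  have hx₀r : x₀ ∈ Metric.ball x₀ r := Metric.mem_ball_self hr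
  have h0 : (0 : ℝ) ∈ Ioo (-ε) ε := ⟨by linarith, hε⟩
  have hopen : IsOpen ((Ioo (-ε) ε ×ˢ Metric.ball x₀ r) ∩ Φ ⁻¹' Metric.ball x₀ (R / 4)) :=
    hΦ.continuousOn.isOpen_inter_preimage (isOpen_Ioo.prod Metric.isOpen_ball) Metric.isOpen_ball
  have hmem : ((0 : ℝ), x₀) ∈ (Ioo (-ε) ε ×ˢ Metric.ball x₀ r) ∩ Φ ⁻¹' Metric.ball x₀ (R / 4) := by
    refine ⟨⟨h0, hx₀r⟩, ?_⟩
    rw [mem_preimage, (hsol x₀ hx₀r).1]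
    exact Metric.mem_ball_self (by positivity)
  obtain ⟨δ, hδ, hball⟩ := Metric.isOpen_iff.1 hopen _ hmem
  have hbox : ∀ t ∈ Ioo (-δ) δ, ∀ x ∈ Metric.ball x₀ δ,
      (t, x) ∈ (Ioo (-ε) ε ×ˢ Metric.ball x₀ r) ∩ Φ ⁻¹' Metric.ball x₀ (R / 4) := by
    intro t ht x hx
    refine hball ?_
    rw [Metric.mem_ball, Prod.dist_eq, max_lt_iff]
    exact ⟨by simpa [abs_lt] using ht, hx⟩
  have h0δ : (0 : ℝ) ∈ Ioo (-δ) δ := ⟨by linarith, hδ⟩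
  refine ⟨δ, hδ, Metric.ball x₀ δ, Metric.isOpen_ball, Metric.mem_ball_self hδ, Φ,
    hΦ.mono fun p hp => (hbox p.1 hp.1 p.2 hp.2).1, fun x hx => ?_⟩
  have hxr := (hbox 0 h0δ x hx).1.2
  refine ⟨(hsol x hxr).1, fun t ht => ?_⟩
  have h1 := hbox t ht x hx
  refine ⟨hRU (Metric.ball_subset_ball (by linarith) h1.2), ?_⟩
  have h2 := (hsol x hxr).2 t h1.1.1
  rwa [hb _ h1.2, one_smul] at h2

/-- Local uniqueness of integral curves of a vector field. -/
theorem eventuallyEq_of_hasDerivAt {E : Type*} [NormedAddCommGroup E] [NormedSpace ℝ E]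
    {f : E → E} {y z : ℝ → E} {t₀ : ℝ} (hf : ContDiffAt ℝ 1 f (y t₀))
    (hy : ∀ᶠ t in 𝓝 t₀, HasDerivAt y (f (y t)) t) (hz : ∀ᶠ t in 𝓝 t₀, HasDerivAt z (f (z t)) t)
    (h : y t₀ = z t₀) : y =ᶠ[𝓝 t₀] z := by
  obtain ⟨K, s, hs, hK⟩ := hf.exists_lipschitzOnWith
  have hys : ∀ᶠ t in 𝓝 t₀, y t ∈ s := hy.self_of_nhds.continuousAt.preimage_mem_nhds hs
  have hzs : ∀ᶠ t in 𝓝 t₀, z t ∈ s :=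
    hz.self_of_nhds.continuousAt.preimage_mem_nhds (by rwa [← h])
  exact ODE_solution_unique_of_eventually (v := fun _ => f) (s := fun _ => s) (K := K)
    (Filter.Eventually.of_forall fun _ => hK) (hy.and hys) (hz.and hzs) h

end SmoothFlow

/-! ### Coordinates of vectors and Christoffel symbols -/

namespace Geod

section LocalTheory

variable {E : Type*} [NormedAddCommGroup E] [NormedSpace ℝ E]
  {H : Type*} [TopologicalSpace H] {I : ModelWithCorners ℝ E H}
  {M : Type*} [TopologicalSpace M] [ChartedSpace H M] [IsManifold I ∞ M]

variable (I) in
/-- The coordinates with respect to the chart at `x₀` of a vector tangent at `y`. -/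
def coordL (x₀ y : M) : TangentSpace I y →L[ℝ] E :=
  (trivializationAt E (TangentSpace I : M → Type _) x₀).continuousLinearMapAt ℝ y

variable (I) in
/-- The vector at `y` with given coordinates with respect to the chart at `x₀`. -/
def constSec (x₀ : M) (ξ : E) (y : M) : TangentSpace I y :=
  (trivializationAt E (TangentSpace I : M → Type _) x₀).symmL ℝ y ξ

theorem trivializationAt_snd {x₀ y : M} (hy : y ∈ (chartAt H x₀).source) (v : TangentSpace I y) :
    (trivializationAt E (TangentSpace I : M → Type _) x₀ (⟨y, v⟩ : TangentBundle I M)).2 =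
      coordL I x₀ y v := by
  rw [coordL, Trivialization.continuousLinearMapAt_apply, Trivialization.linearMapAt_apply]
  simp [hy]

@[simp] theorem coordL_constSec {x₀ y : M} (hy : y ∈ (chartAt H x₀).source) (ξ : E) :
    coordL I x₀ y (constSec I x₀ ξ y) = ξ :=
  Trivialization.continuousLinearMapAt_symmL _ (by simpa using hy) ξ

@[simp] theorem constSec_coordL {x₀ y : M} (hy : y ∈ (chartAt H x₀).source)
    (v : TangentSpace I y) : constSec I x₀ (coordL I x₀ y v) y = v :=
  Trivialization.symmL_continuousLinearMapAt _ (by simpa using hy) v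

theorem coordL_injective {x₀ y : M} (hy : y ∈ (chartAt H x₀).source) :
    Function.Injective (coordL I x₀ y) := fun v w h => by
  rw [← constSec_coordL hy v, h, constSec_coordL hy]

theorem mdifferentiableAt_coordL {x₀ y : M} (hy : y ∈ (chartAt H x₀).source)
    {σ : Π y : M, TangentSpace I y} (hσ : MDiffAt (T% σ) y) :
    MDifferentiableAt I 𝓘(ℝ, E) (fun z => coordL I x₀ z (σ z)) y := by
  have h := ((trivializationAt E (TangentSpace I : M → Type _) x₀).mdifferentiableAt_section_iff
    (IB := I) σ (b₀ := y) (by simpa using hy)).1 hσ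
  refine h.congr_of_eventuallyEq ?_
  filter_upwards [(chartAt H x₀).open_source.mem_nhds hy] with z hz
  exact (trivializationAt_snd hz _).symm

theorem mdifferentiableAt_of_coordL {x₀ y : M} (hy : y ∈ (chartAt H x₀).source)
    {σ : Π y : M, TangentSpace I y}
    (hσ : MDifferentiableAt I 𝓘(ℝ, E) (fun z => coordL I x₀ z (σ z)) y) : MDiffAt (T% σ) y := by
  refine ((trivializationAt E (TangentSpace I : M → Type _) x₀).mdifferentiableAt_section_iff
    (IB := I) σ (b₀ := y) (by simpa using hy)).2 (hσ.congr_of_eventuallyEq ?_)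
  filter_upwards [(chartAt H x₀).open_source.mem_nhds hy] with z hz
  exact trivializationAt_snd hz _

/-- A section with differentiable coordinates is differentiable. -/
theorem mdifferentiableAt_constSec {x₀ y : M} (hy : y ∈ (chartAt H x₀).source) {g : M → E}
    (hg : MDifferentiableAt I 𝓘(ℝ, E) g y) : MDiffAt (T% fun z => constSec I x₀ (g z) z) y := by
  refine mdifferentiableAt_of_coordL hy (hg.congr_of_eventuallyEq ?_)
  filter_upwards [(chartAt H x₀).open_source.mem_nhds hy] with z hz
  exact coordL_constSec hz _

variable (I) in
/-- The flat connection of the chart at `x₀`. -/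
def flat (x₀ : M) (σ : Π y : M, TangentSpace I y) (y : M) : TangentSpace I y →L[ℝ] TangentSpace I y :=
  ((trivializationAt E (TangentSpace I : M → Type _) x₀).symmL ℝ y).comp
    (mvfderiv I (fun z => coordL I x₀ z (σ z)) y)

/-- Needed for the difference with another connection to be tensorial, which makes `christoffel` a
bilinear map at each point. -/
theorem isCovariantDerivativeOn_flat (x₀ : M) :
    IsCovariantDerivativeOn E (flat I x₀) (chartAt H x₀).source where
  add {σ σ' y} hσ hσ' hy := by
    have h : (fun z => coordL I x₀ z ((σ + σ') z)) =
        (fun z => coordL I x₀ z (σ z)) + fun z => coordL I x₀ z (σ' z) := by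
      funext z; exact map_add _ _ _
    unfold flat
    rw [h, mvfderiv_add (mdifferentiableAt_coordL hy hσ) (mdifferentiableAt_coordL hy hσ'),
      ContinuousLinearMap.comp_add]
  leibniz {σ g y} hσ hg hy := by
    have h : (fun z => coordL I x₀ z ((g • σ) z)) = g • fun z => coordL I x₀ z (σ z) := by
      funext z; exact (coordL I x₀ z).map_smul (g z) (σ z)
    unfold flat
    rw [h, mvfderiv_smul hg (mdifferentiableAt_coordL hy hσ)]
    ext u
    have h2 := constSec_coordL hy (σ y)
    rw [constSec] at h2
    simp [h2]

theorem flat_constSec {x₀ y : M} (hy : y ∈ (chartAt H x₀).source) (g : M → E) :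
    flat I x₀ (fun z => constSec I x₀ (g z) z) y =
      ((trivializationAt E (TangentSpace I : M → Type _) x₀).symmL ℝ y).comp (mvfderiv I g y) := by
  have h : (fun z => coordL I x₀ z (constSec I x₀ (g z) z)) =ᶠ[𝓝 y] g := by
    filter_upwards [(chartAt H x₀).open_source.mem_nhds hy] with z hz
    exact coordL_constSec hz _
  unfold flat mvfderiv
  rw [h.mfderiv_eq]
  rfl

variable [FiniteDimensional ℝ E]

variable (cov : CovariantDerivative I E (TangentSpace I : M → Type _))

/-- The difference between a connection and the flat connection of a chart. -/
def christoffel (x₀ y : M) : TangentSpace I y →L[ℝ] TangentSpace I y →L[ℝ] TangentSpace I y :=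
  (cov.isCovariantDerivativeOn (s := (chartAt H x₀).source)).difference
    (isCovariantDerivativeOn_flat x₀) y

theorem cov_eq_flat_add {x₀ y : M} (hy : y ∈ (chartAt H x₀).source)
    {σ : Π y : M, TangentSpace I y} (hσ : MDiffAt (T% σ) y) :
    cov σ y = flat I x₀ σ y + christoffel cov x₀ y (σ y) := by
  rw [christoffel, IsCovariantDerivativeOn.difference_apply _ _ hy hσ]
  abel

/-- The flat connection kills fields with constant components, so only the difference tensor
remains. -/
theorem cov_constSec {x₀ y : M} (hy : y ∈ (chartAt H x₀).source) (ξ : E) :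
    cov (constSec I x₀ ξ) y = christoffel cov x₀ y (constSec I x₀ ξ y) := by
  have h := mdifferentiableAt_constSec (I := I) hy (g := fun _ => ξ) mdifferentiableAt_const
  rw [cov_eq_flat_add cov hy h, flat_constSec hy (fun _ => ξ)]
  simp [mvfderiv]

end LocalTheory

end Geod

/-! ### The covariant derivative along a curve, in an arbitrary chart -/

namespace Geod

section Along

variable {E : Type*} [NormedAddCommGroup E] [NormedSpace ℝ E]
  {H : Type*} [TopologicalSpace H] {I : ModelWithCorners ℝ E H}
  {M : Type*} [TopologicalSpace M] [ChartedSpace H M] [IsManifold I ∞ M]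

theorem hasDerivAt_of_hasMFDerivAt {F : Type*} [NormedAddCommGroup F] [NormedSpace ℝ F]
    {f : ℝ → F} {t : ℝ} {f' : ℝ →L[ℝ] F} (h : HasMFDerivAt 𝓘(ℝ, ℝ) 𝓘(ℝ, F) f t f') :
    HasDerivAt f (f' 1) t := by
  have h2 : HasFDerivAt f f' t := hasMFDerivAt_iff_hasFDerivAt.1 h
  exact h2.hasDerivAt

theorem mdifferentiableAt_coordL_comp_symmL {x₀ x₁ p : M} (h₀ : p ∈ (chartAt H x₀).source)
    (h₁ : p ∈ (chartAt H x₁).source) :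
    MDifferentiableAt I 𝓘(ℝ, E →L[ℝ] E) (fun z => (coordL I x₀ z).comp
      ((trivializationAt E (TangentSpace I : M → Type _) x₁).symmL ℝ z)) p := by
  have h := mdifferentiableAt_coordChangeL (𝕜 := ℝ) (IB := I)
    (e := trivializationAt E (TangentSpace I : M → Type _) x₁)
    (e' := trivializationAt E (TangentSpace I : M → Type _) x₀) (x := p)
    (by simpa using h₁) (by simpa using h₀)
  refine h.congr_of_eventuallyEq ?_
  filter_upwards [(chartAt H x₀).open_source.mem_nhds h₀,
    (chartAt H x₁).open_source.mem_nhds h₁] with z hz₀ hz₁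
  ext ξ
  have h2 := Trivialization.coordChangeL_apply (R := ℝ)
    (trivializationAt E (TangentSpace I : M → Type _) x₁)
    (trivializationAt E (TangentSpace I : M → Type _) x₀) (b := z)
    ⟨by simpa using hz₁, by simpa using hz₀⟩ ξ
  change coordL I x₀ z (Trivialization.symmL ℝ _ z ξ) = _
  rw [← trivializationAt_snd hz₀, Trivialization.symmL_apply]
  · exact h2.symm
  · simpa using hz₁

theorem hasDerivAt_coordL {x₀ : M} {γ : ℝ → M} {t : ℝ} (h₀ : γ t ∈ (chartAt H x₀).source)
    {V : Π s : ℝ, TangentSpace I (γ s)}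
    (hV : MDifferentiableAt 𝓘(ℝ, ℝ) I.tangent (fun s => (⟨γ s, V s⟩ : TangentBundle I M)) t) :
    HasDerivAt (fun s => coordL I x₀ (γ s) (V s))
      (deriv (fun s => coordL I x₀ (γ s) (V s)) t) t := by
  have h := ((trivializationAt E (TangentSpace I : M → Type _) x₀).mdifferentiableAt_totalSpace_iff
    (IB := I) (fun s => (⟨γ s, V s⟩ : TangentBundle I M)) (x₀ := t) (by simpa using h₀)).1 hV
  have h2 : MDifferentiableAt 𝓘(ℝ, ℝ) 𝓘(ℝ, E) (fun s => coordL I x₀ (γ s) (V s)) t := by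
    refine h.2.congr_of_eventuallyEq ?_
    filter_upwards [h.1.continuousAt.preimage_mem_nhds ((chartAt H x₀).open_source.mem_nhds h₀)]
      with s hs
    exact (trivializationAt_snd hs _).symm
  exact h2.differentiableAt.hasDerivAt

theorem coordL_velocity {x₀ : M} {γ : ℝ → M} {t : ℝ} (h₀ : γ t ∈ (chartAt H x₀).source)
    (hγ : MDifferentiableAt 𝓘(ℝ, ℝ) I γ t) :
    HasDerivAt (fun s => extChartAt I x₀ (γ s)) (coordL I x₀ (γ t) (velocity I γ t)) t := by
  have h1 : MDifferentiableAt I 𝓘(ℝ, E) (extChartAt I x₀) (γ t) :=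
    mdifferentiableAt_extChartAt h₀
  have h2 := hasDerivAt_of_hasMFDerivAt (h1.hasMFDerivAt.comp t hγ.hasMFDerivAt)
  rw [coordL, TangentBundle.continuousLinearMapAt_trivializationAt h₀]
  exact h2

variable [FiniteDimensional ℝ E]

/-- The covariant derivative along a curve, computed in any chart. -/
theorem coordL_covDerivAlong (cov : CovariantDerivative I E (TangentSpace I : M → Type _))
    {x₀ : M} {γ : ℝ → M} {t : ℝ} (h₀ : γ t ∈ (chartAt H x₀).source)
    {V : Π s : ℝ, TangentSpace I (γ s)}
    (hV : MDifferentiableAt 𝓘(ℝ, ℝ) I.tangent (fun s => (⟨γ s, V s⟩ : TangentBundle I M)) t) :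
    coordL I x₀ (γ t) (covDerivAlong cov γ V t) =
      deriv (fun s => coordL I x₀ (γ s) (V s)) t +
        coordL I x₀ (γ t) (christoffel cov x₀ (γ t) (V t) (velocity I γ t)) := by
  -- The definition uses the chart at `γ t`; let `A` be the transition from it to the chart at `x₀`.
  -- The derivative of `A` along the velocity enters on one side through the product rule for the
  -- components of `V`, and on the other through the `x₀`-flat derivative of the field that is
  -- constant in the chart at `γ t`. The two terms agree.
  set p := γ t with hp
  have h₁ : p ∈ (chartAt H p).source := mem_chart_source H p
  have hγ : MDifferentiableAt 𝓘(ℝ, ℝ) I γ t :=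
    ((mdifferentiableAt_totalSpace I (fun s => (⟨γ s, V s⟩ : TangentBundle I M))).1 hV).1
  let e := trivializationAt E (TangentSpace I : M → Type _) p
  let A : M → E →L[ℝ] E := fun z => (coordL I x₀ z).comp (e.symmL ℝ z)
  have hA : MDifferentiableAt I 𝓘(ℝ, E →L[ℝ] E) A p :=
    mdifferentiableAt_coordL_comp_symmL h₀ h₁
  let A' : TangentSpace I p →L[ℝ] (E →L[ℝ] E) := mfderiv I 𝓘(ℝ, E →L[ℝ] E) A p
  have hA' : HasMFDerivAt I 𝓘(ℝ, E →L[ℝ] E) A p A' := hA.hasMFDerivAt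
  have hAγ : HasDerivAt (fun s => A (γ s)) (A' (velocity I γ t)) t :=
    hasDerivAt_of_hasMFDerivAt (hA'.comp t hγ.hasMFDerivAt)
  have hw := hasDerivAt_coordL (x₀ := p) h₁ hV
  set w' := deriv (fun s => coordL I p (γ s) (V s)) t with hw'
  have hprod := hAγ.clm_apply hw
  have hev : (fun s => coordL I x₀ (γ s) (V s)) =ᶠ[𝓝 t]
      fun s => A (γ s) (coordL I p (γ s) (V s)) := by
    filter_upwards [hγ.continuousAt.preimage_mem_nhds ((chartAt H p).open_source.mem_nhds h₁)]
      with s hs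
    change _ = coordL I x₀ (γ s) (constSec I p (coordL I p (γ s) (V s)) (γ s))
    rw [constSec_coordL hs]
  have hd := (hprod.congr_of_eventuallyEq hev).deriv
  rw [hd]
  have hcov : cov (constExtension p (V t)) p = flat I x₀ (constExtension p (V t)) p +
      christoffel cov x₀ p (V t) := by
    have h := mdifferentiableAt_constSec (I := I) (x₀ := p) h₁
      (g := fun _ => coordL I p p (V t)) mdifferentiableAt_const
    have h2 := cov_eq_flat_add cov h₀ h
    have h3 : constSec I p (coordL I p p (V t)) p = V t := constSec_coordL h₁ _
    rw [h3] at h2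
    exact h2
  have hflat : coordL I x₀ p (flat I x₀ (constExtension p (V t)) p (velocity I γ t)) =
      A' (velocity I γ t) (coordL I p p (V t)) := by
    have h1 : flat I x₀ (constExtension p (V t)) p (velocity I γ t) =
      constSec I x₀ (mvfderiv I (fun z => A z (coordL I p p (V t))) p (velocity I γ t)) p := rfl
    rw [h1, coordL_constSec h₀]
    have h2 : HasMFDerivAt I 𝓘(ℝ, E) (fun z => A z (coordL I p p (V t))) p
        ((ContinuousLinearMap.apply ℝ E (coordL I p p (V t))).comp A') :=
      (ContinuousLinearMap.apply ℝ E (coordL I p p (V t))).hasMFDerivAt.comp p hA'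
    rw [mvfderiv, h2.mfderiv]
    rfl
  have hdef : covDerivAlong cov γ V t = e.symmL ℝ p w' +
      cov (constExtension p (V t)) p (velocity I γ t) := by
    have h1 : deriv (fun s => (e (⟨γ s, V s⟩ : TangentBundle I M)).2) t = w' := by
      rw [hw']
      refine Filter.EventuallyEq.deriv_eq ?_
      filter_upwards [hγ.continuousAt.preimage_mem_nhds ((chartAt H p).open_source.mem_nhds h₁)]
        with s hs
      exact trivializationAt_snd hs _
    rw [← h1]
    rfl
  rw [hdef, map_add, hcov, add_apply, map_add, hflat]
  change A p w' + (A' (velocity I γ t) (coordL I p p (V t)) + _) =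
    A' (velocity I γ t) (coordL I p p (V t)) + A p w' + _
  abel

end Along

end Geod

/-! ### Charts of the tangent bundle and velocity curves -/

namespace Geod

section Coordinates

variable {E : Type*} [NormedAddCommGroup E] [NormedSpace ℝ E]
  {H : Type*} [TopologicalSpace H] {I : ModelWithCorners ℝ E H}
  {M : Type*} [TopologicalSpace M] [ChartedSpace H M] [IsManifold I ∞ M]

variable (I) in
/-- The velocity curve of `γ` in the tangent bundle. -/
def lift (γ : ℝ → M) (t : ℝ) : TangentBundle I M := ⟨γ t, velocity I γ t⟩

variable (I) in
/-- The coordinates of a tangent vector in the chart at `x₀`. -/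
def tcoord (x₀ : M) (v : TangentBundle I M) : E × E := (extChartAt I x₀ v.1, coordL I x₀ v.1 v.2)

variable (I) in
/-- The tangent vector with given coordinates in the chart at `x₀`. -/
def tpoint (x₀ : M) (p : E × E) : TangentBundle I M :=
  ⟨(extChartAt I x₀).symm p.1, constSec I x₀ p.2 ((extChartAt I x₀).symm p.1)⟩

theorem extChartAt_symm_mem {x₀ : M} {z : E} (hz : z ∈ (extChartAt I x₀).target) :
    (extChartAt I x₀).symm z ∈ (chartAt H x₀).source := by
  rw [← extChartAt_source I]
  exact (extChartAt I x₀).map_target hz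

theorem tcoord_tpoint {x₀ : M} {p : E × E} (hp : p.1 ∈ (extChartAt I x₀).target) :
    tcoord I x₀ (tpoint I x₀ p) = p := by
  refine Prod.ext ?_ ?_
  · exact (extChartAt I x₀).right_inv hp
  · exact coordL_constSec (extChartAt_symm_mem hp) _

theorem tpoint_tcoord {x₀ : M} {v : TangentBundle I M} (hv : v.1 ∈ (chartAt H x₀).source) :
    tpoint I x₀ (tcoord I x₀ v) = v := by
  obtain ⟨y, v⟩ := v
  have h : (extChartAt I x₀).symm (extChartAt I x₀ y) = y :=
    (extChartAt I x₀).left_inv (by rwa [extChartAt_source])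
  unfold tpoint tcoord
  dsimp only at hv ⊢
  rw [h, constSec_coordL hv]

theorem tcoord_injOn {x₀ : M} {v w : TangentBundle I M} (hv : v.1 ∈ (chartAt H x₀).source)
    (hw : w.1 ∈ (chartAt H x₀).source) (h : tcoord I x₀ v = tcoord I x₀ w) : v = w := by
  rw [← tpoint_tcoord hv, h, tpoint_tcoord hw]

theorem contMDiffAt_tcoord {x₀ : M} {v : TangentBundle I M} (hv : v.1 ∈ (chartAt H x₀).source) :
    ContMDiffAt I.tangent 𝓘(ℝ, E × E) ∞ (tcoord I x₀) v := by
  have h := ((trivializationAt E (TangentSpace I : M → Type _) x₀).contMDiffAt_iff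
    (IB := I) (n := ∞) (IM := I.tangent)
    (f := fun w : TangentBundle I M => w) (x₀ := v) (by simpa using hv)).1 contMDiffAt_id
  have h1 : ContMDiffAt I.tangent 𝓘(ℝ, E) ∞ (fun w : TangentBundle I M => extChartAt I x₀ w.1) v :=
    ContMDiffAt.comp v (contMDiffAt_extChartAt' hv) h.1
  have h2 := h1.prodMk_space h.2
  refine h2.congr_of_eventuallyEq ?_
  filter_upwards [h.1.continuousAt.preimage_mem_nhds ((chartAt H x₀).open_source.mem_nhds hv)]
    with w hw
  exact Prod.ext rfl (trivializationAt_snd hw _).symm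

/-- A map to the tangent bundle is smooth if it is smooth in coordinates. -/
theorem contMDiffAt_tangent {EN HN N : Type*} [NormedAddCommGroup EN] [NormedSpace ℝ EN]
    [TopologicalSpace HN] {IN : ModelWithCorners ℝ EN HN} [TopologicalSpace N] [ChartedSpace HN N]
    {x₀ : M} {f : N → TangentBundle I M} {q : N} (hf : (f q).1 ∈ (chartAt H x₀).source)
    (h1 : ContMDiffAt IN I ∞ (fun s => (f s).1) q)
    (h2 : ContMDiffAt IN 𝓘(ℝ, E) ∞ (fun s => coordL I x₀ (f s).1 (f s).2) q) :
    ContMDiffAt IN I.tangent ∞ f q := by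
  refine ((trivializationAt E (TangentSpace I : M → Type _) x₀).contMDiffAt_iff
    (IB := I) (n := ∞) (IM := IN) (f := f) (x₀ := q) (by simpa using hf)).2
    ⟨h1, h2.congr_of_eventuallyEq ?_⟩
  filter_upwards [h1.continuousAt.preimage_mem_nhds ((chartAt H x₀).open_source.mem_nhds hf)]
    with w hw
  exact trivializationAt_snd hw _

theorem contMDiffAt_tpoint [I.Boundaryless] {x₀ : M} {p : E × E}
    (hp : p.1 ∈ (extChartAt I x₀).target) :
    ContMDiffAt 𝓘(ℝ, E × E) I.tangent ∞ (tpoint I x₀) p := by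
  have hopen := isOpen_extChartAt_target (I := I) x₀
  have h1 : ContMDiffAt 𝓘(ℝ, E × E) I ∞ (fun q : E × E => (tpoint I x₀ q).1) p :=
    ContMDiffAt.comp (I' := 𝓘(ℝ, E)) (g := (extChartAt I x₀).symm) p
      ((contMDiffOn_extChartAt_symm (n := ∞) x₀).contMDiffAt (hopen.mem_nhds hp))
      contDiffAt_fst.contMDiffAt
  refine contMDiffAt_tangent (x₀ := x₀) (q := p) (f := tpoint I x₀) (extChartAt_symm_mem hp) h1 ?_
  have h2 : ContMDiffAt 𝓘(ℝ, E × E) 𝓘(ℝ, E) ∞ (fun q : E × E => q.2) p :=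
    contDiffAt_snd.contMDiffAt
  refine h2.congr_of_eventuallyEq ?_
  filter_upwards [(hopen.preimage continuous_fst).mem_nhds hp] with q hq
  exact coordL_constSec (extChartAt_symm_mem hq) _

theorem coordL_velocity_eq_deriv {x₀ : M} {γ : ℝ → M} {t : ℝ} {n : ℕ∞ω} (hn : n ≠ 0)
    (h₀ : γ t ∈ (chartAt H x₀).source) (hγ : ContMDiffAt 𝓘(ℝ, ℝ) I n γ t) :
    coordL I x₀ (γ t) (velocity I γ t) = deriv (fun s => extChartAt I x₀ (γ s)) t :=
  (coordL_velocity h₀ (hγ.mdifferentiableAt hn)).deriv.symm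

theorem contMDiffAt_lift {γ : ℝ → M} {J : Set ℝ} (hJ : IsOpen J)
    (hγ : ContMDiffOn 𝓘(ℝ, ℝ) I ∞ γ J) {t : ℝ} (ht : t ∈ J) :
    ContMDiffAt 𝓘(ℝ, ℝ) I.tangent ∞ (lift I γ) t := by
  have h0 := hγ.contMDiffAt (hJ.mem_nhds ht)
  have hs := mem_chart_source H (γ t)
  refine contMDiffAt_tangent (x₀ := γ t) hs h0 ?_
  have h1 : ContMDiffAt 𝓘(ℝ, ℝ) 𝓘(ℝ, E) ∞ (fun s => extChartAt I (γ t) (γ s)) t :=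
    ContMDiffAt.comp t (contMDiffAt_extChartAt' hs) h0
  have h2 : ContDiffAt ℝ ∞ (deriv fun s => extChartAt I (γ t) (γ s)) t :=
    ContDiffAt.derivWithin (n := ∞) (contMDiffAt_iff_contDiffAt.1 h1) le_rfl
  refine h2.contMDiffAt.congr_of_eventuallyEq ?_
  filter_upwards [h0.continuousAt.preimage_mem_nhds ((chartAt H (γ t)).open_source.mem_nhds hs),
    hJ.mem_nhds ht] with s hs hsJ
  exact coordL_velocity_eq_deriv (n := ∞) (by simp) hs (hγ.contMDiffAt (hJ.mem_nhds hsJ))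

end Coordinates

end Geod

/-! ### The geodesic spray in a chart -/

namespace Geod

section Spray

variable {E : Type*} [NormedAddCommGroup E] [NormedSpace ℝ E] [FiniteDimensional ℝ E]
  {H : Type*} [TopologicalSpace H] {I : ModelWithCorners ℝ E H}
  {M : Type*} [TopologicalSpace M] [ChartedSpace H M] [IsManifold I ∞ M]
  (cov : CovariantDerivative I E (TangentSpace I : M → Type _))

/-- The Christoffel symbols of a connection are smooth functions in each chart. -/
def SmoothSymbols : Prop :=
  ∀ (x₀ : M) (ξ η : E), ContMDiffOn I 𝓘(ℝ, E) ∞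
    (fun y => coordL I x₀ y (cov (constSec I x₀ ξ) y (constSec I x₀ η y))) (chartAt H x₀).source

/-- The Christoffel symbols in the chart at `x₀`, as functions of the coordinates. -/
def symbols (x₀ : M) (z ξ η : E) : E :=
  coordL I x₀ ((extChartAt I x₀).symm z) (christoffel cov x₀ ((extChartAt I x₀).symm z)
    (constSec I x₀ ξ ((extChartAt I x₀).symm z)) (constSec I x₀ η ((extChartAt I x₀).symm z)))

/-- The geodesic spray in the chart at `x₀`. -/
def sprayField (x₀ : M) (p : E × E) : E × E := (p.2, -symbols cov x₀ p.1 p.2 p.2)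

variable {cov}

theorem contDiffOn_symbols (hcov : SmoothSymbols cov) (x₀ : M) (ξ η : E) :
    ContDiffOn ℝ ∞ (fun z => symbols cov x₀ z ξ η) (extChartAt I x₀).target := by
  have h := (hcov x₀ ξ η).comp (contMDiffOn_extChartAt_symm (n := ∞) (I := I) x₀)
    fun z hz => extChartAt_symm_mem hz
  refine (contMDiffOn_iff_contDiffOn.1 h).congr fun z hz => ?_
  change _ = coordL I x₀ _ (cov (constSec I x₀ ξ) _ (constSec I x₀ η _))
  rw [cov_constSec cov (extChartAt_symm_mem hz)]
  rfl

/-- `SmoothSymbols` concerns fixed vectors only. Expanding the velocity in a basis gives smoothness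
in position and velocity jointly, as a quadratic polynomial in the velocity with smooth
coefficients. Only the diagonal enters the spray, so torsion plays no part. -/
theorem symbols_eq_sum (x₀ : M) (z ξ : E) :
    symbols cov x₀ z ξ ξ = ∑ i, ∑ j, ((Module.finBasis ℝ E).repr ξ i *
      (Module.finBasis ℝ E).repr ξ j) •
        symbols cov x₀ z (Module.finBasis ℝ E i) (Module.finBasis ℝ E j) := by
  conv_lhs => rw [← (Module.finBasis ℝ E).sum_repr ξ]
  simp only [symbols, constSec, map_sum, map_smul, sum_apply, Finset.smul_sum,
    smul_apply, mul_smul]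
  rw [Finset.sum_comm]
  simp only [smul_smul, mul_comm]

theorem contDiffOn_sprayField (hcov : SmoothSymbols cov) (x₀ : M) :
    ContDiffOn ℝ ∞ (sprayField cov x₀) ((extChartAt I x₀).target ×ˢ univ) := by
  refine contDiff_snd.contDiffOn.prodMk (ContDiffOn.neg ?_)
  simp only [symbols_eq_sum]
  refine ContDiffOn.sum fun i _ => ContDiffOn.sum fun j _ => ContDiffOn.smul ?_ ?_
  · have h : ∀ i, ContDiff ℝ ∞ fun p : E × E => (Module.finBasis ℝ E).repr p.2 i := fun i =>
      (LinearMap.toContinuousLinearMap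
        ((Module.finBasis ℝ E).coord i ∘ₗ LinearMap.snd ℝ E E)).contDiff
    exact ((h i).mul (h j)).contDiffOn
  · exact (contDiffOn_symbols hcov x₀ _ _).comp contDiff_fst.contDiffOn fun p hp => hp.1

theorem sprayField_tcoord {x₀ p : M} (hp : p ∈ (chartAt H x₀).source) (u : TangentSpace I p) :
    sprayField cov x₀ (tcoord I x₀ ⟨p, u⟩) =
      (coordL I x₀ p u, -coordL I x₀ p (christoffel cov x₀ p u u)) := by
  have h5 : (extChartAt I x₀).symm (extChartAt I x₀ p) = p :=
    (extChartAt I x₀).left_inv (by rwa [extChartAt_source])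
  simp only [sprayField, symbols, tcoord]
  rw [h5, constSec_coordL hp]
  rfl

/-- The geodesic equation as a first-order system: the position component is the definition of
velocity, the velocity component is `coordL_covDerivAlong` with vanishing left side. Any chart
around the point may be used, not only the preferred one. -/
theorem IsGeodesicOn.hasDerivAt {γ : ℝ → M} {J : Set ℝ} (hγ : IsGeodesicOn cov γ J) {x₀ : M}
    {t : ℝ} (ht : t ∈ J) (hx₀ : γ t ∈ (chartAt H x₀).source) :
    HasDerivAt (fun s => tcoord I x₀ (lift I γ s)) (sprayField cov x₀ (tcoord I x₀ (lift I γ t)))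
      t := by
  have h0 := hγ.contMDiffOn.contMDiffAt (hγ.isOpen.mem_nhds ht)
  have hl := (contMDiffAt_lift hγ.isOpen hγ.contMDiffOn ht).mdifferentiableAt (by simp)
  have h1 := coordL_velocity hx₀ (h0.mdifferentiableAt (by simp))
  have h2 := hasDerivAt_coordL (V := velocity I γ) hx₀ hl
  have h3 := coordL_covDerivAlong cov (V := velocity I γ) hx₀ hl
  rw [hγ.geodesic_eq t ht, map_zero] at h3
  rw [eq_neg_of_add_eq_zero_left h3.symm] at h2
  have h4 := h1.prodMk h2
  rw [← sprayField_tcoord hx₀] at h4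
  exact h4

/-- Solutions of the spray equation in a chart are geodesics. -/
theorem isGeodesicOn_of_hasDerivAt [I.Boundaryless] {x₀ : M} {y : ℝ → E × E} {J : Set ℝ}
    (hJ : IsOpen J) (hJc : J.OrdConnected) (hJn : J.Nonempty) (hy : ContDiffOn ℝ ∞ y J)
    (hyt : ∀ t ∈ J, (y t).1 ∈ (extChartAt I x₀).target)
    (hd : ∀ t ∈ J, HasDerivAt y (sprayField cov x₀ (y t)) t) :
    IsGeodesicOn cov (fun t => (tpoint I x₀ (y t)).1) J ∧
      ∀ t ∈ J, lift I (fun t => (tpoint I x₀ (y t)).1) t = tpoint I x₀ (y t) := by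
  set γ : ℝ → M := fun t => (tpoint I x₀ (y t)).1 with hγdef
  have hopen := isOpen_extChartAt_target (I := I) x₀
  have hγ : ContMDiffOn 𝓘(ℝ, ℝ) I ∞ γ J := by
    intro t ht
    have h1 : ContMDiffAt 𝓘(ℝ, ℝ) 𝓘(ℝ, E) ∞ (fun t => (y t).1) t :=
      (contDiffAt_fst.comp t (hy.contDiffAt (hJ.mem_nhds ht))).contMDiffAt
    exact (ContMDiffAt.comp (I' := 𝓘(ℝ, E)) (g := (extChartAt I x₀).symm) t
      ((contMDiffOn_extChartAt_symm (n := ∞) x₀).contMDiffAt (hopen.mem_nhds (hyt t ht)))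
        h1).contMDiffWithinAt
  have hsrc : ∀ t ∈ J, γ t ∈ (chartAt H x₀).source := fun t ht => extChartAt_symm_mem (hyt t ht)
  have hext : ∀ t ∈ J, extChartAt I x₀ (γ t) = (y t).1 := fun t ht =>
    (extChartAt I x₀).right_inv (hyt t ht)
  -- The position component of the spray equation forces the second coordinate of `y` to be the
  -- velocity of the base curve.
  have hvel : ∀ t ∈ J, coordL I x₀ (γ t) (velocity I γ t) = (y t).2 := by
    intro t ht
    rw [coordL_velocity_eq_deriv (n := ∞) (by simp) (hsrc t ht)
      (hγ.contMDiffAt (hJ.mem_nhds ht))]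
    have h1 : (fun s => extChartAt I x₀ (γ s)) =ᶠ[𝓝 t] fun s => (y s).1 := by
      filter_upwards [hJ.mem_nhds ht] with s hs using hext s hs
    rw [h1.deriv_eq]
    exact (hasFDerivAt_fst.comp_hasDerivAt t (hd t ht)).deriv
  have hlift : ∀ t ∈ J, lift I γ t = tpoint I x₀ (y t) := by
    intro t ht
    refine tcoord_injOn (x₀ := x₀) (hsrc t ht) (hsrc t ht) ?_
    rw [tcoord_tpoint (hyt t ht)]
    exact Prod.ext (hext t ht) (hvel t ht)
  refine ⟨⟨hJ, hJc, hJn, hγ, fun t ht => ?_⟩, hlift⟩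
  refine coordL_injective (hsrc t ht) ?_
  have hl := (contMDiffAt_lift hJ hγ ht).mdifferentiableAt (by simp)
  rw [coordL_covDerivAlong cov (V := velocity I γ) (hsrc t ht) hl, map_zero]
  have h1 : (fun s => coordL I x₀ (γ s) (velocity I γ s)) =ᶠ[𝓝 t] fun s => (y s).2 := by
    filter_upwards [hJ.mem_nhds ht] with s hs using hvel s hs
  have h3 : HasDerivAt (fun s => (y s).2) (sprayField cov x₀ (y t)).2 t :=
    (hasFDerivAt_snd (𝕜 := ℝ) (E := E) (F := E) (p := y t)).comp_hasDerivAt t (hd t ht)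
  rw [h1.deriv_eq, h3.deriv]
  have h2 : velocity I γ t = constSec I x₀ (y t).2 (γ t) := by
    rw [← hvel t ht, constSec_coordL (hsrc t ht)]
  rw [h2]
  exact neg_add_cancel (symbols cov x₀ (y t).1 (y t).2 (y t).2)

end Spray

end Geod

/-! ### Local flow, uniqueness and reparametrization of geodesics -/

namespace Geod

/-- A property of real numbers that is locally constant on a connected open set is constant. -/
theorem of_locally_constant {J : Set ℝ} (hJ : IsOpen J) (hJc : J.OrdConnected) {P : ℝ → Prop}
    (h : ∀ t ∈ J, ∀ᶠ s in 𝓝 t, (P s ↔ P t)) {s t : ℝ} (hs : s ∈ J) (ht : t ∈ J) (hP : P s) :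
    P t := by
  by_contra hPt
  have h1 : IsOpen (J ∩ {t | P t}) := by
    rw [isOpen_iff_mem_nhds]
    rintro r ⟨hr, hPr⟩
    filter_upwards [hJ.mem_nhds hr, h r hr] with q hq hqP
    exact ⟨hq, hqP.2 hPr⟩
  have h2 : IsOpen (J ∩ {t | ¬ P t}) := by
    rw [isOpen_iff_mem_nhds]
    rintro r ⟨hr, hPr⟩
    filter_upwards [hJ.mem_nhds hr, h r hr] with q hq hqP
    exact ⟨hq, fun h => hPr (hqP.1 h)⟩
  obtain ⟨r, -, hr1, hr2⟩ := hJc.isPreconnected _ _ h1 h2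
    (fun r hr => (em (P r)).imp (fun h => ⟨hr, h⟩) fun h => ⟨hr, h⟩) ⟨s, hs, hs, hP⟩ ⟨t, ht, ht, hPt⟩
  exact hr2.2 hr1.2

section Geodesics

variable {E : Type*} [NormedAddCommGroup E] [NormedSpace ℝ E] [FiniteDimensional ℝ E]
  {H : Type*} [TopologicalSpace H] {I : ModelWithCorners ℝ E H}
  {M : Type*} [TopologicalSpace M] [ChartedSpace H M] [IsManifold I ∞ M]
  {cov : CovariantDerivative I E (TangentSpace I : M → Type _)}

theorem continuous_tangent_fst : Continuous fun v : TangentBundle I M => v.1 :=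
  FiberBundle.continuous_proj E (TangentSpace I : M → Type _)

theorem isOpen_tangent_source (x₀ : M) :
    IsOpen {v : TangentBundle I M | v.1 ∈ (chartAt H x₀).source} :=
  (chartAt H x₀).open_source.preimage continuous_tangent_fst

theorem exists_local_flow [I.Boundaryless] (hcov : SmoothSymbols cov) (v₀ : TangentBundle I M) :
    ∃ ε > 0, ∃ O : Set (TangentBundle I M), IsOpen O ∧ v₀ ∈ O ∧
      ∃ Ψ : ℝ × TangentBundle I M → TangentBundle I M,
        (∀ p ∈ Ioo (-ε) ε ×ˢ O, ContMDiffAt (𝓘(ℝ, ℝ).prod I.tangent) I.tangent ∞ Ψ p) ∧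
        ∀ v ∈ O, Ψ (0, v) = v ∧ IsGeodesicOn cov (fun t => (Ψ (t, v)).1) (Ioo (-ε) ε) ∧
          ∀ t ∈ Ioo (-ε) ε, lift I (fun t => (Ψ (t, v)).1) t = Ψ (t, v) := by
  set x₀ := v₀.1
  have hx₀ : v₀.1 ∈ (chartAt H x₀).source := mem_chart_source H x₀
  have hU : IsOpen ((extChartAt I x₀).target ×ˢ (univ : Set E)) :=
    (isOpen_extChartAt_target x₀).prod isOpen_univ
  have hmap : ∀ v : TangentBundle I M, v.1 ∈ (chartAt H x₀).source →
      (tcoord I x₀ v).1 ∈ (extChartAt I x₀).target := fun v hv =>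
    (extChartAt I x₀).map_source (by rwa [extChartAt_source])
  obtain ⟨ε, hε, V, hV, hv₀V, Φ, hΦ, hsol⟩ := SmoothFlow.exists_flow_of_contDiffOn hU
    (contDiffOn_sprayField hcov x₀) (x₀ := tcoord I x₀ v₀) ⟨hmap v₀ hx₀, mem_univ _⟩
  have hcont : ContinuousOn (tcoord I x₀) {v : TangentBundle I M | v.1 ∈ (chartAt H x₀).source} :=
    fun v hv => (contMDiffAt_tcoord hv).continuousAt.continuousWithinAt
  have hopen : IsOpen (Ioo (-ε) ε ×ˢ V) := isOpen_Ioo.prod hV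
  refine ⟨ε, hε, _, hcont.isOpen_inter_preimage (isOpen_tangent_source x₀) hV, ⟨hx₀, hv₀V⟩,
    fun p => tpoint I x₀ (Φ (p.1, tcoord I x₀ p.2)), ?_, ?_⟩
  · rintro ⟨t, v⟩ ⟨ht, hv, hvV⟩
    have h1 : ContMDiffAt (𝓘(ℝ, ℝ).prod I.tangent) 𝓘(ℝ, ℝ × (E × E)) ∞
        (fun p : ℝ × TangentBundle I M => (p.1, tcoord I x₀ p.2)) (t, v) :=
      contMDiffAt_fst.prodMk_space
        (ContMDiffAt.comp (t, v) (contMDiffAt_tcoord hv) contMDiffAt_snd)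
    have h2 : ContMDiffAt 𝓘(ℝ, ℝ × (E × E)) 𝓘(ℝ, E × E) ∞ Φ (t, tcoord I x₀ v) :=
      (hΦ.contDiffAt (hopen.mem_nhds (show (t, tcoord I x₀ v) ∈ _ from ⟨ht, hvV⟩))).contMDiffAt
    have h3 := contMDiffAt_tpoint (I := I) ((hsol _ hvV).2 t ht).1.1
    exact ContMDiffAt.comp (I' := 𝓘(ℝ, E × E)) (t, v) h3
      (ContMDiffAt.comp (I' := 𝓘(ℝ, ℝ × (E × E))) (t, v) h2 h1)
  · rintro v ⟨hv, hvV⟩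
    have h1 := isGeodesicOn_of_hasDerivAt (cov := cov) (x₀ := x₀)
      (y := fun t => Φ (t, tcoord I x₀ v)) isOpen_Ioo ordConnected_Ioo
      ⟨0, by linarith, hε⟩
      (hΦ.comp (contDiff_id.prodMk contDiff_const).contDiffOn fun t ht => ⟨ht, hvV⟩)
      (fun t ht => ((hsol _ hvV).2 t ht).1.1) fun t ht => ((hsol _ hvV).2 t ht).2
    refine ⟨?_, h1⟩
    dsimp only
    rw [(hsol _ hvV).1, tpoint_tcoord hv]

/-- The geodesic equation at time `t`, in the preferred chart at `γ t`. -/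
def GeodesicEq (cov : CovariantDerivative I E (TangentSpace I : M → Type _)) (γ : ℝ → M) (t : ℝ) :
    Prop :=
  HasDerivAt (fun s => tcoord I (γ t) (lift I γ s))
    (sprayField cov (γ t) (tcoord I (γ t) (lift I γ t))) t

/-- `covDerivAlong` takes values in a tangent space that depends on the curve. In coordinates the
equation lives in a fixed vector space and depends only on the germ of the curve, so it passes to
curves that agree locally. -/
theorem isGeodesicOn_iff {γ : ℝ → M} {J : Set ℝ} : IsGeodesicOn cov γ J ↔
    IsOpen J ∧ J.OrdConnected ∧ J.Nonempty ∧ ContMDiffOn 𝓘(ℝ, ℝ) I ∞ γ J ∧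
      ∀ t ∈ J, GeodesicEq cov γ t := by
  refine ⟨fun h => ⟨h.isOpen, h.ordConnected, h.nonempty, h.contMDiffOn,
    fun t ht => h.hasDerivAt ht (mem_chart_source H _)⟩, ?_⟩
  rintro ⟨h1, h2, h3, h4, h5⟩
  refine ⟨h1, h2, h3, h4, fun t ht => ?_⟩
  have hx := mem_chart_source H (γ t)
  have hl := (contMDiffAt_lift h1 h4 ht).mdifferentiableAt (by simp)
  have hd := h5 t ht
  have h6 := coordL_covDerivAlong cov (V := velocity I γ) hx hl
  have h7 := (hasFDerivAt_snd (𝕜 := ℝ) (E := E) (F := E)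
    (p := tcoord I (γ t) (lift I γ t))).comp_hasDerivAt t hd
  have h8 : deriv (fun s => coordL I (γ t) (γ s) (velocity I γ s)) t =
      (sprayField cov (γ t) (tcoord I (γ t) (lift I γ t))).2 := h7.deriv
  have h9 : sprayField cov (γ t) (tcoord I (γ t) (lift I γ t)) = _ := sprayField_tcoord hx _
  rw [h8, h9] at h6
  refine coordL_injective hx ?_
  rw [h6, map_zero]
  exact neg_add_cancel (coordL I (γ t) (γ t) (christoffel cov (γ t) (γ t) _ _))

theorem lift_congr {γ γ' : ℝ → M} {t : ℝ} (h : γ =ᶠ[𝓝 t] γ') : lift I γ t = lift I γ' t := by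
  have h1 := h.mfderiv_eq (I := 𝓘(ℝ, ℝ)) (I' := I)
  have h2 := h.self_of_nhds
  -- The velocities of the two curves lie in tangent spaces at different expressions for the base
  -- point. The comparison treats the derivatives as maps into `E` and varies the base point
  -- separately.
  have h3 : ∀ (x y : M) (f : ℝ →L[ℝ] E) (g : ℝ →L[ℝ] E), x = y → f = g →
      (⟨x, f 1⟩ : TangentBundle I M) = ⟨y, g 1⟩ := by
    rintro x y f g rfl rfl
    rfl
  exact h3 _ _ _ _ h2 h1

theorem GeodesicEq.congr {γ γ' : ℝ → M} {t : ℝ} (h : γ =ᶠ[𝓝 t] γ') (hγ : GeodesicEq cov γ t) :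
    GeodesicEq cov γ' t := by
  unfold GeodesicEq at hγ ⊢
  rw [← h.self_of_nhds, ← lift_congr h]
  refine hγ.congr_of_eventuallyEq ?_
  filter_upwards [h.eventuallyEq_nhds] with s hs
  rw [lift_congr hs]

/-- A geodesic is determined by its velocity at one time. -/
theorem IsGeodesicOn.lift_eq [I.Boundaryless] [T2Space M] (hcov : SmoothSymbols cov)
    {γ γ' : ℝ → M} {J : Set ℝ} (hγ : IsGeodesicOn cov γ J) (hγ' : IsGeodesicOn cov γ' J)
    {t₀ t : ℝ} (ht₀ : t₀ ∈ J) (h : lift I γ t₀ = lift I γ' t₀) (ht : t ∈ J) :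
    lift I γ t = lift I γ' t := by
  -- Agreement of the lifts is locally constant. Distinct base points stay distinct by
  -- Hausdorffness, distinct velocities at a common base point stay distinct by continuity in a
  -- chart, and equal velocities stay equal by uniqueness for the spray equation.
  refine of_locally_constant (P := fun t => lift I γ t = lift I γ' t) hγ.isOpen hγ.ordConnected
    (fun t ht => ?_) ht₀ ht h
  have hc : ContinuousAt γ t := (hγ.contMDiffOn.contMDiffAt (hγ.isOpen.mem_nhds ht)).continuousAt
  have hc' : ContinuousAt γ' t :=
    (hγ'.contMDiffOn.contMDiffAt (hγ.isOpen.mem_nhds ht)).continuousAt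
  by_cases hp : γ t = γ' t
  swap
  · have h1 : ∀ᶠ s in 𝓝 t, γ s ≠ γ' s := hc.ne_iff_eventually_ne hc' |>.1 hp
    filter_upwards [h1] with s hs
    exact ⟨fun h => absurd (congrArg (fun v => v.1) h) hs,
      fun h => absurd (congrArg (fun v => v.1) h) hp⟩
  have hs : γ t ∈ (chartAt H (γ t)).source := mem_chart_source H (γ t)
  have hs' : γ' t ∈ (chartAt H (γ t)).source := hp ▸ hs
  have hev := hc.preimage_mem_nhds ((chartAt H (γ t)).open_source.mem_nhds hs)
  have hev' := hc'.preimage_mem_nhds ((chartAt H (γ t)).open_source.mem_nhds hs')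
  have hd := hγ.hasDerivAt ht hs
  have hd' := hγ'.hasDerivAt ht hs'
  by_cases hl : lift I γ t = lift I γ' t
  · have hsp : ContDiffAt ℝ 1 (sprayField cov (γ t)) (tcoord I (γ t) (lift I γ t)) := by
      refine ((contDiffOn_sprayField hcov (γ t)).contDiffAt
        (((isOpen_extChartAt_target (γ t)).prod isOpen_univ).mem_nhds ⟨?_, mem_univ _⟩)).of_le
        (by exact_mod_cast le_top)
      exact mem_extChartAt_target (γ t)
    have hy : ∀ᶠ s in 𝓝 t, HasDerivAt (fun s => tcoord I (γ t) (lift I γ s))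
        (sprayField cov (γ t) (tcoord I (γ t) (lift I γ s))) s := by
      filter_upwards [hev, hγ.isOpen.mem_nhds ht] with s h1 h2 using hγ.hasDerivAt h2 h1
    have hy' : ∀ᶠ s in 𝓝 t, HasDerivAt (fun s => tcoord I (γ t) (lift I γ' s))
        (sprayField cov (γ t) (tcoord I (γ t) (lift I γ' s))) s := by
      filter_upwards [hev', hγ.isOpen.mem_nhds ht] with s h1 h2 using hγ'.hasDerivAt h2 h1
    have := SmoothFlow.eventuallyEq_of_hasDerivAt hsp hy hy' (by rw [hl])
    filter_upwards [this, hev, hev'] with s h1 h2 h3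
    exact ⟨fun _ => hl, fun _ => tcoord_injOn h2 h3 h1⟩
  · have h1 : tcoord I (γ t) (lift I γ t) ≠ tcoord I (γ t) (lift I γ' t) := fun h =>
      hl (tcoord_injOn hs hs' h)
    have h2 : ∀ᶠ s in 𝓝 t, tcoord I (γ t) (lift I γ s) ≠ tcoord I (γ t) (lift I γ' s) :=
      hd.continuousAt.ne_iff_eventually_ne hd'.continuousAt |>.1 h1
    filter_upwards [h2] with s hs
    exact ⟨fun h => absurd (by rw [h]) hs, fun h => absurd h hl⟩

/-- Multiplication of a tangent vector by a scalar. -/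
def smulT (c : ℝ) (v : TangentBundle I M) : TangentBundle I M := ⟨v.1, c • v.2⟩

theorem smulT_one (v : TangentBundle I M) : smulT 1 v = v := by
  unfold smulT; rw [one_smul]

theorem smulT_smulT (c d : ℝ) (v : TangentBundle I M) : smulT c (smulT d v) = smulT (c * d) v := by
  unfold smulT; rw [mul_smul]

theorem tcoord_smulT (x₀ : M) (c : ℝ) (v : TangentBundle I M) :
    tcoord I x₀ (smulT c v) = ((tcoord I x₀ v).1, c • (tcoord I x₀ v).2) :=
  Prod.ext rfl ((coordL I x₀ v.1).map_smul c v.2)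

theorem symbols_smul (x₀ : M) (z ξ : E) (c : ℝ) :
    symbols cov x₀ z (c • ξ) (c • ξ) = (c * c) • symbols cov x₀ z ξ ξ := by
  simp only [symbols, constSec, map_smul, smul_apply, mul_smul]

/-- Affine reparametrization of a geodesic. -/
theorem IsGeodesicOn.comp_affine {γ : ℝ → M} {J : Set ℝ} (hγ : IsGeodesicOn cov γ J) {c : ℝ}
    (hc : c ≠ 0) (a : ℝ) :
    IsGeodesicOn cov (fun t => γ (c * t + a)) {t | c * t + a ∈ J} ∧
      ∀ t, c * t + a ∈ J → lift I (fun t => γ (c * t + a)) t = smulT c (lift I γ (c * t + a)) := by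
  have hda : ∀ t : ℝ, HasDerivAt (fun t : ℝ => c * t + a) c t := fun t => by
    simpa using ((hasDerivAt_id t).const_mul c).add_const a
  have hcont : Continuous fun t : ℝ => c * t + a := by fun_prop
  have hopen : IsOpen {t | c * t + a ∈ J} := hγ.isOpen.preimage hcont
  have hlift : ∀ t, c * t + a ∈ J →
      lift I (fun t => γ (c * t + a)) t = smulT c (lift I γ (c * t + a)) := by
    intro t ht
    have h1 := (hγ.contMDiffOn.contMDiffAt (hγ.isOpen.mem_nhds ht)).mdifferentiableAt (by simp)
    have h2 : HasMFDerivAt 𝓘(ℝ, ℝ) 𝓘(ℝ, ℝ) (fun t : ℝ => c * t + a) t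
        (ContinuousLinearMap.toSpanSingleton ℝ c) := (hda t).hasFDerivAt.hasMFDerivAt
    have h3 := (HasMFDerivAt.comp t h1.hasMFDerivAt h2).mfderiv
    have h4 : velocity I (fun t => γ (c * t + a)) t = c • velocity I γ (c * t + a) := by
      have h5 : velocity I (fun t => γ (c * t + a)) t =
        (mfderiv 𝓘(ℝ, ℝ) I γ (c * t + a)) ((1 : ℝ) • c) := congrArg (fun f => f (1 : ℝ)) h3
      have h6 : ∀ f : ℝ →L[ℝ] E, f ((1 : ℝ) • c) = c • f 1 := fun f => by
        rw [← f.map_smul, smul_eq_mul, smul_eq_mul, mul_comm]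
      exact h5.trans (h6 _)
    unfold lift smulT
    rw [h4]
  refine ⟨isGeodesicOn_iff.2 ⟨hopen, ?_, ?_, ?_, ?_⟩, hlift⟩
  · rcases lt_or_gt_of_ne hc with h | h
    · refine hγ.ordConnected.preimage_anti fun s t hst => ?_
      have := mul_le_mul_of_nonpos_left hst h.le
      linarith
    · refine hγ.ordConnected.preimage_mono fun s t hst => ?_
      have := mul_le_mul_of_nonneg_left hst h.le
      linarith
  · obtain ⟨t, ht⟩ := hγ.nonempty
    exact ⟨(t - a) / c, by simpa [mul_div_cancel₀ _ hc] using ht⟩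
  · have h1 : ContMDiff 𝓘(ℝ, ℝ) 𝓘(ℝ, ℝ) ∞ fun t : ℝ => c * t + a :=
      ((contDiff_const.mul contDiff_id).add contDiff_const).contMDiff
    exact hγ.contMDiffOn.comp h1.contMDiffOn fun t ht => ht
  · intro t ht
    have ht' : c * t + a ∈ J := ht
    have hd := hγ.hasDerivAt ht' (mem_chart_source H (γ (c * t + a)))
    set x₀ := γ (c * t + a) with hx₀
    set y : ℝ → E × E := fun s => tcoord I x₀ (lift I γ s) with hy
    have h1 : HasDerivAt (fun s => y (c * s + a)) (c • sprayField cov x₀ (y (c * t + a))) t :=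
      HasDerivAt.scomp t (h := fun s : ℝ => c * s + a) hd (hda t)
    have h2 : HasDerivAt (fun s => (y (c * s + a)).1)
        (c • sprayField cov x₀ (y (c * t + a))).1 t :=
      h1.fst
    have h3 : HasDerivAt (fun s => (y (c * s + a)).2)
        (c • sprayField cov x₀ (y (c * t + a))).2 t :=
      h1.snd
    -- The velocity is multiplied by `c` and its time derivative by `c * c`; the symbols are
    -- quadratic in the velocity, so the spray scales in the same way.
    have h4 := h2.prodMk (h3.const_smul c)
    have h5 : (fun s => tcoord I x₀ (lift I (fun t => γ (c * t + a)) s)) =ᶠ[𝓝 t]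
        fun s => ((y (c * s + a)).1, c • (y (c * s + a)).2) := by
      filter_upwards [hopen.mem_nhds ht] with s hs
      rw [hlift s hs, tcoord_smulT]
    have h6 := h4.congr_of_eventuallyEq h5
    have h7 : sprayField cov x₀ (tcoord I x₀ (lift I (fun t => γ (c * t + a)) t)) =
        ((c • sprayField cov x₀ (y (c * t + a))).1,
          c • (c • sprayField cov x₀ (y (c * t + a))).2) := by
      rw [hlift t ht', tcoord_smulT]
      simp only [sprayField, Prod.smul_fst, Prod.smul_snd, symbols_smul, mul_smul, smul_neg]
      rfl
    rw [← h7] at h6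
    exact h6

end Geodesics

end Geod

/-! ### Maximal geodesics and the geodesic flow -/

namespace Geod

section Geodesics

variable {E : Type*} [NormedAddCommGroup E] [NormedSpace ℝ E] [FiniteDimensional ℝ E]
  {H : Type*} [TopologicalSpace H] {I : ModelWithCorners ℝ E H}
  {M : Type*} [TopologicalSpace M] [ChartedSpace H M] [IsManifold I ∞ M]
  {cov : CovariantDerivative I E (TangentSpace I : M → Type _)}

theorem IsGeodesicOn.mono {γ : ℝ → M} {J J' : Set ℝ} (hγ : IsGeodesicOn cov γ J) (h : J' ⊆ J)
    (ho : IsOpen J') (hc : J'.OrdConnected) (hn : J'.Nonempty) : IsGeodesicOn cov γ J' :=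
  ⟨ho, hc, hn, hγ.contMDiffOn.mono h, fun t ht => hγ.geodesic_eq t (h ht)⟩

variable (cov) in
/-- The curve `γ` is a geodesic on `J` with initial velocity `v`. -/
def IsGeodesicFrom (v : TangentBundle I M) (γ : ℝ → M) (J : Set ℝ) : Prop :=
  IsGeodesicOn cov γ J ∧ (0 : ℝ) ∈ J ∧ lift I γ 0 = v

variable (cov) in
/-- The domain of the maximal geodesic with initial velocity `v`. -/
def dom (v : TangentBundle I M) : Set ℝ := {t | ∃ γ J, IsGeodesicFrom cov v γ J ∧ t ∈ J}

open Classical in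
variable (cov) in
/-- The geodesic flow. -/
def flow (v : TangentBundle I M) (t : ℝ) : TangentBundle I M :=
  if h : t ∈ dom cov v then lift I h.choose t else v

variable (cov) in
/-- The maximal geodesic with initial velocity `v`. -/
def geo (v : TangentBundle I M) (t : ℝ) : M := (flow cov v t).1

theorem IsGeodesicFrom.subset_dom {v : TangentBundle I M} {γ : ℝ → M} {J : Set ℝ}
    (h : IsGeodesicFrom cov v γ J) : J ⊆ dom cov v := fun _ ht => ⟨γ, J, h, ht⟩

theorem isOpen_dom (v : TangentBundle I M) : IsOpen (dom cov v) := by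
  rw [isOpen_iff_mem_nhds]
  rintro t ⟨γ, J, h, ht⟩
  filter_upwards [h.1.isOpen.mem_nhds ht] with s hs using h.subset_dom hs

theorem ordConnected_dom (v : TangentBundle I M) : (dom cov v).OrdConnected := by
  refine ⟨?_⟩
  rintro s ⟨γ, J, h, hs⟩ t ⟨γ', J', h', ht⟩ r hr
  rcases le_total 0 r with h0 | h0
  · exact h'.subset_dom (h'.1.ordConnected.out h'.2.1 ht ⟨h0, hr.2⟩)
  · exact h.subset_dom (h.1.ordConnected.out hs h.2.1 ⟨hr.1, h0⟩)

variable [I.Boundaryless]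

theorem zero_mem_dom (hcov : SmoothSymbols cov) (v : TangentBundle I M) : (0 : ℝ) ∈ dom cov v := by
  obtain ⟨ε, hε, O, -, hv, Ψ, -, h⟩ := exists_local_flow hcov v
  have h0 : (0 : ℝ) ∈ Ioo (-ε) ε := ⟨by linarith, hε⟩
  exact ⟨_, _, ⟨(h v hv).2.1, h0, ((h v hv).2.2 0 h0).trans (h v hv).1⟩, h0⟩

variable [T2Space M]

/-- `flow` picks a geodesic for each time separately. Uniqueness on the intersection of two domains,
an open interval containing 0, makes the choice immaterial. -/
theorem IsGeodesicFrom.flow_eq (hcov : SmoothSymbols cov) {v : TangentBundle I M} {γ : ℝ → M}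
    {J : Set ℝ} (h : IsGeodesicFrom cov v γ J) {t : ℝ} (ht : t ∈ J) :
    flow cov v t = lift I γ t := by
  have hd := h.subset_dom ht
  obtain ⟨J', h', ht'⟩ := hd.choose_spec
  have h0 : (0 : ℝ) ∈ J ∩ J' := ⟨h.2.1, h'.2.1⟩
  have ho := h.1.isOpen.inter h'.1.isOpen
  have hc := h.1.ordConnected.inter h'.1.ordConnected
  unfold flow
  rw [dif_pos hd]
  exact (h'.1.mono inter_subset_right ho hc ⟨0, h0⟩).lift_eq hcov
    (h.1.mono inter_subset_left ho hc ⟨0, h0⟩) h0 (h'.2.2.trans h.2.2.symm) ⟨ht, ht'⟩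

theorem IsGeodesicFrom.eventuallyEq_geo (hcov : SmoothSymbols cov) {v : TangentBundle I M}
    {γ : ℝ → M} {J : Set ℝ} (h : IsGeodesicFrom cov v γ J) {t : ℝ} (ht : t ∈ J) :
    γ =ᶠ[𝓝 t] geo cov v := by
  filter_upwards [h.1.isOpen.mem_nhds ht] with s hs
  unfold geo
  rw [h.flow_eq hcov hs]
  rfl

theorem lift_geo (hcov : SmoothSymbols cov) {v : TangentBundle I M} {t : ℝ} (ht : t ∈ dom cov v) :
    lift I (geo cov v) t = flow cov v t := by
  obtain ⟨γ, J, h, hJ⟩ := ht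
  rw [h.flow_eq hcov hJ, lift_congr (h.eventuallyEq_geo hcov hJ)]

theorem isGeodesicOn_geo (hcov : SmoothSymbols cov) (v : TangentBundle I M) :
    IsGeodesicOn cov (geo cov v) (dom cov v) := by
  refine isGeodesicOn_iff.2 ⟨isOpen_dom v, ordConnected_dom v, ⟨0, zero_mem_dom hcov v⟩, ?_, ?_⟩
  · rintro t ⟨γ, J, h, hJ⟩
    exact ((h.1.contMDiffOn.contMDiffAt (h.1.isOpen.mem_nhds hJ)).congr_of_eventuallyEq
      (h.eventuallyEq_geo hcov hJ).symm).contMDiffWithinAt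
  · rintro t ⟨γ, J, h, hJ⟩
    exact ((isGeodesicOn_iff.1 h.1).2.2.2.2 t hJ).congr (h.eventuallyEq_geo hcov hJ)

theorem flow_zero (hcov : SmoothSymbols cov) (v : TangentBundle I M) : flow cov v 0 = v := by
  obtain ⟨γ, J, h, hJ⟩ := zero_mem_dom hcov v
  rw [h.flow_eq hcov hJ, h.2.2]

theorem IsGeodesicOn.isGeodesicFrom {γ : ℝ → M} {J : Set ℝ} (hγ : IsGeodesicOn cov γ J) {s : ℝ}
    (hs : s ∈ J) : IsGeodesicFrom cov (lift I γ s) (fun t => γ (1 * t + s)) {t | 1 * t + s ∈ J} := by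
  have h := hγ.comp_affine one_ne_zero s
  have h0 : 1 * (0 : ℝ) + s = s := by ring
  have h1 : 1 * (0 : ℝ) + s ∈ J := by rwa [h0]
  exact ⟨h.1, h1, (h.2 0 h1).trans (by rw [smulT_one, h0])⟩

theorem IsGeodesicOn.sub_mem_dom {γ : ℝ → M} {J : Set ℝ} (hγ : IsGeodesicOn cov γ J) {s t : ℝ}
    (hs : s ∈ J) (ht : t ∈ J) : t - s ∈ dom cov (lift I γ s) :=
  (hγ.isGeodesicFrom hs).subset_dom (by simpa using ht)

theorem IsGeodesicOn.flow_lift (hcov : SmoothSymbols cov) {γ : ℝ → M} {J : Set ℝ}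
    (hγ : IsGeodesicOn cov γ J) {s t : ℝ} (hs : s ∈ J) (ht : t ∈ J) :
    flow cov (lift I γ s) (t - s) = lift I γ t := by
  have h : 1 * (t - s) + s = t := by ring
  have h1 : 1 * (t - s) + s ∈ J := by rwa [h]
  rw [(hγ.isGeodesicFrom hs).flow_eq hcov h1, (hγ.comp_affine one_ne_zero s).2 _ h1, smulT_one, h]

/-- The group law: the maximal geodesic of `v`, restarted at time `s`, is a geodesic with initial
velocity `flow cov v s`. -/
theorem mem_dom_flow_of_add (hcov : SmoothSymbols cov) {v : TangentBundle I M} {s t : ℝ}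
    (hs : s ∈ dom cov v) (ht : t + s ∈ dom cov v) :
    t ∈ dom cov (flow cov v s) ∧ flow cov (flow cov v s) t = flow cov v (t + s) := by
  have h1 := (isGeodesicOn_geo hcov v).sub_mem_dom hs ht
  have h2 := (isGeodesicOn_geo hcov v).flow_lift hcov hs ht
  rw [lift_geo hcov hs, add_sub_cancel_right] at h1 h2
  rw [lift_geo hcov ht] at h2
  exact ⟨h1, h2⟩

theorem neg_mem_dom_flow (hcov : SmoothSymbols cov) {v : TangentBundle I M} {s : ℝ}
    (hs : s ∈ dom cov v) : -s ∈ dom cov (flow cov v s) ∧ flow cov (flow cov v s) (-s) = v := by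
  have h := mem_dom_flow_of_add hcov (t := -s) hs (by simpa using zero_mem_dom hcov v)
  rwa [neg_add_cancel, flow_zero hcov] at h

theorem mem_dom_flow (hcov : SmoothSymbols cov) {v : TangentBundle I M} {s t : ℝ}
    (hs : s ∈ dom cov v) : t ∈ dom cov (flow cov v s) ↔ t + s ∈ dom cov v := by
  refine ⟨fun ht => ?_, fun ht => (mem_dom_flow_of_add hcov hs ht).1⟩
  have h := neg_mem_dom_flow hcov hs
  have h1 := mem_dom_flow_of_add hcov (t := t + s) h.1 (by simpa using ht)
  rw [h.2] at h1
  exact h1.1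

theorem flow_flow (hcov : SmoothSymbols cov) {v : TangentBundle I M} {s t : ℝ}
    (hs : s ∈ dom cov v) (ht : t + s ∈ dom cov v) :
    flow cov (flow cov v s) t = flow cov v (t + s) := (mem_dom_flow_of_add hcov hs ht).2

theorem smulT_mem_dom (hcov : SmoothSymbols cov) {v : TangentBundle I M} {c t : ℝ} (hc : c ≠ 0)
    (ht : c * t ∈ dom cov v) :
    t ∈ dom cov (smulT c v) ∧ flow cov (smulT c v) t = smulT c (flow cov v (c * t)) := by
  have h := (isGeodesicOn_geo hcov v).comp_affine hc 0
  have h0 : c * 0 + 0 ∈ dom cov v := by simpa using zero_mem_dom hcov v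
  have ht' : c * t + 0 ∈ dom cov v := by simpa using ht
  have h1 : IsGeodesicFrom cov (smulT c v) _ _ :=
    ⟨h.1, h0, (h.2 0 h0).trans (by rw [mul_zero, add_zero, lift_geo hcov (zero_mem_dom hcov v),
      flow_zero hcov])⟩
  refine ⟨h1.subset_dom ht', ?_⟩
  rw [h1.flow_eq hcov ht', h.2 t ht', add_zero, lift_geo hcov ht]

theorem mem_dom_smulT (hcov : SmoothSymbols cov) {v : TangentBundle I M} {c t : ℝ} (hc : c ≠ 0) :
    t ∈ dom cov (smulT c v) ↔ c * t ∈ dom cov v := by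
  refine ⟨fun ht => ?_, fun ht => (smulT_mem_dom hcov hc ht).1⟩
  have h := (smulT_mem_dom hcov (v := smulT c v) (c := c⁻¹) (t := c * t) (inv_ne_zero hc)
    (by rwa [inv_mul_cancel_left₀ hc])).1
  rwa [smulT_smulT, inv_mul_cancel₀ hc, smulT_one] at h

theorem flow_smulT (hcov : SmoothSymbols cov) {v : TangentBundle I M} {c t : ℝ} (hc : c ≠ 0)
    (ht : c * t ∈ dom cov v) : flow cov (smulT c v) t = smulT c (flow cov v (c * t)) :=
  (smulT_mem_dom hcov hc ht).2

theorem lift_const (p : M) (t : ℝ) : lift I (fun _ : ℝ => p) t = ⟨p, 0⟩ := by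
  unfold lift velocity
  rw [mfderiv_const]
  rfl

theorem isGeodesicOn_const (p : M) : IsGeodesicOn cov (fun _ => p) univ := by
  refine isGeodesicOn_iff.2 ⟨isOpen_univ, ordConnected_univ, univ_nonempty, contMDiffOn_const,
    fun t _ => ?_⟩
  have h : ∀ s : ℝ, tcoord I p (lift I (fun _ : ℝ => p) s) = (extChartAt I p p, 0) := fun s => by
    rw [lift_const]
    exact Prod.ext rfl ((coordL I p p).map_zero)
  unfold GeodesicEq
  dsimp only
  simp only [h]
  have h2 : sprayField cov p (extChartAt I p p, (0 : E)) = 0 := by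
    have := symbols_smul (cov := cov) p (extChartAt I p p) 0 0
    simp only [smul_zero, mul_zero, zero_smul] at this
    simp only [sprayField, this, neg_zero]
    rfl
  rw [h2]
  exact hasDerivAt_const _ _

/-- A geodesic whose velocity vanishes once is constant by uniqueness; flowing back to time 0 would
then give `v` zero velocity. -/
theorem flow_ne_zero (hcov : SmoothSymbols cov) {v : TangentBundle I M} {t : ℝ}
    (ht : t ∈ dom cov v) (hv : v.2 ≠ 0) : (flow cov v t).2 ≠ 0 := by
  intro h0
  have h1 := neg_mem_dom_flow hcov ht
  have h2 : IsGeodesicFrom cov (flow cov v t) (fun _ => (flow cov v t).1) univ := by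
    refine ⟨isGeodesicOn_const _, mem_univ _, ?_⟩
    rw [lift_const, ← h0]
  rw [h2.flow_eq hcov (mem_univ _), lift_const] at h1
  exact hv (by rw [← h1.2])

theorem isInextendibleGeodesic_geo (hcov : SmoothSymbols cov) (v : TangentBundle I M) :
    IsInextendibleGeodesic cov (geo cov v) (dom cov v) := by
  refine ⟨isGeodesicOn_geo hcov v, fun γ' J' h hJ he => (hJ.antisymm ?_).symm⟩
  have h0 := zero_mem_dom hcov v
  refine IsGeodesicFrom.subset_dom (γ := γ') ⟨h, hJ h0, ?_⟩
  rw [← lift_congr (he.eventuallyEq_of_mem ((isOpen_dom v).mem_nhds h0)), lift_geo hcov h0,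
    flow_zero hcov]

/-- Every geodesic extends to an inextendible one. -/
theorem IsGeodesicOn.exists_extension (hcov : SmoothSymbols cov) {γ : ℝ → M} {J : Set ℝ}
    (h : IsGeodesicOn cov γ J) :
    ∃ γ' J', IsInextendibleGeodesic cov γ' J' ∧ J ⊆ J' ∧ EqOn γ γ' J := by
  obtain ⟨s, hs⟩ := h.nonempty
  have h1 := isInextendibleGeodesic_geo hcov (lift I γ s)
  -- The extension is the maximal geodesic of the velocity at a time `s` of `J`, with the time
  -- shifted so that 0 becomes `s`.
  refine ⟨fun t => geo cov (lift I γ s) (1 * t + -s), {t | 1 * t + -s ∈ dom cov (lift I γ s)},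
    ⟨(h1.toIsGeodesicOn.comp_affine one_ne_zero (-s)).1, ?_⟩, ?_, ?_⟩
  · intro γ' J' h' hJ he
    refine (hJ.antisymm fun t ht => ?_).symm
    have h0 : s ∈ {t | 1 * t + -s ∈ dom cov (lift I γ s)} := by
      rw [mem_ofPred_eq, show 1 * s + -s = 0 by ring]
      exact zero_mem_dom hcov _
    have ho : IsOpen {t | 1 * t + -s ∈ dom cov (lift I γ s)} :=
      (isOpen_dom _).preimage (by fun_prop)
    have h2 := h'.sub_mem_dom (hJ h0) ht
    have h3 := (h1.toIsGeodesicOn.comp_affine one_ne_zero (-s)).2 s h0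
    rw [smulT_one, show 1 * s + -s = 0 by ring, lift_geo hcov (zero_mem_dom hcov _),
      flow_zero hcov] at h3
    rw [← lift_congr (he.eventuallyEq_of_mem (ho.mem_nhds h0)), h3] at h2
    rwa [mem_ofPred_eq, show 1 * t + -s = t - s by ring]
  · intro t ht
    have := h.sub_mem_dom hs ht
    rwa [mem_ofPred_eq, show 1 * t + -s = t - s by ring]
  · intro t ht
    have := h.flow_lift hcov hs ht
    dsimp only
    unfold geo
    rw [show 1 * t + -s = t - s by ring, this]
    rfl

/-- The geodesic flow is smooth, and its domain is open. -/
theorem flow_smooth (hcov : SmoothSymbols cov) {v : TangentBundle I M} {t : ℝ}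
    (ht : t ∈ dom cov v) :
    (∀ᶠ p : ℝ × TangentBundle I M in 𝓝 (t, v), p.1 ∈ dom cov p.2) ∧
      ContMDiffAt (𝓘(ℝ, ℝ).prod I.tangent) I.tangent ∞
        (fun p : ℝ × TangentBundle I M => flow cov p.2 p.1) (t, v) := by
  refine of_locally_constant (P := fun t => (∀ᶠ p : ℝ × TangentBundle I M in 𝓝 (t, v),
      p.1 ∈ dom cov p.2) ∧ ContMDiffAt (𝓘(ℝ, ℝ).prod I.tangent) I.tangent ∞
        (fun p : ℝ × TangentBundle I M => flow cov p.2 p.1) (t, v)) (isOpen_dom v)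
    (ordConnected_dom v) (fun t ht => ?_) (zero_mem_dom hcov v) ht ?_
  · obtain ⟨ε, hε, O, hO, hv, Ψ, hΨ, h⟩ := exists_local_flow hcov (flow cov v t)
    have h0 : (0 : ℝ) ∈ Ioo (-ε) ε := ⟨by linarith, hε⟩
    have hfrom : ∀ w ∈ O, IsGeodesicFrom cov w (fun t => (Ψ (t, w)).1) (Ioo (-ε) ε) := fun w hw =>
      ⟨(h w hw).2.1, h0, ((h w hw).2.2 0 h0).trans (h w hw).1⟩
    -- The flow for time `s` is the flow for time `r` followed by the local flow for time `s - r`.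
    -- Since `r` and `s` may be exchanged, goodness of one of two close times is equivalent to
    -- goodness of the other, as the connectedness argument requires.
    have key : ∀ r s, flow cov v r ∈ O → s - r ∈ Ioo (-ε) ε →
        ((∀ᶠ p : ℝ × TangentBundle I M in 𝓝 (r, v), p.1 ∈ dom cov p.2) ∧
          ContMDiffAt (𝓘(ℝ, ℝ).prod I.tangent) I.tangent ∞
          (fun p : ℝ × TangentBundle I M => flow cov p.2 p.1) (r, v)) →
        ((∀ᶠ p : ℝ × TangentBundle I M in 𝓝 (s, v), p.1 ∈ dom cov p.2) ∧
          ContMDiffAt (𝓘(ℝ, ℝ).prod I.tangent) I.tangent ∞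
          (fun p : ℝ × TangentBundle I M => flow cov p.2 p.1) (s, v)) := by
      rintro r s hr hsr ⟨h1, h2⟩
      have hin : ContMDiffAt (𝓘(ℝ, ℝ).prod I.tangent) (𝓘(ℝ, ℝ).prod I.tangent) ∞
          (fun p : ℝ × TangentBundle I M => (r, p.2)) (s, v) :=
        contMDiffAt_const.prodMk contMDiffAt_snd
      have h3 : ContMDiffAt (𝓘(ℝ, ℝ).prod I.tangent) I.tangent ∞
          (fun p : ℝ × TangentBundle I M => flow cov p.2 r) (s, v) :=
        ContMDiffAt.comp (s, v) h2 hin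
      have h4 : ContMDiffAt (𝓘(ℝ, ℝ).prod I.tangent) 𝓘(ℝ, ℝ) ∞
          (fun p : ℝ × TangentBundle I M => p.1 - r) (s, v) :=
        contMDiffAt_fst.sub contMDiffAt_const
      have h5 : ContMDiffAt (𝓘(ℝ, ℝ).prod I.tangent) I.tangent ∞
          (fun p : ℝ × TangentBundle I M => Ψ (p.1 - r, flow cov p.2 r)) (s, v) :=
        ContMDiffAt.comp (s, v) (hΨ (s - r, flow cov v r) ⟨hsr, hr⟩) (h4.prodMk h3)
      have e1 : ∀ᶠ p : ℝ × TangentBundle I M in 𝓝 (s, v), r ∈ dom cov p.2 :=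
        hin.continuousAt.eventually h1
      have e2 := h3.continuousAt.eventually (hO.mem_nhds hr)
      have e3 := h4.continuousAt.eventually (isOpen_Ioo.mem_nhds hsr)
      have e4 : ∀ᶠ p : ℝ × TangentBundle I M in 𝓝 (s, v), p.1 ∈ dom cov p.2 ∧
          flow cov p.2 p.1 = Ψ (p.1 - r, flow cov p.2 r) := by
        filter_upwards [e1, e2, e3] with p p1 p2 p3
        have p4 := (mem_dom_flow hcov p1).1 ((hfrom _ p2).subset_dom p3)
        rw [sub_add_cancel] at p4
        refine ⟨p4, ?_⟩
        rw [← (h _ p2).2.2 _ p3, ← (hfrom _ p2).flow_eq hcov p3,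
          flow_flow hcov p1 (by rwa [sub_add_cancel]), sub_add_cancel]
      exact ⟨e4.mono fun p hp => hp.1, h5.congr_of_eventuallyEq (e4.mono fun p hp => hp.2)⟩
    have hc : ContinuousAt (fun s => flow cov v s) t := by
      have h1 := (contMDiffAt_lift (isOpen_dom v) (isGeodesicOn_geo hcov v).contMDiffOn
        ht).continuousAt
      refine h1.congr ?_
      filter_upwards [(isOpen_dom v).mem_nhds ht] with s hs using lift_geo hcov hs
    filter_upwards [hc.eventually (hO.mem_nhds hv), Ioo_mem_nhds (show t - ε < t by linarith)
      (show t < t + ε by linarith)] with s hs hst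
    exact ⟨key s t hs ⟨by linarith [hst.2], by linarith [hst.1]⟩,
      key t s hv ⟨by linarith [hst.1], by linarith [hst.2]⟩⟩
  · obtain ⟨ε, hε, O, hO, hv, Ψ, hΨ, h⟩ := exists_local_flow hcov v
    have h0 : (0 : ℝ) ∈ Ioo (-ε) ε := ⟨by linarith, hε⟩
    have hfrom : ∀ w ∈ O, IsGeodesicFrom cov w (fun t => (Ψ (t, w)).1) (Ioo (-ε) ε) := fun w hw =>
      ⟨(h w hw).2.1, h0, ((h w hw).2.2 0 h0).trans (h w hw).1⟩
    have hn : Ioo (-ε) ε ×ˢ O ∈ 𝓝 ((0 : ℝ), v) := (isOpen_Ioo.prod hO).mem_nhds ⟨h0, hv⟩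
    refine ⟨?_, (hΨ (0, v) ⟨h0, hv⟩).congr_of_eventuallyEq ?_⟩
    · filter_upwards [hn] with p hp using (hfrom _ hp.2).subset_dom hp.1
    · filter_upwards [hn] with p hp
      rw [(hfrom _ hp.2).flow_eq hcov hp.1, (h _ hp.2).2.2 _ hp.1]

end Geodesics

end Geod

/-! ### The fibres of the projection to the space of geodesics -/

namespace Geod

/-- A map into an open submanifold is smooth if it is smooth as a map to the whole manifold. -/
theorem contMDiffAt_of_subtype_val {EN HN N E H M : Type*} [NormedAddCommGroup EN]
    [NormedSpace ℝ EN] [TopologicalSpace HN] {IN : ModelWithCorners ℝ EN HN} [TopologicalSpace N]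
    [ChartedSpace HN N] [NormedAddCommGroup E] [NormedSpace ℝ E] [TopologicalSpace H]
    {I : ModelWithCorners ℝ E H} [TopologicalSpace M] [ChartedSpace H M]
    {U : TopologicalSpace.Opens M} {n : ℕ∞ω} {f : N → U} {x : N}
    (h : ContMDiffAt IN I n (fun y => (f y : M)) x) : ContMDiffAt IN I n f x := by
  have h1 := contMDiffAt_iff_target.1 h
  exact contMDiffAt_iff_target.2 ⟨IsInducing.subtypeVal.continuousAt_iff.2 h1.1, h1.2⟩

section Geodesics

variable {E : Type*} [NormedAddCommGroup E] [NormedSpace ℝ E] [FiniteDimensional ℝ E]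
  {H : Type*} [TopologicalSpace H] {I : ModelWithCorners ℝ E H}
  {M : Type*} [TopologicalSpace M] [ChartedSpace H M] [IsManifold I ∞ M]
  {cov : CovariantDerivative I E (TangentSpace I : M → Type _)}

variable (cov) in
/-- Two tangent vectors are related if the second is, up to a scalar, a velocity of the maximal
geodesic determined by the first. -/
def Related (v w : TangentBundle I M) : Prop :=
  ∃ t ∈ dom cov v, ∃ c : ℝ, c ≠ 0 ∧ w = smulT c (flow cov v t)

theorem contMDiff_smulT (c : ℝ) :
    ContMDiff I.tangent I.tangent ∞ (smulT c : TangentBundle I M → TangentBundle I M) := by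
  intro v
  have hv : v.1 ∈ (chartAt H v.1).source := mem_chart_source H v.1
  have h1 : ContMDiffAt I.tangent 𝓘(ℝ, E) ∞ (fun w : TangentBundle I M => coordL I v.1 w.1 w.2) v :=
    (contDiff_snd.contMDiff (x := tcoord I v.1 v)).comp v (contMDiffAt_tcoord hv)
  refine contMDiffAt_tangent (x₀ := v.1) (q := v) (f := smulT c) hv
    (contMDiff_proj (TangentSpace I : M → Type _) v) ?_
  have h2 : ContMDiffAt 𝓘(ℝ, E) 𝓘(ℝ, E) ∞ (fun x : E => c • x) (coordL I v.1 v.1 v.2) :=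
    (contDiff_const_smul c).contDiffAt.contMDiffAt
  refine (ContMDiffAt.comp v h2 h1).congr_of_eventuallyEq (Filter.Eventually.of_forall fun w => ?_)
  exact (coordL I v.1 w.1).map_smul c w.2

variable [I.Boundaryless] [T2Space M]

theorem Related.refl (hcov : SmoothSymbols cov) (v : TangentBundle I M) : Related cov v v :=
  ⟨0, zero_mem_dom hcov v, 1, one_ne_zero, by rw [flow_zero hcov, smulT_one]⟩

theorem related_smulT (hcov : SmoothSymbols cov) (v : TangentBundle I M) {c : ℝ} (hc : c ≠ 0) :
    Related cov v (smulT c v) :=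
  ⟨0, zero_mem_dom hcov v, c, hc, by rw [flow_zero hcov]⟩

theorem related_flow (v : TangentBundle I M) {t : ℝ} (ht : t ∈ dom cov v) :
    Related cov v (flow cov v t) :=
  ⟨t, ht, 1, one_ne_zero, by rw [smulT_one]⟩

theorem Related.trans (hcov : SmoothSymbols cov) {u v w : TangentBundle I M}
    (h : Related cov u v) (h' : Related cov v w) : Related cov u w := by
  obtain ⟨t, ht, c, hc, rfl⟩ := h
  obtain ⟨s, hs, d, hd, rfl⟩ := h'
  have h1 := (mem_dom_smulT hcov hc).1 hs
  have h2 := (mem_dom_flow hcov ht).1 h1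
  refine ⟨c * s + t, h2, d * c, mul_ne_zero hd hc, ?_⟩
  rw [flow_smulT hcov hc h1, flow_flow hcov ht h2, smulT_smulT]

theorem Related.symm (hcov : SmoothSymbols cov) {v w : TangentBundle I M}
    (h : Related cov v w) : Related cov w v := by
  obtain ⟨t, ht, c, hc, rfl⟩ := h
  refine Related.trans hcov (v := flow cov v t) ?_ ?_
  · have := related_smulT hcov (smulT c (flow cov v t)) (inv_ne_zero hc)
    rwa [smulT_smulT, inv_mul_cancel₀ hc, smulT_one] at this
  · have := neg_mem_dom_flow hcov ht
    have h1 := related_flow (cov := cov) _ this.1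
    rwa [this.2] at h1

/-- Translates the relation defining the quotient into a statement about the flow. An arbitrary
geodesic through two lines is compared with the flow at its velocities; conversely, the maximal
geodesic of `v` is a common geodesic. -/
theorem onCommonGeodesic_iff (hcov : SmoothSymbols cov) (v w : ReducedTangentBundle I M) :
    OnCommonGeodesic cov (Quotient.mk _ v) (Quotient.mk _ w) ↔
      Related cov (v : TangentBundle I M) w := by
  have hprop : ∀ {γ : ℝ → M} {s : ℝ} {v : ReducedTangentBundle I M} {h : velocity I γ s ≠ 0},
      Quotient.mk (proportional I M) v =
        Quotient.mk (proportional I M) ⟨(⟨γ s, velocity I γ s⟩ : TangentBundle I M), h⟩ →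
      Related cov v (lift I γ s) := by
    intro γ s v h he
    obtain ⟨c, hc, h1⟩ := Quotient.exact he
    have h2 : lift I γ s = smulT c v := h1
    rw [h2]
    exact related_smulT hcov _ hc
  constructor
  · rintro ⟨γ, J, hγ, ⟨s, hs, hs0, h1⟩, t, ht, ht0, h2⟩
    refine Related.trans hcov (hprop h1) (Related.trans hcov ?_ (Related.symm hcov (hprop h2)))
    have := related_flow (cov := cov) _ (hγ.sub_mem_dom hs ht)
    rwa [hγ.flow_lift hcov hs ht] at this
  · rintro ⟨t, ht, c, hc, h⟩
    have h0 := zero_mem_dom hcov v.1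
    have e0 := (lift_geo hcov h0).trans (flow_zero hcov v.1)
    have e1 := lift_geo hcov ht
    refine ⟨geo cov v.1, dom cov v.1, isInextendibleGeodesic_geo hcov v.1, ⟨0, h0, ?_, ?_⟩,
      t, ht, ?_, ?_⟩
    · have := v.2
      rw [← e0] at this
      exact this
    · exact congrArg _ (Subtype.ext e0.symm)
    · have := flow_ne_zero hcov ht v.2
      rw [← e1] at this
      exact this
    · refine (Quotient.sound ?_)
      refine ⟨c⁻¹, inv_ne_zero hc, ?_⟩
      change lift I (geo cov v.1) t = smulT c⁻¹ w.1
      rw [h, smulT_smulT, inv_mul_cancel₀ hc, smulT_one, e1]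

/-- Equality in a `Quot` is equality under the generated equivalence. Here the relation already is
an equivalence, by the group law of the flow, so no chains of geodesics arise. -/
theorem geodesicProj_eq_iff (hcov : SmoothSymbols cov) {v w : ReducedTangentBundle I M} :
    geodesicProj cov v = geodesicProj cov w ↔ Related cov (v : TangentBundle I M) w := by
  have heq : Equivalence (OnCommonGeodesic cov) := by
    refine ⟨fun ℓ => ?_, fun {ℓ m} => ?_, fun {ℓ m k} => ?_⟩
    · induction ℓ using Quotient.inductionOn with | h v =>
      exact (onCommonGeodesic_iff hcov v v).2 (Related.refl hcov _)
    · induction ℓ, m using Quotient.inductionOn₂ with | h v w =>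
      rw [onCommonGeodesic_iff hcov, onCommonGeodesic_iff hcov]
      exact Related.symm hcov
    · induction ℓ, m, k using Quotient.inductionOn₃ with | h u v w =>
      rw [onCommonGeodesic_iff hcov, onCommonGeodesic_iff hcov, onCommonGeodesic_iff hcov]
      exact Related.trans hcov
  rw [← onCommonGeodesic_iff hcov]
  exact ⟨fun h => heq.eqvGen_iff.1 (Quot.eqvGen_exact h), fun h => Quot.sound h⟩

/-- Related vectors are exchanged by a smooth local map which preserves relatedness. -/
theorem exists_local_map (hcov : SmoothSymbols cov) {v w : ReducedTangentBundle I M}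
    (h : geodesicProj cov v = geodesicProj cov w) :
    ∃ φ : ReducedTangentBundle I M → ReducedTangentBundle I M,
      ContMDiffAt I.tangent I.tangent ∞ φ v ∧ φ v = w ∧
        ∀ᶠ u in 𝓝 v, geodesicProj cov (φ u) = geodesicProj cov u := by
  obtain ⟨t, ht, c, hc, hw⟩ := (geodesicProj_eq_iff hcov).1 h
  obtain ⟨h1, h2⟩ := flow_smooth hcov ht
  have h3 : ContMDiffAt I.tangent (𝓘(ℝ, ℝ).prod I.tangent) ∞
      (fun u : ReducedTangentBundle I M => (t, (u : TangentBundle I M))) v :=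
    contMDiffAt_const.prodMk (contMDiff_subtype_val v)
  have h4 : ContMDiffAt I.tangent I.tangent ∞
      (fun u : ReducedTangentBundle I M => smulT c (flow cov (u : TangentBundle I M) t)) v :=
    ContMDiffAt.comp v (contMDiff_smulT c _) (ContMDiffAt.comp v h2 h3)
  have h5 : ∀ᶠ u : ReducedTangentBundle I M in 𝓝 v, t ∈ dom cov (u : TangentBundle I M) :=
    h3.continuousAt.eventually h1
  have hn : ∀ u : ReducedTangentBundle I M, t ∈ dom cov (u : TangentBundle I M) →
      smulT c (flow cov (u : TangentBundle I M) t) ∈ ReducedTangentBundle I M := fun u hu =>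
    smul_ne_zero hc (flow_ne_zero hcov hu u.2)
  classical
  let φ : ReducedTangentBundle I M → ReducedTangentBundle I M := fun u =>
    if h : t ∈ dom cov (u : TangentBundle I M) then ⟨_, hn u h⟩ else u
  have hφ : ∀ u : ReducedTangentBundle I M, t ∈ dom cov (u : TangentBundle I M) →
      (φ u : TangentBundle I M) = smulT c (flow cov (u : TangentBundle I M) t) := fun u hu => by
    simp only [φ, dif_pos hu]
  refine ⟨φ, contMDiffAt_of_subtype_val (h4.congr_of_eventuallyEq (h5.mono hφ)),
    Subtype.ext ((hφ v ht).trans hw.symm), h5.mono fun u hu => ?_⟩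
  refine ((geodesicProj_eq_iff hcov).2 ⟨t, hu, c, hc, hφ u hu⟩).symm

theorem continuous_geodesicProj : Continuous (geodesicProj cov) :=
  continuous_quot_mk.comp continuous_quot_mk

theorem surjective_geodesicProj : Function.Surjective (geodesicProj cov) :=
  Quot.mk_surjective.comp Quotient.mk_surjective

/-- A class-preserving local map carries a neighbourhood of `w` into any open set that meets the
class of `w`, so saturations of open sets are open. Openness lets Hausdorffness be tested on pairs
of vectors and lets countability descend. -/
theorem isOpenQuotientMap_geodesicProj (hcov : SmoothSymbols cov) :
    IsOpenQuotientMap (geodesicProj cov) := by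
  refine ⟨surjective_geodesicProj, continuous_geodesicProj, fun O hO => ?_⟩
  have hq : IsQuotientMap (geodesicProj cov) := isQuotientMap_quot_mk.comp isQuotientMap_quot_mk
  rw [← hq.isOpen_preimage, isOpen_iff_mem_nhds]
  rintro w ⟨v, hv, h⟩
  obtain ⟨φ, h1, h2, h3⟩ := exists_local_map hcov h.symm
  have h4 : ∀ᶠ u in 𝓝 w, φ u ∈ O := h1.continuousAt.eventually (by rw [h2]; exact hO.mem_nhds hv)
  filter_upwards [h3, h4] with u h5 h6 using ⟨φ u, h6, h5⟩

end Geodesics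

end Geod

/-! ### Escape from compact sets and Hausdorffness -/

namespace Geod

section Geodesics

variable {E : Type*} [NormedAddCommGroup E] [NormedSpace ℝ E] [FiniteDimensional ℝ E]
  {H : Type*} [TopologicalSpace H] {I : ModelWithCorners ℝ E H}
  {M : Type*} [TopologicalSpace M] [ChartedSpace H M] [IsManifold I ∞ M]
  {cov : CovariantDerivative I E (TangentSpace I : M → Type _)}

theorem tcoord_snd_ne_zero {x₀ : M} {v : TangentBundle I M} (hv : v.1 ∈ (chartAt H x₀).source)
    (h : v.2 ≠ 0) : (tcoord I x₀ v).2 ≠ 0 := fun h0 =>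
  h (coordL_injective hv (h0.trans (map_zero (coordL I x₀ v.1)).symm))

theorem continuousAt_tcoord {x₀ : M} {v : TangentBundle I M} (hv : v.1 ∈ (chartAt H x₀).source) :
    ContinuousAt (tcoord I x₀) v := (contMDiffAt_tcoord hv).continuousAt

/-- Proportionality of nonzero tangent vectors is a closed condition. -/
theorem eventually_not_proportional [T2Space M] {v w : TangentBundle I M} (hv : v.2 ≠ 0)
    (hw : w.2 ≠ 0) (h : ∀ c : ℝ, c ≠ 0 → w ≠ smulT c v) :
    ∀ᶠ p : TangentBundle I M × TangentBundle I M in 𝓝 (v, w),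
      ∀ c : ℝ, c ≠ 0 → p.2 ≠ smulT c p.1 := by
  -- Over one base point, not being proportional is linear independence, an open condition in a
  -- chart. Over distinct base points, Hausdorffness keeps the base points distinct.
  by_cases he : v.1 = w.1
  · have hs : v.1 ∈ (chartAt H v.1).source := mem_chart_source H v.1
    have hs' : w.1 ∈ (chartAt H v.1).source := he ▸ hs
    have h1 : LinearIndependent ℝ ![(tcoord I v.1 v).2, (tcoord I v.1 w).2] := by
      rw [LinearIndependent.pair_iff' (tcoord_snd_ne_zero hs hv)]
      intro c hc
      have hc0 : c ≠ 0 := by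
        rintro rfl
        rw [zero_smul] at hc
        exact tcoord_snd_ne_zero hs' hw hc.symm
      refine h c hc0 (tcoord_injOn hs' hs ?_)
      rw [tcoord_smulT]
      exact Prod.ext (congrArg (extChartAt I v.1) he.symm) hc.symm
    have h2 : ContinuousAt (fun p : TangentBundle I M × TangentBundle I M =>
        ![(tcoord I v.1 p.1).2, (tcoord I v.1 p.2).2]) (v, w) := by
      rw [continuousAt_pi]
      intro i
      fin_cases i
      · exact continuous_snd.continuousAt.comp
          (ContinuousAt.comp (g := tcoord I v.1) (continuousAt_tcoord hs) continuousAt_fst)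
      · exact continuous_snd.continuousAt.comp
          (ContinuousAt.comp (g := tcoord I v.1) (continuousAt_tcoord hs') continuousAt_snd)
    filter_upwards [h2.eventually (isOpen_setOfPred_linearIndependent.mem_nhds h1)] with p hp c hc hpc
    have h3 : (tcoord I v.1 p.2).2 = c • (tcoord I v.1 p.1).2 := by
      rw [hpc, tcoord_smulT]
    have hp' : LinearIndependent ℝ ![(tcoord I v.1 p.1).2, (tcoord I v.1 p.2).2] := hp
    have h4 := (LinearIndependent.pair_iff' (hp'.ne_zero 0)).1 hp' c
    exact h4 h3.symm
  · have h1 : ContinuousAt (fun p : TangentBundle I M × TangentBundle I M => p.1.1) (v, w) :=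
      (continuous_tangent_fst.comp continuous_fst).continuousAt
    have h2 : ContinuousAt (fun p : TangentBundle I M × TangentBundle I M => p.2.1) (v, w) :=
      (continuous_tangent_fst.comp continuous_snd).continuousAt
    filter_upwards [(h1.ne_iff_eventually_ne h2).1 he] with p hp c hc hpc
    exact hp (by rw [hpc]; rfl)

variable [I.Boundaryless] [T2Space M]

theorem continuousAt_flow (hcov : SmoothSymbols cov) {v : TangentBundle I M} {t : ℝ}
    (ht : t ∈ dom cov v) :
    ContinuousAt (fun p : ℝ × TangentBundle I M => flow cov p.2 p.1) (t, v) :=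
  (flow_smooth hcov ht).2.continuousAt

theorem continuousAt_flow_left (hcov : SmoothSymbols cov) {v : TangentBundle I M} {t : ℝ}
    (ht : t ∈ dom cov v) : ContinuousAt (fun w => flow cov w t) v :=
  ContinuousAt.comp (f := fun w : TangentBundle I M => (t, w)) (continuousAt_flow hcov ht)
    (by fun_prop)

theorem eventually_mem_dom (hcov : SmoothSymbols cov) {v : TangentBundle I M} {t : ℝ}
    (ht : t ∈ dom cov v) : ∀ᶠ w in 𝓝 v, t ∈ dom cov w :=
  (show ContinuousAt (fun w : TangentBundle I M => (t, w)) v by fun_prop).eventually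
    (flow_smooth hcov ht).1

/-- A nonconstant geodesic leaves its initial point at once. -/
theorem eventually_flow_ne (hcov : SmoothSymbols cov) {v : TangentBundle I M} (hv : v.2 ≠ 0) :
    ∀ᶠ t in 𝓝[≠] (0 : ℝ), (flow cov v t).1 ≠ v.1 := by
  have h0 := zero_mem_dom hcov v
  have hs : v.1 ∈ (chartAt H v.1).source := mem_chart_source H v.1
  have he : geo cov v 0 = v.1 := by unfold geo; rw [flow_zero hcov]
  have h1 : HasDerivAt (fun s => extChartAt I v.1 (geo cov v s))
      (sprayField cov v.1 (tcoord I v.1 (lift I (geo cov v) 0))).1 0 :=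
    ((isGeodesicOn_geo hcov v).hasDerivAt h0 (x₀ := v.1) (by rwa [he])).fst
  rw [lift_geo hcov h0, flow_zero hcov] at h1
  have h2 : (sprayField cov v.1 (tcoord I v.1 v)).1 ≠ 0 := tcoord_snd_ne_zero hs hv
  filter_upwards [h1.eventually_ne (c := extChartAt I v.1 v.1) h2] with t ht h3
  exact ht (congrArg (extChartAt I v.1) h3)

/-- Every point has a neighbourhood which every nonconstant geodesic leaves. -/
theorem exists_nhds_exit (hcov : SmoothSymbols cov) (z : M) :
    ∃ U ∈ 𝓝 z, ∀ v : TangentBundle I M, v.2 ≠ 0 → v.1 ∈ U →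
      ∃ τ > 0, τ ∈ dom cov v ∧ (flow cov v τ).1 ∉ U := by
  have hz := mem_chart_source H z
  have hproper : ProperSpace E := FiniteDimensional.proper ℝ E
  -- By homogeneity of the flow only unit directions in the chart matter. Each direction has an exit
  -- time and a neighbourhood of `z` that serve all nearby directions, and an exit persists when `U`
  -- shrinks, so compactness of the sphere suffices.
  have key : ∃ U ∈ 𝓝 z, ∀ p ∈ U, ∀ ξ ∈ Metric.sphere (0 : E) 1, ∃ τ > 0,
      τ ∈ dom cov (tpoint I z (extChartAt I z p, ξ)) ∧
        (flow cov (tpoint I z (extChartAt I z p, ξ)) τ).1 ∉ U := by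
    refine (isCompact_sphere (0 : E) 1).induction_on
      (p := fun S => ∃ U ∈ 𝓝 z, ∀ p ∈ U, ∀ ξ ∈ S, ∃ τ > 0,
        τ ∈ dom cov (tpoint I z (extChartAt I z p, ξ)) ∧
          (flow cov (tpoint I z (extChartAt I z p, ξ)) τ).1 ∉ U) ?_ ?_ ?_ ?_
    · exact ⟨univ, Filter.univ_mem, fun p _ ξ h => absurd h (notMem_empty _)⟩
    · rintro S T hST ⟨U, hU, h⟩
      exact ⟨U, hU, fun p hp ξ hξ => h p hp ξ (hST hξ)⟩
    · rintro S T ⟨U, hU, h⟩ ⟨V, hV, h'⟩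
      refine ⟨U ∩ V, Filter.inter_mem hU hV, ?_⟩
      rintro p ⟨hp, hp'⟩ ξ (hξ | hξ)
      · obtain ⟨τ, h1, h2, h3⟩ := h p hp ξ hξ
        exact ⟨τ, h1, h2, fun h4 => h3 h4.1⟩
      · obtain ⟨τ, h1, h2, h3⟩ := h' p hp' ξ hξ
        exact ⟨τ, h1, h2, fun h4 => h3 h4.2⟩
    · intro ξ hξ
      set y := extChartAt I z z
      set v := tpoint I z (y, ξ)
      have hy : y ∈ (extChartAt I z).target := mem_extChartAt_target z
      have hc : ContinuousAt (tpoint I z) (y, ξ) := (contMDiffAt_tpoint (p := (y, ξ)) hy).continuousAt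
      have hv1 : v.1 = z := (extChartAt I z).left_inv (mem_extChartAt_source z)
      have hv : v.2 ≠ 0 := by
        intro h0
        have h1 : (tcoord I z v).2 = ξ := by rw [tcoord_tpoint (p := (y, ξ)) hy]
        have h2 : (tcoord I z v).2 = 0 := by
          change coordL I z v.1 v.2 = 0
          rw [h0, map_zero]
        rw [← h1, h2] at hξ
        simp at hξ
      have h3 : ∀ᶠ τ in 𝓝[>] (0 : ℝ), (flow cov v τ).1 ≠ z ∧ τ ∈ dom cov v ∧ 0 < τ := by
        have := (eventually_flow_ne hcov hv).filter_mono
          (nhdsWithin_mono (0 : ℝ) fun t (ht : 0 < t) => ne_of_gt ht)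
        rw [hv1] at this
        filter_upwards [this, nhdsWithin_le_nhds ((isOpen_dom v).mem_nhds (zero_mem_dom hcov v)),
          self_mem_nhdsWithin] with τ h1 h2 h3 using ⟨h1, h2, h3⟩
      obtain ⟨τ, hτ1, hτ2, hτ0⟩ := h3.exists
      obtain ⟨A, B, hA, hB, hzA, hwB, hAB⟩ := t2_separation hτ1.symm
      have h4 : ∀ᶠ w in 𝓝 v, τ ∈ dom cov w ∧ (flow cov w τ).1 ∈ B :=
        (eventually_mem_dom hcov hτ2).and ((continuous_tangent_fst.continuousAt.comp
          (continuousAt_flow_left hcov hτ2)).eventually (hB.mem_nhds hwB))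
      have h5 : ContinuousAt (fun q : M × E => tpoint I z (extChartAt I z q.1, q.2)) (z, ξ) := by
        refine ContinuousAt.comp (g := tpoint I z) hc ?_
        exact (ContinuousAt.comp (g := extChartAt I z) (f := fun q : M × E => q.1) (x := (z, ξ))
          (continuousAt_extChartAt z) continuousAt_fst).prodMk continuousAt_snd
      have h6 := h5.eventually h4
      rw [nhds_prod_eq, Filter.eventually_prod_iff] at h6
      obtain ⟨P, hP, Q, hQ, h7⟩ := h6
      refine ⟨_, mem_nhdsWithin_of_mem_nhds hQ, {p | P p} ∩ A,
        Filter.inter_mem hP (hA.mem_nhds hzA), fun p hp η hη => ?_⟩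
      have h8 := h7 hp.1 hη
      exact ⟨τ, hτ0, h8.1, fun h9 => disjoint_left.1 hAB h9.2 h8.2⟩
  obtain ⟨U, hU, h⟩ := key
  refine ⟨U ∩ (chartAt H z).source, Filter.inter_mem hU ((chartAt H z).open_source.mem_nhds hz), ?_⟩
  rintro v hv ⟨hvU, hvs⟩
  set η := (tcoord I z v).2 with hη
  have hη0 : ‖η‖ ≠ 0 := norm_ne_zero_iff.2 (tcoord_snd_ne_zero hvs hv)
  set w := tpoint I z (extChartAt I z v.1, ‖η‖⁻¹ • η) with hw
  have hvt : extChartAt I z v.1 ∈ (extChartAt I z).target :=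
    (extChartAt I z).map_source (by rwa [extChartAt_source])
  have hws : w.1 ∈ (chartAt H z).source := extChartAt_symm_mem hvt
  have hvw : v = smulT ‖η‖ w := by
    refine tcoord_injOn hvs hws ?_
    rw [tcoord_smulT, hw, tcoord_tpoint (p := (extChartAt I z v.1, ‖η‖⁻¹ • η)) hvt,
      smul_inv_smul₀ hη0]
    rfl
  obtain ⟨τ, h1, h2, h3⟩ := h v.1 hvU (‖η‖⁻¹ • η) (by
    rw [mem_sphere_zero_iff_norm, norm_smul, norm_inv, norm_norm, inv_mul_cancel₀ hη0])
  have h4 : ‖η‖ * (‖η‖⁻¹ * τ) = τ := mul_inv_cancel_left₀ hη0 τ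
  refine ⟨‖η‖⁻¹ * τ, mul_pos (inv_pos.2 ((norm_nonneg η).lt_of_ne' hη0)) h1, ?_, ?_⟩
  · rw [hvw]
    exact (mem_dom_smulT hcov hη0).2 (by rwa [h4])
  · intro h5
    rw [hvw, flow_smulT hcov hη0 (by rwa [h4]), h4] at h5
    exact h3 h5.1

/-- In a nonreturning manifold no nonconstant geodesic stays in a compact set. -/
theorem Nonreturning.exists_notMem (hN : Nonreturning cov) (hcov : SmoothSymbols cov)
    {v : TangentBundle I M} (hv : v.2 ≠ 0) {K : Set M} (hK : IsCompact K) :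
    ∃ t > 0, t ∈ dom cov v ∧ (flow cov v t).1 ∉ K := by
  have h0 : ∃ T > 0, T ∈ dom cov v := by
    have h1 : ∀ᶠ t in 𝓝[>] (0 : ℝ), t ∈ dom cov v ∧ 0 < t :=
      Filter.Eventually.and
        (nhdsWithin_le_nhds ((isOpen_dom v).mem_nhds (zero_mem_dom hcov v))) self_mem_nhdsWithin
    obtain ⟨T, h1, h2⟩ := h1.exists
    exact ⟨T, h2, h1⟩
  -- The statement is strengthened to all later times of the domain, so that it passes to finite
  -- unions by taking the larger `T`.
  have key : ∃ T > 0, T ∈ dom cov v ∧ ∀ t ∈ dom cov v, T ≤ t → (flow cov v t).1 ∉ K := by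
    refine hK.induction_on
      (p := fun S => ∃ T > 0, T ∈ dom cov v ∧ ∀ t ∈ dom cov v, T ≤ t → (flow cov v t).1 ∉ S)
      ?_ ?_ ?_ ?_
    · obtain ⟨T, h1, h2⟩ := h0
      exact ⟨T, h1, h2, fun _ _ _ => notMem_empty _⟩
    · rintro S S' hS ⟨T, h1, h2, h3⟩
      exact ⟨T, h1, h2, fun t ht hTt h => h3 t ht hTt (hS h)⟩
    · rintro S S' ⟨T, h1, h2, h3⟩ ⟨T', h1', h2', h3'⟩
      refine ⟨max T T', lt_max_of_lt_left h1, ?_, ?_⟩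
      · rcases max_choice T T' with h | h <;> rwa [h]
      · rintro t ht hTt (h | h)
        · exact h3 t ht ((le_max_left _ _).trans hTt) h
        · exact h3' t ht ((le_max_right _ _).trans hTt) h
    · intro z _
      obtain ⟨V, hV, hexit⟩ := exists_nhds_exit hcov z
      obtain ⟨U, hU, hUV, hret⟩ := hN z V hV
      refine ⟨U, mem_nhdsWithin_of_mem_nhds hU, ?_⟩
      obtain ⟨T, hT0, hT⟩ := h0
      -- If the geodesic meets `U` after time `T`, it must leave the larger set `V` later, hence
      -- leaves `U`, and from then on it cannot return to `U`.
      by_cases hex : ∃ r ∈ dom cov v, T ≤ r ∧ (flow cov v r).1 ∈ U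
      · obtain ⟨r, hr, hTr, hrU⟩ := hex
        obtain ⟨τ, hτ0, hτ, hτU⟩ := hexit _ (flow_ne_zero hcov hr hv) (hUV hrU)
        have hrτ := (mem_dom_flow hcov hr).1 hτ
        rw [flow_flow hcov hr hrτ] at hτU
        have h1 : (flow cov v (τ + r)).1 ∉ U := fun h => hτU (hUV h)
        refine ⟨τ + r, by linarith, hrτ, fun t ht hle => ?_⟩
        rcases hle.eq_or_lt with rfl | hlt
        · exact h1
        · exact hret _ _ (isInextendibleGeodesic_geo hcov v) r hr (τ + r) hrτ t ht
            (by linarith) hlt hrU h1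
      · exact ⟨T, hT0, hT, fun t ht hle h => hex ⟨t, ht, hle, h⟩⟩
  obtain ⟨T, h1, h2, h3⟩ := key
  exact ⟨T, h1, h2, h3 T h2 le_rfl⟩

/-- Time reversal: the forward statement for the opposite vector. -/
theorem Nonreturning.exists_neg_notMem (hN : Nonreturning cov) (hcov : SmoothSymbols cov)
    {v : TangentBundle I M} (hv : v.2 ≠ 0) {K : Set M} (hK : IsCompact K) :
    ∃ t < 0, t ∈ dom cov v ∧ (flow cov v t).1 ∉ K := by
  have h1 : (-1 : ℝ) ≠ 0 := by norm_num
  obtain ⟨t, h2, h3, h4⟩ := hN.exists_notMem hcov (v := smulT (-1) v)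
    (smul_ne_zero h1 hv) hK
  rw [mem_dom_smulT hcov h1] at h3
  rw [flow_smulT hcov h1 h3] at h4
  exact ⟨-1 * t, by linarith, h3, h4⟩

/-- The space of geodesics of a nonreturning pseudoconvex manifold is Hausdorff. -/
theorem t2Space_spaceOfGeodesics (hcov : SmoothSymbols cov) (hN : Nonreturning cov)
    (hP : Pseudoconvex cov) : T2Space (SpaceOfGeodesics cov) := by
  have hlc : LocallyCompactSpace M := Manifold.locallyCompact_of_finiteDimensional I
  rw [t2Space_iff_of_isOpenQuotientMap (isOpenQuotientMap_geodesicProj hcov),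
    ← isOpen_compl_iff, isOpen_iff_mem_nhds]
  rintro ⟨v, w⟩ hvw
  have hvw' : ¬ Related cov (v : TangentBundle I M) w := fun h =>
    hvw ((geodesicProj_eq_iff hcov).2 h)
  obtain ⟨K₁, hK₁, hvK⟩ := exists_compact_mem_nhds (v : TangentBundle I M).1
  obtain ⟨K₂, hK₂, hwK⟩ := exists_compact_mem_nhds (w : TangentBundle I M).1
  obtain ⟨K', hK', hseg⟩ := hP (K₁ ∪ K₂) (hK₁.union hK₂)
  -- The points at times `a` and `b` lie outside `K'`, also for vectors near `v`. If such a vector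
  -- were related to one near `w` by a time beyond `a` or `b`, the segment would have endpoints in
  -- `K₁ ∪ K₂` and yet leave `K'`. Only times in the compact interval `[a, b]` remain.
  obtain ⟨a, ha0, ha, haK⟩ := hN.exists_neg_notMem hcov v.2 hK'
  obtain ⟨b, hb0, hb, hbK⟩ := hN.exists_notMem hcov v.2 hK'
  have hab : Icc a b ⊆ dom cov (v : TangentBundle I M) := (ordConnected_dom _).out ha hb
  have hev : ∀ {t}, t ∈ dom cov (v : TangentBundle I M) →
      (flow cov (v : TangentBundle I M) t).1 ∉ K' →
      ∀ᶠ u in 𝓝 (v : TangentBundle I M), t ∈ dom cov u ∧ (flow cov u t).1 ∉ K' := fun ht htK =>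
    (eventually_mem_dom hcov ht).and ((continuous_tangent_fst.continuousAt.comp
      (continuousAt_flow_left hcov ht)).eventually (hK'.isClosed.isOpen_compl.mem_nhds htK))
  have hprop : ∀ᶠ p : TangentBundle I M × TangentBundle I M in
      𝓝 ((v : TangentBundle I M), (w : TangentBundle I M)), ∀ t ∈ Icc a b,
        ∀ c : ℝ, c ≠ 0 → p.2 ≠ smulT c (flow cov p.1 t) := by
    refine isCompact_Icc.eventually_forall_of_forall_eventually
      (P := fun (p : TangentBundle I M × TangentBundle I M) t =>
        ∀ c : ℝ, c ≠ 0 → p.2 ≠ smulT c (flow cov p.1 t)) fun t ht => ?_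
    have h1 := eventually_not_proportional (flow_ne_zero hcov (hab ht) v.2) w.2
      fun c hc h => hvw' ⟨t, hab ht, c, hc, h⟩
    have h2 : ContinuousAt (fun z : (TangentBundle I M × TangentBundle I M) × ℝ =>
        (flow cov z.1.1 z.2, z.1.2)) (((v : TangentBundle I M), (w : TangentBundle I M)), t) := by
      refine ContinuousAt.prodMk ?_ (by fun_prop)
      exact ContinuousAt.comp
        (f := fun z : (TangentBundle I M × TangentBundle I M) × ℝ => (z.2, z.1.1))
        (g := fun p : ℝ × TangentBundle I M => flow cov p.2 p.1)
        (continuousAt_flow hcov (hab ht)) (by fun_prop)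
    exact h2.eventually h1
  have hv1 : ∀ᶠ u in 𝓝 (v : TangentBundle I M), u.1 ∈ K₁ :=
    continuous_tangent_fst.continuousAt.eventually hvK
  have hw1 : ∀ᶠ u in 𝓝 (w : TangentBundle I M), u.1 ∈ K₂ :=
    continuous_tangent_fst.continuousAt.eventually hwK
  have hval : ContinuousAt (fun p : ReducedTangentBundle I M × ReducedTangentBundle I M =>
      ((p.1 : TangentBundle I M), (p.2 : TangentBundle I M))) (v, w) := by fun_prop
  have hall := ((((hev ha haK).and (hev hb hbK)).and hv1).prod_inl_nhds (w : TangentBundle I M)).and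
    ((hw1.prod_inr_nhds (v : TangentBundle I M)).and hprop)
  filter_upwards [hval.eventually hall] with p hp hpr
  obtain ⟨⟨⟨⟨ha', haK'⟩, hb', hbK'⟩, hp1⟩, hp2, hpp⟩ := hp
  obtain ⟨t, ht, c, hc, h⟩ := (geodesicProj_eq_iff hcov).1 hpr
  have h0 := zero_mem_dom hcov (p.1 : TangentBundle I M)
  have hgeo := isInextendibleGeodesic_geo hcov (p.1 : TangentBundle I M)
  have e0 : geo cov (p.1 : TangentBundle I M) 0 ∈ K₁ ∪ K₂ := by
    unfold geo
    rw [flow_zero hcov]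
    exact Or.inl hp1
  have et : geo cov (p.1 : TangentBundle I M) t ∈ K₁ ∪ K₂ := by
    rw [h] at hp2
    exact Or.inr hp2
  refine hpp t ⟨?_, ?_⟩ c hc h
  · by_contra! hlt
    exact haK' (hseg _ _ hgeo t ht 0 h0 (by linarith) et e0 a ⟨hlt.le, ha0.le⟩)
  · by_contra! hlt
    exact hbK' (hseg _ _ hgeo 0 h0 t ht (by linarith) e0 et b ⟨hb0.le, hlt.le⟩)

end Geodesics

end Geod

/-! ### Transversals to the geodesics -/

namespace Geod

section Geodesics

variable {E : Type*} [NormedAddCommGroup E] [NormedSpace ℝ E] [FiniteDimensional ℝ E]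
  {H : Type*} [TopologicalSpace H] {I : ModelWithCorners ℝ E H}
  {M : Type*} [TopologicalSpace M] [ChartedSpace H M] [IsManifold I ∞ M]
  {cov : CovariantDerivative I E (TangentSpace I : M → Type _)}
  [I.Boundaryless] [T2Space M]

theorem hasDerivAt_tcoord_flow (hcov : SmoothSymbols cov) {v : TangentBundle I M} {t : ℝ} {x₀ : M}
    (ht : t ∈ dom cov v) (hs : (flow cov v t).1 ∈ (chartAt H x₀).source) :
    HasDerivAt (fun s => tcoord I x₀ (flow cov v s)) (sprayField cov x₀ (tcoord I x₀ (flow cov v t)))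
      t := by
  have h1 := (isGeodesicOn_geo hcov v).hasDerivAt ht (x₀ := x₀) hs
  rw [lift_geo hcov ht] at h1
  refine h1.congr_of_eventuallyEq ?_
  filter_upwards [(isOpen_dom v).mem_nhds ht] with s hs
  rw [lift_geo hcov hs]

/-- In a nonreturning manifold a geodesic meets a small transversal hypersurface at most once. -/
theorem Nonreturning.exists_transversal (hN : Nonreturning cov) (hcov : SmoothSymbols cov)
    (v₀ : TangentBundle I M) (l : E →L[ℝ] ℝ) (hl : 0 < l (tcoord I v₀.1 v₀).2) :
    ∃ O ∈ 𝓝 v₀, ∀ w ∈ O, ∀ w' ∈ O, Related cov w w' →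
      l (tcoord I v₀.1 w).1 = l (tcoord I v₀.1 w').1 → ∃ c : ℝ, c ≠ 0 ∧ w' = smulT c w := by
  set x₀ := v₀.1
  have hx₀ : v₀.1 ∈ (chartAt H x₀).source := mem_chart_source H x₀
  have h0 := zero_mem_dom hcov v₀
  have hf0 := flow_zero hcov v₀
  have h1 : ∀ᶠ p : ℝ × TangentBundle I M in 𝓝 (0, v₀), p.1 ∈ dom cov p.2 ∧
      (flow cov p.2 p.1).1 ∈ (chartAt H x₀).source ∧
        0 < l (tcoord I x₀ (flow cov p.2 p.1)).2 := by
    refine (flow_smooth hcov h0).1.and ((continuousAt_flow hcov h0).eventually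
      (p := fun w => w.1 ∈ (chartAt H x₀).source ∧ 0 < l (tcoord I x₀ w).2) ?_)
    have hs : (flow cov v₀ 0).1 ∈ (chartAt H x₀).source := by rwa [hf0]
    refine Filter.Eventually.and ((isOpen_tangent_source x₀).mem_nhds hs) ?_
    have h2 : ContinuousAt (fun w => l (tcoord I x₀ w).2) (flow cov v₀ 0) :=
      (l.continuous.comp continuous_snd).continuousAt.comp (continuousAt_tcoord hs)
    refine h2.eventually (isOpen_Ioi.mem_nhds ?_)
    rw [mem_Ioi, hf0]
    exact hl
  rw [nhds_prod_eq, Filter.eventually_prod_iff] at h1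
  obtain ⟨P, hP, Q, hQ, h2⟩ := h1
  obtain ⟨ε, hε, hεP⟩ := Metric.eventually_nhds_iff.1 hP
  -- Halved so that the closed interval lies inside the open one.
  set δ := ε / 2 with hδ
  have hδ0 : 0 < δ := by positivity
  have hδP : ∀ t ∈ Icc (-δ) δ, P t := fun t ht => hεP (by
    rw [Real.dist_eq, sub_zero]
    exact lt_of_le_of_lt (abs_le.2 ⟨ht.1, ht.2⟩) (by linarith))
  -- The derivative of `l` of the position is `l` of the velocity, which is positive near `v₀`.
  have hmono : ∀ w, Q w → StrictMonoOn (fun t => l (tcoord I x₀ (flow cov w t)).1) (Icc (-δ) δ) := by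
    intro w hw
    have hd : ∀ t ∈ Icc (-δ) δ, HasDerivAt (fun t => l (tcoord I x₀ (flow cov w t)).1)
        (l (tcoord I x₀ (flow cov w t)).2) t := fun t ht => by
      have h3 := h2 (hδP t ht) hw
      have h4 : HasDerivAt (fun t => (tcoord I x₀ (flow cov w t)).1) _ t :=
        (hasDerivAt_tcoord_flow hcov h3.1 h3.2.1).fst
      exact l.hasFDerivAt.comp_hasDerivAt t h4
    refine strictMonoOn_of_hasDerivWithinAt_pos (convex_Icc _ _)
      (fun t ht => (hd t ht).continuousAt.continuousWithinAt)
      (fun t ht => (hd t (interior_subset ht)).hasDerivWithinAt)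
      fun t ht => (h2 (hδP t (interior_subset ht)) hw).2.2
  have hz : (0 : ℝ) ∈ Icc (-δ) δ := ⟨by linarith, hδ0.le⟩
  have hp : δ ∈ Icc (-δ) δ := ⟨by linarith, le_rfl⟩
  have hm : -δ ∈ Icc (-δ) δ := ⟨le_rfl, by linarith⟩
  have hQ0 : Q v₀ := hQ.self_of_nhds
  -- By strict monotonicity the geodesic of `v₀` is away from `x₀` at times `δ` and `-δ`, and nearby
  -- geodesics then avoid a fixed neighbourhood of `x₀` at those times.
  have hexit : ∀ t ∈ Icc (-δ) δ, t ≠ 0 → ∃ A ∈ 𝓝 x₀, ∀ᶠ w in 𝓝 v₀, (flow cov w t).1 ∉ A := by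
    intro t ht ht0
    have hne : x₀ ≠ (flow cov v₀ t).1 := by
      intro he
      have h3 : (flow cov v₀ 0).1 = (flow cov v₀ t).1 := by rw [hf0]; exact he
      exact ht0 ((hmono v₀ hQ0).injOn hz ht (by
        change l (extChartAt I x₀ (flow cov v₀ 0).1) = l (extChartAt I x₀ (flow cov v₀ t).1)
        rw [h3])).symm
    obtain ⟨A, B, hA, hB, hzA, hwB, hAB⟩ := t2_separation hne
    refine ⟨A, hA.mem_nhds hzA, ?_⟩
    have h3 := (continuous_tangent_fst.continuousAt.comp
      (continuousAt_flow_left hcov (h2 (hδP t ht) hQ0).1)).eventually (hB.mem_nhds hwB)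
    filter_upwards [h3] with w hw h4 using disjoint_left.1 hAB h4 hw
  obtain ⟨A, hA, hAw⟩ := hexit δ hp hδ0.ne'
  obtain ⟨B, hB, hBw⟩ := hexit (-δ) hm (by linarith)
  obtain ⟨U, hU, hUAB, hret⟩ := hN x₀ (A ∩ B) (Filter.inter_mem hA hB)
  refine ⟨_, (((continuous_tangent_fst.continuousAt.eventually hU).and hAw).and
    (hBw.and hQ)), ?_⟩
  rintro w ⟨⟨hwU, hwA⟩, hwB, hwQ⟩ w' ⟨⟨hwU', -⟩, -, -⟩ ⟨t, ht, c, hc, rfl⟩ hlw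
  have hw0 := zero_mem_dom hcov w
  have hgeo := isInextendibleGeodesic_geo hcov w
  have hUt : geo cov w t ∈ U := hwU'
  have hU0 : geo cov w 0 ∈ U := by
    unfold geo
    rw [flow_zero hcov]
    exact hwU
  -- Otherwise the geodesic would be in `U` at times 0 and `t`, but outside it at `δ` or `-δ` in
  -- between.
  have ht' : t ∈ Icc (-δ) δ := by
    constructor
    · by_contra! hlt
      exact hret _ _ hgeo t ht (-δ) (h2 (hδP _ hm) hwQ).1 0 hw0 hlt (by linarith) hUt
        (fun h => hwB (hUAB h).2) hU0
    · by_contra! hlt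
      exact hret _ _ hgeo 0 hw0 δ (h2 (hδP _ hp) hwQ).1 t ht hδ0 hlt hU0
        (fun h => hwA (hUAB h).1) hUt
  have h3 : (0 : ℝ) = t := (hmono w hwQ).injOn hz ht' (by
    rw [flow_zero hcov, hlw]
    rfl)
  exact ⟨c, hc, by rw [← h3, flow_zero hcov]⟩

variable {F : Type*} [NormedAddCommGroup F] [NormedSpace ℝ F] {l : E →L[ℝ] ℝ}

/-- The parametrization, by a vector space `F`, of a transversal at `v₀`, in coordinates. -/
def transversalCoord (v₀ : TangentBundle I M) (κ : F ≃L[ℝ] (l.ker × l.ker)) (z : F) : E × E :=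
  -- The position moves in a translate of `l.ker`, which removes displacement along the flow. The
  -- velocity moves in a translate of `l.ker` too, which fixes the value of `l` and so removes the
  -- freedom of scaling.
  ((tcoord I v₀.1 v₀).1 + ((κ z).1 : E), (tcoord I v₀.1 v₀).2 + ((κ z).2 : E))

/-- The parametrization, by a vector space `F`, of a transversal at `v₀`. -/
def transversal (v₀ : TangentBundle I M) (κ : F ≃L[ℝ] (l.ker × l.ker)) (z : F) :
    TangentBundle I M :=
  tpoint I v₀.1 (transversalCoord v₀ κ z)

theorem transversal_zero (v₀ : TangentBundle I M) (κ : F ≃L[ℝ] (l.ker × l.ker)) :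
    transversal v₀ κ 0 = v₀ := by
  unfold transversal transversalCoord
  simp only [map_zero, Prod.fst_zero, Prod.snd_zero, ZeroMemClass.coe_zero, add_zero]
  exact tpoint_tcoord (mem_chart_source H v₀.1)

theorem contDiff_transversalCoord (v₀ : TangentBundle I M) (κ : F ≃L[ℝ] (l.ker × l.ker)) :
    ContDiff ℝ ∞ (transversalCoord v₀ κ) := by
  unfold transversalCoord
  refine (contDiff_const.add ?_).prodMk (contDiff_const.add ?_)
  · exact l.ker.subtypeL.contDiff.comp (contDiff_fst.comp κ.contDiff)
  · exact l.ker.subtypeL.contDiff.comp (contDiff_snd.comp κ.contDiff)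

theorem eventually_transversalCoord_mem (v₀ : TangentBundle I M) (κ : F ≃L[ℝ] (l.ker × l.ker)) :
    ∀ᶠ z in 𝓝 (0 : F), (transversalCoord v₀ κ z).1 ∈ (extChartAt I v₀.1).target := by
  have h1 : ContinuousAt (fun z => (transversalCoord v₀ κ z).1) 0 :=
    (continuous_fst.comp (contDiff_transversalCoord v₀ κ).continuous).continuousAt
  refine h1.eventually ((isOpen_extChartAt_target v₀.1).mem_nhds ?_)
  simp only [transversalCoord, map_zero, Prod.fst_zero, ZeroMemClass.coe_zero, add_zero]
  exact mem_extChartAt_target v₀.1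

theorem contMDiffAt_transversal {v₀ : TangentBundle I M} {κ : F ≃L[ℝ] (l.ker × l.ker)} {z : F}
    (hz : (transversalCoord v₀ κ z).1 ∈ (extChartAt I v₀.1).target) :
    ContMDiffAt 𝓘(ℝ, F) I.tangent ∞ (transversal v₀ κ) z :=
  ContMDiffAt.comp (I' := 𝓘(ℝ, E × E)) (g := tpoint I v₀.1) (f := transversalCoord v₀ κ) z
    (contMDiffAt_tpoint hz)
    (contDiff_transversalCoord v₀ κ).contDiffAt.contMDiffAt

/-- The parametrization `(t, r, z) ↦ r • γ_z'(t)`, in coordinates, of the vectors tangent to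
geodesics through the transversal. -/
def leafMap (cov : CovariantDerivative I E (TangentSpace I : M → Type _)) (v₀ : TangentBundle I M)
    (κ : F ≃L[ℝ] (l.ker × l.ker)) (p : ℝ × ℝ × F) : E × E :=
  tcoord I v₀.1 (smulT p.2.1 (flow cov (transversal v₀ κ p.2.2) p.1))

theorem contDiffAt_leafMap (hcov : SmoothSymbols cov) {v₀ : TangentBundle I M}
    {κ : F ≃L[ℝ] (l.ker × l.ker)} {p : ℝ × ℝ × F}
    (hz : (transversalCoord v₀ κ p.2.2).1 ∈ (extChartAt I v₀.1).target)
    (ht : p.1 ∈ dom cov (transversal v₀ κ p.2.2))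
    (hs : (flow cov (transversal v₀ κ p.2.2) p.1).1 ∈ (chartAt H v₀.1).source) :
    ContDiffAt ℝ ∞ (leafMap cov v₀ κ) p := by
  have h1 : ContMDiffAt 𝓘(ℝ, ℝ × ℝ × F) (𝓘(ℝ, ℝ).prod I.tangent) ∞
      (fun p : ℝ × ℝ × F => (p.1, transversal v₀ κ p.2.2)) p :=
    contDiffAt_fst.contMDiffAt.prodMk (ContMDiffAt.comp (I' := 𝓘(ℝ, F)) (g := transversal v₀ κ)
      (f := fun p : ℝ × ℝ × F => p.2.2) p
      (contMDiffAt_transversal hz) (contDiff_snd.comp contDiff_snd).contDiffAt.contMDiffAt)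
  have h2 : ContMDiffAt 𝓘(ℝ, ℝ × ℝ × F) I.tangent ∞
      (fun p : ℝ × ℝ × F => flow cov (transversal v₀ κ p.2.2) p.1) p :=
    ContMDiffAt.comp (g := fun p : ℝ × TangentBundle I M => flow cov p.2 p.1) p
      (flow_smooth hcov ht).2 h1
  have h3 : ContDiffAt ℝ ∞
      (fun p : ℝ × ℝ × F => tcoord I v₀.1 (flow cov (transversal v₀ κ p.2.2) p.1)) p :=
    contMDiffAt_iff_contDiffAt.1 (ContMDiffAt.comp (g := tcoord I v₀.1) p (contMDiffAt_tcoord hs) h2)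
  have h4 : leafMap cov v₀ κ = fun p : ℝ × ℝ × F =>
      ((tcoord I v₀.1 (flow cov (transversal v₀ κ p.2.2) p.1)).1,
        p.2.1 • (tcoord I v₀.1 (flow cov (transversal v₀ κ p.2.2) p.1)).2) := by
    funext p
    exact tcoord_smulT _ _ _
  rw [h4]
  exact h3.fst.prodMk ((contDiff_fst.comp contDiff_snd).contDiffAt.smul h3.snd)

theorem eventually_leafMap (hcov : SmoothSymbols cov) (v₀ : TangentBundle I M)
    (κ : F ≃L[ℝ] (l.ker × l.ker)) :
    ∀ᶠ p : ℝ × ℝ × F in 𝓝 (0, 1, 0),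
      (transversalCoord v₀ κ p.2.2).1 ∈ (extChartAt I v₀.1).target ∧
      p.1 ∈ dom cov (transversal v₀ κ p.2.2) ∧
      (flow cov (transversal v₀ κ p.2.2) p.1).1 ∈ (chartAt H v₀.1).source := by
  have h0 := eventually_transversalCoord_mem v₀ κ
  have hc : ContinuousAt (fun p : ℝ × ℝ × F => p.2.2) (0, 1, 0) := by fun_prop
  have hd : (0 : ℝ) ∈ dom cov (transversal v₀ κ 0) := zero_mem_dom hcov _
  have h1 : ContinuousAt (fun p : ℝ × ℝ × F => (p.1, transversal v₀ κ p.2.2)) (0, 1, 0) :=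
    continuousAt_fst.prodMk (ContinuousAt.comp (g := transversal v₀ κ)
      (f := fun p : ℝ × ℝ × F => p.2.2)
      (contMDiffAt_transversal h0.self_of_nhds).continuousAt hc)
  refine (hc.eventually h0).and ((h1.eventually (flow_smooth hcov hd).1).and ?_)
  have h2 : ContinuousAt (fun p : ℝ × ℝ × F => (flow cov (transversal v₀ κ p.2.2) p.1).1)
      (0, 1, 0) := by
    refine continuous_tangent_fst.continuousAt.comp ?_
    exact ContinuousAt.comp (g := fun p : ℝ × TangentBundle I M => flow cov p.2 p.1)
      (f := fun p : ℝ × ℝ × F => (p.1, transversal v₀ κ p.2.2)) (x := (0, 1, 0))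
      (continuousAt_flow hcov hd) h1
  refine h2.eventually ((chartAt H v₀.1).open_source.mem_nhds ?_)
  dsimp only
  rw [flow_zero hcov, transversal_zero]
  exact mem_chart_source H v₀.1

theorem leafMap_zero (hcov : SmoothSymbols cov) {v₀ : TangentBundle I M}
    {κ : F ≃L[ℝ] (l.ker × l.ker)} {z : F} (r : ℝ)
    (hz : (transversalCoord v₀ κ z).1 ∈ (extChartAt I v₀.1).target) :
    leafMap cov v₀ κ (0, r, z) =
      ((tcoord I v₀.1 v₀).1 + ((κ z).1 : E), r • ((tcoord I v₀.1 v₀).2 + ((κ z).2 : E))) := by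
  unfold leafMap
  dsimp only
  rw [flow_zero hcov, tcoord_smulT]
  unfold transversal
  rw [tcoord_tpoint hz]
  rfl

/-- The derivative of the parametrization at the base point is injective. -/
theorem injective_fderiv_leafMap (hcov : SmoothSymbols cov) (v₀ : TangentBundle I M)
    (κ : F ≃L[ℝ] (l.ker × l.ker)) (hl : l (tcoord I v₀.1 v₀).2 = 1) :
    Function.Injective (fderiv ℝ (leafMap cov v₀ κ) (0, 1, 0)) := by
  set y₀ := (tcoord I v₀.1 v₀).1
  set ξ₀ := (tcoord I v₀.1 v₀).2
  obtain ⟨hz, ht, hs⟩ := (eventually_leafMap hcov v₀ κ).self_of_nhds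
  have hD := ((contDiffAt_leafMap hcov hz ht hs).differentiableAt (by simp)).hasFDerivAt
  set D := fderiv ℝ (leafMap cov v₀ κ) (0, 1, 0) with hDdef
  have h1 : D (1, 0, 0) = sprayField cov v₀.1 (y₀, ξ₀) := by
    have ha : HasDerivAt (fun t : ℝ => ((t, 1, 0) : ℝ × ℝ × F)) (1, 0, 0) 0 :=
      (hasDerivAt_id 0).prodMk (hasDerivAt_const _ _)
    have hb := HasFDerivAt.comp_hasDerivAt (f := fun t : ℝ => ((t, 1, 0) : ℝ × ℝ × F)) 0 hD ha
    have hc := hasDerivAt_tcoord_flow hcov ht hs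
    dsimp only at hc
    rw [flow_zero hcov, transversal_zero] at hc
    refine hb.unique (hc.congr_of_eventuallyEq (Filter.Eventually.of_forall fun t => ?_))
    simp only [Function.comp_apply, leafMap, smulT_one, transversal_zero]
  have h2 : ∀ (ρ : ℝ) (z : F), D (0, ρ, z) = (((κ z).1 : E), ρ • ξ₀ + ((κ z).2 : E)) := by
    intro ρ z
    have ha : HasDerivAt (fun t : ℝ => ((0, 1 + t * ρ, t • z) : ℝ × ℝ × F)) (0, ρ, z) 0 := by
      refine (hasDerivAt_const _ _).prodMk (HasDerivAt.prodMk ?_ ?_)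
      · simpa using ((hasDerivAt_id (0 : ℝ)).mul_const ρ).const_add 1
      · simpa using (hasDerivAt_id (0 : ℝ)).smul_const z
    have hD' : HasFDerivAt (leafMap cov v₀ κ) D ((0, 1 + (0 : ℝ) * ρ, (0 : ℝ) • z) : ℝ × ℝ × F) := by
      rw [zero_mul, add_zero, zero_smul]
      exact hD
    have hb := HasFDerivAt.comp_hasDerivAt
      (f := fun t : ℝ => ((0, 1 + t * ρ, t • z) : ℝ × ℝ × F)) 0 hD' ha
    have hc : HasDerivAt (fun t : ℝ => (y₀ + t • ((κ z).1 : E),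
        (1 + t * ρ) • (ξ₀ + t • ((κ z).2 : E)))) (((κ z).1 : E), ρ • ξ₀ + ((κ z).2 : E)) 0 := by
      refine HasDerivAt.prodMk ?_ ?_
      · simpa using ((hasDerivAt_id (0 : ℝ)).smul_const ((κ z).1 : E)).const_add y₀
      · have h3 : HasDerivAt (fun t : ℝ => 1 + t * ρ) ρ 0 := by
          simpa using ((hasDerivAt_id (0 : ℝ)).mul_const ρ).const_add 1
        have h4 : HasDerivAt (fun t : ℝ => ξ₀ + t • ((κ z).2 : E)) ((κ z).2 : E) 0 := by
          simpa using ((hasDerivAt_id (0 : ℝ)).smul_const ((κ z).2 : E)).const_add ξ₀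
        have h5 := h3.smul h4
        simp only [zero_mul, add_zero, zero_smul, one_smul] at h5
        rw [add_comm] at h5
        exact h5
    refine hb.unique (hc.congr_of_eventuallyEq ?_)
    have hct : Filter.Tendsto (fun t : ℝ => t • z) (𝓝 0) (𝓝 0) := by
      have : ContinuousAt (fun t : ℝ => t • z) 0 := by fun_prop
      unfold ContinuousAt at this
      dsimp only at this
      rwa [zero_smul] at this
    have h6 := hct.eventually (eventually_transversalCoord_mem v₀ κ)
    filter_upwards [h6] with t ht
    simp only [Function.comp_apply, leafMap_zero hcov _ ht, map_smul, Prod.smul_fst, Prod.smul_snd,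
      SetLike.val_smul]
    rfl
  -- The position component of the derivative is `τ • ξ₀` plus an element of `l.ker`, so `l` gives
  -- `τ = 0`. Then the velocity component is `ρ • ξ₀` plus an element of `l.ker`, so `ρ = 0`, and
  -- both kernel elements vanish.
  refine (injective_iff_map_eq_zero D).2 ?_
  rintro ⟨τ, ρ, z⟩ h
  have h3 : D (τ, ρ, z) = τ • D (1, 0, 0) + D (0, ρ, z) := by
    rw [← map_smul, ← map_add]
    simp
  rw [h3, h1, h2, Prod.ext_iff] at h
  have hk1 : l ((κ z).1 : E) = 0 := (κ z).1.2
  have hk2 : l ((κ z).2 : E) = 0 := (κ z).2.2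
  have h4 : τ • ξ₀ + ((κ z).1 : E) = 0 := h.1
  have hτ : τ = 0 := by
    have := congrArg l h4
    rwa [map_add, map_smul, hl, hk1, smul_eq_mul, mul_one, add_zero, map_zero] at this
  have h5 : τ • (sprayField cov v₀.1 (y₀, ξ₀)).2 + (ρ • ξ₀ + ((κ z).2 : E)) = 0 := h.2
  rw [hτ, zero_smul, zero_add] at h4 h5
  have hρ : ρ = 0 := by
    have := congrArg l h5
    rwa [map_add, map_smul, hl, hk2, smul_eq_mul, mul_one, add_zero, map_zero] at this
  rw [hρ, zero_smul, zero_add] at h5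
  have h6 : κ z = 0 := Prod.ext (Subtype.ext h4) (Subtype.ext h5)
  have h7 : z = 0 := by simpa using h6
  rw [hτ, hρ, h7]
  rfl

end Geodesics

end Geod

/-! ### Local slices for the projection -/

namespace Geod

/-- A local slice for a projection `q : X → Y`: a submersion `s` of an open set `W` onto an open
set `S` of a vector space, whose fibres are those of `q`, with a section `σ`. -/
structure LocalSlice {EX HX X Y : Type*} [NormedAddCommGroup EX] [NormedSpace ℝ EX]
    [TopologicalSpace HX] (IX : ModelWithCorners ℝ EX HX) [TopologicalSpace X] [ChartedSpace HX X]
    (F : Type*) [NormedAddCommGroup F] [NormedSpace ℝ F] (q : X → Y) where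
  W : Set X
  S : Set F
  s : X → F
  σ : F → X
  isOpen_W : IsOpen W
  isOpen_S : IsOpen S
  mapsTo_s : MapsTo s W S
  mapsTo_σ : MapsTo σ S W
  s_σ : ∀ z ∈ S, s (σ z) = z
  contMDiffAt_s : ∀ x ∈ W, ContMDiffAt IX 𝓘(ℝ, F) ∞ s x
  contMDiffAt_σ : ∀ z ∈ S, ContMDiffAt 𝓘(ℝ, F) IX ∞ σ z
  q_σ_s : ∀ x ∈ W, q (σ (s x)) = q x
  eq_of_q_eq : ∀ z ∈ S, ∀ z' ∈ S, q (σ z) = q (σ z') → z = z'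

theorem finrank_ker_add_one {E : Type*} [NormedAddCommGroup E] [NormedSpace ℝ E]
    [FiniteDimensional ℝ E] {l : E →L[ℝ] ℝ} {ξ : E} (hl : l ξ = 1) :
    Module.finrank ℝ l.ker + 1 = Module.finrank ℝ E := by
  have h1 := (l : E →ₗ[ℝ] ℝ).finrank_range_add_finrank_ker
  have h2 : LinearMap.range (l : E →ₗ[ℝ] ℝ) = ⊤ := by
    refine LinearMap.range_eq_top.2 fun c => ⟨c • ξ, ?_⟩
    change l (c • ξ) = c
    rw [map_smul, hl, smul_eq_mul, mul_one]
  rw [h2, finrank_top, Module.finrank_self] at h1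
  rw [← h1, add_comm]

section Geodesics

variable {E : Type*} [NormedAddCommGroup E] [NormedSpace ℝ E] [FiniteDimensional ℝ E]
  {H : Type*} [TopologicalSpace H] {I : ModelWithCorners ℝ E H}
  {M : Type*} [TopologicalSpace M] [ChartedSpace H M] [IsManifold I ∞ M]
  {cov : CovariantDerivative I E (TangentSpace I : M → Type _)}
  [I.Boundaryless] [T2Space M]
  {F : Type*} [NormedAddCommGroup F] [NormedSpace ℝ F] [FiniteDimensional ℝ F] {l : E →L[ℝ] ℝ}

theorem exists_equiv_fderiv_leafMap (hcov : SmoothSymbols cov) (v₀ : TangentBundle I M)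
    (κ : F ≃L[ℝ] (l.ker × l.ker)) (hl : l (tcoord I v₀.1 v₀).2 = 1) :
    ∃ D : (ℝ × ℝ × F) ≃L[ℝ] (E × E), (D : (ℝ × ℝ × F) →L[ℝ] (E × E)) =
      fderiv ℝ (leafMap cov v₀ κ) (0, 1, 0) := by
  have h1 := injective_fderiv_leafMap hcov v₀ κ hl
  have h2 : Module.finrank ℝ (ℝ × ℝ × F) = Module.finrank ℝ (E × E) := by
    have h3 := finrank_ker_add_one hl
    have h5 := κ.toLinearEquiv.finrank_eq
    rw [Module.finrank_prod] at h5
    rw [Module.finrank_prod, Module.finrank_prod, Module.finrank_prod, Module.finrank_self, h5]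
    omega
  exact ⟨(LinearEquiv.ofInjectiveOfFinrankEq _ h1 h2).toContinuousLinearEquiv,
    ContinuousLinearMap.ext fun x => rfl⟩

theorem exists_localSlice_of_transversal (hN : Nonreturning cov) (hcov : SmoothSymbols cov)
    (v₀ : ReducedTangentBundle I M) (κ : F ≃L[ℝ] (l.ker × l.ker))
    (hl : l (tcoord I v₀.1.1 (v₀ : TangentBundle I M)).2 = 1) :
    ∃ L : LocalSlice I.tangent F (geodesicProj cov), v₀ ∈ L.W := by
  have hcompl : CompleteSpace F := FiniteDimensional.complete ℝ F
  set u := (v₀ : TangentBundle I M) with hu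
  obtain ⟨O, hO, hinj⟩ := hN.exists_transversal hcov u l (by rw [hl]; exact one_pos)
  obtain ⟨D, hD⟩ := exists_equiv_fderiv_leafMap hcov u κ hl
  have hev := eventually_leafMap hcov u κ
  obtain ⟨hz0, ht0, hs0⟩ := hev.self_of_nhds
  have hcd := contDiffAt_leafMap hcov hz0 ht0 hs0
  have hfd : HasFDerivAt (leafMap cov u κ) (D : (ℝ × ℝ × F) →L[ℝ] (E × E)) (0, 1, 0) := by
    rw [hD]
    exact (hcd.differentiableAt (by simp)).hasFDerivAt
  -- In the coordinates `(t, r, z)` the first two run within the class of a vector, along the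
  -- geodesic and along multiples, while `z` labels the geodesic. The slice map will be the
  -- coordinate `z`.
  set Θ := hcd.toOpenPartialHomeomorph (leafMap cov u κ) hfd (by simp) with hΘ
  have hΘc : ∀ p, Θ p = leafMap cov u κ p := fun p => rfl
  have h1 : ∀ᶠ p : ℝ × ℝ × F in 𝓝 (0, 1, 0), p ∈ Θ.source :=
    Θ.open_source.mem_nhds (hcd.mem_toOpenPartialHomeomorph_source hfd (by simp))
  have h2 : ∀ᶠ p : ℝ × ℝ × F in 𝓝 (0, 1, 0), fderiv ℝ (leafMap cov u κ) p ∈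
      range ((↑) : ((ℝ × ℝ × F) ≃L[ℝ] (E × E)) → (ℝ × ℝ × F) →L[ℝ] (E × E)) :=
    (hcd.fderiv_right (m := 0) (by simp)).continuousAt.eventually
      (ContinuousLinearEquiv.isOpen.mem_nhds ⟨D, hD⟩)
  have h3 : ∀ᶠ p : ℝ × ℝ × F in 𝓝 (0, 1, 0), p.2.1 ≠ 0 :=
    (show ContinuousAt (fun p : ℝ × ℝ × F => p.2.1) (0, 1, 0) by fun_prop).eventually
      (isOpen_ne.mem_nhds one_ne_zero)
  have h4 : ∀ᶠ p : ℝ × ℝ × F in 𝓝 (0, 1, 0), transversal u κ p.2.2 ∈ O := by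
    have h5 : ContinuousAt (transversal u κ) 0 :=
      (contMDiffAt_transversal hz0).continuousAt
    have h6 : ContinuousAt (fun p : ℝ × ℝ × F => transversal u κ p.2.2) (0, 1, 0) :=
      ContinuousAt.comp (g := transversal u κ) (f := fun p : ℝ × ℝ × F => p.2.2) h5 (by fun_prop)
    refine h6.eventually ?_
    dsimp only
    rwa [transversal_zero]
  have hall := (hev.and h1).and (h2.and (h3.and h4))
  -- A box around `(0, 1, 0)` on which all the open conditions hold; a product form is needed so
  -- that each of its points has the foot `(0, 1, z)` in the box as well.
  obtain ⟨A₁, B, hA₁, hA₁0, hB, hB0, hAB⟩ := mem_nhds_prod_iff'.1 hall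
  obtain ⟨A₂, S, hA₂, hA₂0, hS, hS0, hAS⟩ := mem_nhds_prod_iff'.1 (hB.mem_nhds hB0)
  have hmem : ∀ {t r : ℝ} {z : F}, t ∈ A₁ → r ∈ A₂ → z ∈ S → (t, r, z) ∈ A₁ ×ˢ A₂ ×ˢ S :=
    fun ht hr hz => ⟨ht, hr, hz⟩
  have hA : ∀ p ∈ A₁ ×ˢ A₂ ×ˢ S, _ := fun p hp => hAB (mk_mem_prod hp.1 (hAS hp.2))
  have hsrc : A₁ ×ˢ A₂ ×ˢ S ⊆ Θ.source := fun p hp => (hA p hp).1.2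
  have hAo : IsOpen (A₁ ×ˢ A₂ ×ˢ S) := hA₁.prod (hA₂.prod hS)
  have hσ : ∀ z ∈ S, (tcoord I u.1 (transversal u κ z) = transversalCoord u κ z) ∧
      (transversal u κ z).1 ∈ (chartAt H u.1).source ∧ (transversal u κ z).2 ≠ 0 := by
    intro z hz
    have h := (hA _ (hmem hA₁0 hA₂0 hz)).1.1.1
    have h5 : tcoord I u.1 (transversal u κ z) = transversalCoord u κ z := tcoord_tpoint h
    refine ⟨h5, extChartAt_symm_mem h, fun h0 => ?_⟩
    have h6 : (tcoord I u.1 (transversal u κ z)).2 = 0 := by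
      change coordL I u.1 _ (transversal u κ z).2 = 0
      rw [h0, map_zero]
    have h7 : l (transversalCoord u κ z).2 = 1 := by
      have hk : l ((κ z).2 : E) = 0 := (κ z).2.2
      simp only [transversalCoord, map_add, hl, hk, add_zero]
    rw [← h5, h6, map_zero] at h7
    exact zero_ne_one h7
  classical
  let σ : F → ReducedTangentBundle I M := fun z =>
    if h : (transversal u κ z).2 ≠ 0 then ⟨transversal u κ z, h⟩ else v₀
  have hσv : ∀ z ∈ S, (σ z : TangentBundle I M) = transversal u κ z := fun z hz => by
    simp only [σ, dif_pos (hσ z hz).2.2]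
  have hσΘ : ∀ z ∈ S, tcoord I u.1 (σ z : TangentBundle I M) = Θ (0, 1, z) := fun z hz => by
    rw [hσv z hz, (hσ z hz).1, hΘc, leafMap_zero hcov 1 (hA _ (hmem hA₁0 hA₂0 hz)).1.1.1, one_smul]
    rfl
  let W : Set (ReducedTangentBundle I M) := {v | (v : TangentBundle I M).1 ∈ (chartAt H u.1).source ∧
    tcoord I u.1 (v : TangentBundle I M) ∈ Θ '' (A₁ ×ˢ A₂ ×ˢ S)}
  let s : ReducedTangentBundle I M → F := fun v => (Θ.symm (tcoord I u.1 (v : TangentBundle I M))).2.2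
  have hWs : ∀ v ∈ W, Θ.symm (tcoord I u.1 (v : TangentBundle I M)) ∈ A₁ ×ˢ A₂ ×ˢ S ∧
      Θ (Θ.symm (tcoord I u.1 (v : TangentBundle I M))) = tcoord I u.1 (v : TangentBundle I M) := by
    rintro v ⟨-, p, hp, hpv⟩
    rw [← hpv, Θ.left_inv (hsrc hp)]
    exact ⟨hp, rfl⟩
  have hσW : MapsTo σ S W := fun z hz =>
    ⟨by rw [hσv z hz]; exact (hσ z hz).2.1, _, hmem hA₁0 hA₂0 hz, (hσΘ z hz).symm⟩
  have hsσ : ∀ z ∈ S, s (σ z) = z := fun z hz => by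
    simp only [s, hσΘ z hz, Θ.left_inv (hsrc (hmem hA₁0 hA₂0 hz))]
  refine ⟨⟨W, S, s, σ, ?_, hS, fun v hv => (hWs v hv).1.2.2, hσW, hsσ, ?_, ?_, ?_, ?_⟩, ?_⟩
  · have hc : ContinuousOn (tcoord I u.1) {v : TangentBundle I M | v.1 ∈ (chartAt H u.1).source} :=
      fun v hv => (continuousAt_tcoord hv).continuousWithinAt
    exact (hc.isOpen_inter_preimage (isOpen_tangent_source u.1)
      (Θ.isOpen_image_of_subset_source hAo hsrc)).preimage continuous_subtype_val
  · intro v hv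
    obtain ⟨hp, hpv⟩ := hWs v hv
    obtain ⟨D', hD'⟩ := (hA _ hp).2.1
    have hcd' := contDiffAt_leafMap hcov (hA _ hp).1.1.1 (hA _ hp).1.1.2.1 (hA _ hp).1.1.2.2
    have h5 : ContDiffAt ℝ ∞ Θ.symm (tcoord I u.1 (v : TangentBundle I M)) := by
      refine Θ.contDiffAt_symm (f₀' := D') ?_ ?_ hcd'
      · rw [← hpv]
        exact Θ.map_source (hsrc hp)
      · rw [hD']
        exact (hcd'.differentiableAt (by simp)).hasFDerivAt
    have h6 : ContMDiffAt I.tangent 𝓘(ℝ, E × E) ∞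
        (fun v : ReducedTangentBundle I M => tcoord I u.1 (v : TangentBundle I M)) v :=
      ContMDiffAt.comp v (contMDiffAt_tcoord hv.1) (contMDiff_subtype_val v)
    exact ContMDiffAt.comp (I' := 𝓘(ℝ, E × E))
      (f := fun v : ReducedTangentBundle I M => tcoord I u.1 (v : TangentBundle I M))
      (g := fun p => (Θ.symm p).2.2) v h5.snd.snd.contMDiffAt h6
  · intro z hz
    refine contMDiffAt_of_subtype_val (ContMDiffAt.congr_of_eventuallyEq (contMDiffAt_transversal
      (hA _ (hmem hA₁0 hA₂0 hz)).1.1.1) ?_)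
    filter_upwards [hS.mem_nhds hz] with z' hz' using hσv z' hz'
  · intro v hv
    obtain ⟨hp, hpv⟩ := hWs v hv
    have h5 := (hA _ hp).1.1
    have h6 := (hA _ hp).2.2.1
    rw [geodesicProj_eq_iff hcov, hσv _ hp.2.2]
    exact ⟨_, h5.2.1, _, h6, tcoord_injOn hv.1 h5.2.2 hpv.symm⟩
  · intro z hz z' hz' h
    rw [geodesicProj_eq_iff hcov, hσv z hz, hσv z' hz'] at h
    have hO : ∀ z ∈ S, transversal u κ z ∈ O := fun z hz => (hA _ (hmem hA₁0 hA₂0 hz)).2.2.2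
    -- Transversal points have base points at the same level of `l`, as
    -- `Nonreturning.exists_transversal` requires for relatedness to reduce to proportionality.
    have hlc : ∀ z ∈ S, l (tcoord I u.1 (transversal u κ z)).1 = l (tcoord I u.1 u).1 := by
      intro z hz
      have hk : l ((κ z).1 : E) = 0 := (κ z).1.2
      rw [(hσ z hz).1]
      simp only [transversalCoord, map_add, hk, add_zero]
    obtain ⟨c, hc, h5⟩ := hinj _ (hO z hz) _ (hO z' hz') h ((hlc z hz).trans (hlc z' hz').symm)
    have h6 := congrArg (tcoord I u.1) h5
    rw [tcoord_smulT, (hσ z hz).1, (hσ z' hz').1, Prod.ext_iff] at h6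
    obtain ⟨h7, h8⟩ := h6
    simp only [transversalCoord] at h7 h8
    -- Both velocities have `l`-value 1, so proportional vectors of the transversal coincide.
    have hc1 : c = 1 := by
      have h9 := congrArg l h8
      have hk : l ((κ z).2 : E) = 0 := (κ z).2.2
      have hk' : l ((κ z').2 : E) = 0 := (κ z').2.2
      rw [map_smul, map_add, map_add, hl, hk, hk', add_zero, smul_eq_mul, mul_one] at h9
      exact h9.symm
    rw [hc1, one_smul] at h8
    exact (κ.injective (Prod.ext (Subtype.ext (add_left_cancel h7))
      (Subtype.ext (add_left_cancel h8)))).symm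
  · refine ⟨mem_chart_source H u.1, _, hmem hA₁0 hA₂0 hS0, ?_⟩
    rw [← hσΘ 0 hS0, hσv 0 hS0, transversal_zero]

/-- Local slices for the projection to the space of geodesics. -/
theorem exists_localSlice (hN : Nonreturning cov) (hcov : SmoothSymbols cov)
    (hF : Module.finrank ℝ F = 2 * Module.finrank ℝ E - 2) (v₀ : ReducedTangentBundle I M) :
    ∃ L : LocalSlice I.tangent F (geodesicProj cov), v₀ ∈ L.W := by
  obtain ⟨l, hl⟩ := SeparatingDual.exists_eq_one (R := ℝ)
    (tcoord_snd_ne_zero (mem_chart_source H v₀.1.1) v₀.2)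
  have h1 := finrank_ker_add_one hl
  refine exists_localSlice_of_transversal hN hcov v₀ (l := l) (ContinuousLinearEquiv.ofFinrankEq ?_)
    hl
  rw [hF, Module.finrank_prod]
  omega

end Geodesics

end Geod

/-! ### The quotient manifold defined by local slices -/

namespace Geod

section Quotient

variable {EX HX X Y F : Type*} [NormedAddCommGroup EX] [NormedSpace ℝ EX]
  [TopologicalSpace HX] {IX : ModelWithCorners ℝ EX HX} [TopologicalSpace X] [ChartedSpace HX X]
  [NormedAddCommGroup F] [NormedSpace ℝ F] [TopologicalSpace Y] {q : X → Y}

namespace LocalSlice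

open Classical in
/-- The chart of the quotient defined by a local slice. -/
def toFun (L : LocalSlice IX F q) (y : Y) : F :=
  if h : ∃ x ∈ L.W, q x = y then L.s h.choose else 0

/-- The chosen representative does not matter: points of `W` with the same image have the same slice
coordinate, by `q_σ_s` and `eq_of_q_eq`. -/
theorem toFun_q (L : LocalSlice IX F q) {x : X} (hx : x ∈ L.W) : L.toFun (q x) = L.s x := by
  have h : ∃ x' ∈ L.W, q x' = q x := ⟨x, hx, rfl⟩
  unfold toFun
  rw [dif_pos h]
  refine L.eq_of_q_eq _ (L.mapsTo_s h.choose_spec.1) _ (L.mapsTo_s hx) ?_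
  rw [L.q_σ_s _ h.choose_spec.1, L.q_σ_s _ hx, h.choose_spec.2]

/-- The chart of the quotient defined by a local slice. -/
def chart (L : LocalSlice IX F q) (hq : IsOpenQuotientMap q) : OpenPartialHomeomorph Y F where
  toFun := L.toFun
  invFun z := q (L.σ z)
  source := q '' L.W
  target := L.S
  map_source' := by
    rintro _ ⟨x, hx, rfl⟩
    rw [L.toFun_q hx]
    exact L.mapsTo_s hx
  map_target' z hz := ⟨_, L.mapsTo_σ hz, rfl⟩
  left_inv' := by
    rintro _ ⟨x, hx, rfl⟩
    rw [L.toFun_q hx, L.q_σ_s x hx]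
  right_inv' z hz := by rw [L.toFun_q (L.mapsTo_σ hz), L.s_σ z hz]
  open_source := hq.isOpenMap _ L.isOpen_W
  open_target := L.isOpen_S
  continuousOn_toFun := by
    rintro _ ⟨x, hx, rfl⟩
    refine ContinuousAt.continuousWithinAt ?_
    unfold ContinuousAt
    rw [← hq.map_nhds_eq x, Filter.tendsto_map'_iff, L.toFun_q hx]
    refine Filter.Tendsto.congr' ?_ (L.contMDiffAt_s x hx).continuousAt
    filter_upwards [L.isOpen_W.mem_nhds hx] with x' hx' using (L.toFun_q hx').symm
  continuousOn_invFun z hz := (ContinuousAt.comp (f := L.σ) (g := q) hq.continuous.continuousAt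
    (L.contMDiffAt_σ z hz).continuousAt).continuousWithinAt

/-- Charts of the quotient are smooth as functions on the total space, if points of the same fibre
are exchanged by smooth local maps. -/
theorem contMDiffAt_toFun_comp
    (hmap : ∀ x x' : X, q x = q x' → ∃ φ : X → X, ContMDiffAt IX IX ∞ φ x ∧ φ x = x' ∧
      ∀ᶠ u in 𝓝 x, q (φ u) = q u) (L : LocalSlice IX F q) {x : X} (hx : q x ∈ q '' L.W) :
    ContMDiffAt IX 𝓘(ℝ, F) ∞ (fun x => L.toFun (q x)) x := by
  obtain ⟨x', hx', h⟩ := hx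
  obtain ⟨φ, h1, h2, h3⟩ := hmap x x' h.symm
  have hW : L.W ∈ 𝓝 (φ x) := h2 ▸ L.isOpen_W.mem_nhds hx'
  refine ContMDiffAt.congr_of_eventuallyEq (f := fun u => L.s (φ u))
    (ContMDiffAt.comp x (L.contMDiffAt_s _ (h2 ▸ hx')) h1) ?_
  filter_upwards [h3, h1.continuousAt.eventually hW] with u h4 h5
  rw [← h4, L.toFun_q h5]

/-- The atlas on the quotient defined by local slices. -/
@[reducible] def chartedSpace (hq : IsOpenQuotientMap q)
    (hslice : ∀ x : X, ∃ L : LocalSlice IX F q, x ∈ L.W) : ChartedSpace F Y where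
  atlas := range fun L : LocalSlice IX F q => L.chart hq
  chartAt y := (hslice (Function.surjInv hq.surjective y)).choose.chart hq
  mem_chart_source y := ⟨_, (hslice (Function.surjInv hq.surjective y)).choose_spec,
    Function.surjInv_eq hq.surjective y⟩
  chart_mem_atlas _ := ⟨_, rfl⟩

end LocalSlice

/-- A quotient map with local slices defines a manifold, and is a submersion onto it. -/
theorem exists_quotient_manifold (hq : IsOpenQuotientMap q)
    (hslice : ∀ x : X, ∃ L : LocalSlice IX F q, x ∈ L.W)
    (hmap : ∀ x x' : X, q x = q x' → ∃ φ : X → X, ContMDiffAt IX IX ∞ φ x ∧ φ x = x' ∧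
      ∀ᶠ u in 𝓝 x, q (φ u) = q u) :
    ∃ _ : ChartedSpace F Y, IsManifold 𝓘(ℝ, F) ∞ Y ∧ ContMDiff IX 𝓘(ℝ, F) ∞ q ∧
      ∀ x, Function.Surjective (mfderiv IX 𝓘(ℝ, F) q x) := by
  let cs := LocalSlice.chartedSpace hq hslice
  have hman : IsManifold 𝓘(ℝ, F) ∞ Y := by
    refine isManifold_of_contDiffOn _ _ _ ?_
    rintro _ _ ⟨L, rfl⟩ ⟨L', rfl⟩ z ⟨⟨hz, hz'⟩, -⟩
    -- The change of charts is the second chart after `q`, composed with the section of the first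
    -- slice.
    have h1 := LocalSlice.contMDiffAt_toFun_comp hmap L' hz'
    exact (contMDiffAt_iff_contDiffAt.1
      (ContMDiffAt.comp z h1 (L.contMDiffAt_σ z hz))).contDiffWithinAt
  have hchart : ∀ y : Y, ∃ L : LocalSlice IX F q, y ∈ q '' L.W ∧ chartAt F y = L.chart hq :=
    fun y => ⟨(hslice (Function.surjInv hq.surjective y)).choose,
      ⟨_, (hslice (Function.surjInv hq.surjective y)).choose_spec,
      Function.surjInv_eq hq.surjective y⟩, rfl⟩
  have hsmooth : ContMDiff IX 𝓘(ℝ, F) ∞ q := by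
    intro x
    refine contMDiffAt_iff_target.2 ⟨hq.continuous.continuousAt, ?_⟩
    obtain ⟨L, hL, hc⟩ := hchart (q x)
    have h1 := LocalSlice.contMDiffAt_toFun_comp hmap L hL
    refine h1.congr_of_eventuallyEq (Filter.Eventually.of_forall fun u => ?_)
    change chartAt F (q x) (q u) = _
    rw [hc]
    rfl
  refine ⟨cs, hman, hsmooth, fun x => ?_⟩
  obtain ⟨L, ⟨x', hx', hxx'⟩, hc⟩ := hchart (q x)
  set z := L.s x'
  have hz : z ∈ L.S := L.mapsTo_s hx'
  -- The slice gives a local section through some point of the fibre of `x`; moved by `φ`, it passes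
  -- through `x`. In the chart of the quotient, `q` after this section is the identity, and the
  -- chain rule makes the derivative of `q` at `x` surjective.
  obtain ⟨φ, h1, h2, h3⟩ := hmap (L.σ z) x ((L.q_σ_s x' hx').trans hxx')
  have hτ : ContMDiffAt 𝓘(ℝ, F) IX ∞ (fun z => φ (L.σ z)) z :=
    ContMDiffAt.comp z h1 (L.contMDiffAt_σ z hz)
  have hinv := isInvertible_mfderiv_extChartAt (I := 𝓘(ℝ, F)) (mem_extChartAt_source (I := 𝓘(ℝ, F)) (q x))
  have hA := (mdifferentiableAt_extChartAt (I := 𝓘(ℝ, F)) (mem_chart_source F (q x))).hasMFDerivAt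
  have hB := ((hsmooth x).mdifferentiableAt (by simp)).hasMFDerivAt
  have hC := (hτ.mdifferentiableAt (by simp)).hasMFDerivAt
  subst h2
  have hABC := HasMFDerivAt.comp z hA (HasMFDerivAt.comp z hB hC)
  have hid : HasMFDerivAt 𝓘(ℝ, F) 𝓘(ℝ, F)
      (extChartAt 𝓘(ℝ, F) (q (φ (L.σ z))) ∘ q ∘ fun z => φ (L.σ z)) z
      (ContinuousLinearMap.id ℝ F) := by
    refine (hasMFDerivAt_id z).congr_of_eventuallyEq ?_
    filter_upwards [(L.contMDiffAt_σ z hz).continuousAt.eventually h3, L.isOpen_S.mem_nhds hz]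
      with z' h4 h5
    change chartAt F (q (φ (L.σ z))) (q (φ (L.σ z'))) = z'
    rw [hc, h4]
    exact (L.toFun_q (L.mapsTo_σ h5)).trans (L.s_σ z' h5)
  have heq := hasMFDerivAt_unique hABC hid
  intro w
  refine ⟨mfderiv 𝓘(ℝ, F) IX (fun z => φ (L.σ z)) z
    (mfderiv 𝓘(ℝ, F) 𝓘(ℝ, F) (extChartAt 𝓘(ℝ, F) (q (φ (L.σ z)))) (q (φ (L.σ z))) w), ?_⟩
  exact hinv.injective (congrArg (fun f : F →L[ℝ] F => f (mfderiv 𝓘(ℝ, F) 𝓘(ℝ, F)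
    (extChartAt 𝓘(ℝ, F) (q (φ (L.σ z)))) (q (φ (L.σ z))) w)) heq)

end Quotient

end Geod

/-- A connected paracompact locally compact Hausdorff space is σ-compact. -/
theorem sigmaCompactSpace_of_paracompactSpace_of_connectedSpace (X : Type*) [TopologicalSpace X]
    [T2Space X] [LocallyCompactSpace X] [ParacompactSpace X] [ConnectedSpace X] :
    SigmaCompactSpace X := by
  choose K hK hKn using fun x : X => exists_compact_mem_nhds x
  obtain ⟨v, hvo, hvc, hvf, hvK⟩ := precise_refinement (fun x => interior (K x))
    (fun x => isOpen_interior)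
    (iUnion_eq_univ_iff.2 fun x => ⟨x, mem_interior_iff_mem_nhds.2 (hKn x)⟩)
  have hcomp : ∀ i, IsCompact (closure (v i)) := fun i =>
    (hK i).of_isClosed_subset isClosed_closure
      (closure_minimal ((hvK i).trans interior_subset) (hK i).isClosed)
  obtain ⟨x₀⟩ : Nonempty X := inferInstance
  -- Each step adds the closures of the members of the cover that meet the previous compact set; by
  -- local finiteness these are finitely many. A member that meets the union lies in it, so the
  -- union is clopen.
  let L : ℕ → Set X := fun n => Nat.rec {x₀}
    (fun _ A => ⋃ i ∈ {i | (v i ∩ A).Nonempty}, closure (v i)) n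
  have hLs : ∀ n, L (n + 1) = ⋃ i ∈ {i | (v i ∩ L n).Nonempty}, closure (v i) := fun n => rfl
  have hL : ∀ n, IsCompact (L n) := by
    intro n
    induction n with
    | zero => exact isCompact_singleton
    | succ n ih =>
      rw [hLs]
      exact (hvf.finite_nonempty_inter_compact ih).isCompact_biUnion fun i _ => hcomp i
  have hstep : ∀ n i, (v i ∩ L n).Nonempty → v i ⊆ L (n + 1) := fun n i h => by
    rw [hLs]
    exact subset_closure.trans (subset_biUnion_of_mem (u := fun i => closure (v i)) h)
  have hclopen : IsClopen (⋃ n, L n) := by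
    constructor
    · rw [← isOpen_compl_iff, isOpen_iff_mem_nhds]
      intro y hy
      obtain ⟨i, hi⟩ := iUnion_eq_univ_iff.1 hvc y
      filter_upwards [(hvo i).mem_nhds hi] with z hz hzA
      obtain ⟨n, hn⟩ := mem_iUnion.1 hzA
      exact hy (mem_iUnion.2 ⟨n + 1, hstep n i ⟨z, hz, hn⟩ hi⟩)
    · rw [isOpen_iff_mem_nhds]
      intro y hy
      obtain ⟨n, hn⟩ := mem_iUnion.1 hy
      obtain ⟨i, hi⟩ := iUnion_eq_univ_iff.1 hvc y
      filter_upwards [(hvo i).mem_nhds hi] with z hz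
      exact mem_iUnion.2 ⟨n + 1, hstep n i ⟨y, hi, hn⟩ hz⟩
  have huniv : (⋃ n, L n) = univ := (isClopen_iff.1 hclopen).resolve_left
    (Nonempty.ne_empty ⟨x₀, mem_iUnion.2 ⟨0, rfl⟩⟩)
  exact SigmaCompactSpace.of_countable (range L) (countable_range L)
    (by rintro _ ⟨n, rfl⟩; exact hL n) (by rwa [sUnion_range])

/-! ### Countability and connectedness of the space of geodesics -/

namespace Geod

section Geodesics

variable {E : Type*} [NormedAddCommGroup E] [NormedSpace ℝ E] [FiniteDimensional ℝ E]
  {H : Type*} [TopologicalSpace H] {I : ModelWithCorners ℝ E H}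
  {M : Type*} [TopologicalSpace M] [ChartedSpace H M] [IsManifold I ∞ M]
  {cov : CovariantDerivative I E (TangentSpace I : M → Type _)}

variable (I M) in
theorem secondCountableTopology_tangentBundle [SecondCountableTopology H] [SigmaCompactSpace M] :
    SecondCountableTopology (TangentBundle I M) := by
  have hE : ProperSpace E := FiniteDimensional.proper ℝ E
  have hH : SecondCountableTopology (ModelProd H E) :=
    inferInstanceAs (SecondCountableTopology (H × E))
  obtain ⟨s, hs, hsc⟩ := countable_cover_nhds_of_sigmaCompact fun x : M =>
    (chartAt H x).open_source.mem_nhds (mem_chart_source H x)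
  refine ChartedSpace.secondCountable_of_countable_cover (ModelProd H E)
    (s := (fun x => (⟨x, 0⟩ : TangentBundle I M)) '' s) ?_ (hs.image _)
  refine eq_univ_of_forall fun v => ?_
  obtain ⟨x, hx, hv⟩ := mem_iUnion₂.1 (hsc ▸ mem_univ v.1)
  exact mem_iUnion₂.2 ⟨_, mem_image_of_mem _ hx, TangentBundle.mem_chart_source_iff _ _ |>.2 hv⟩

/-- The bundle projection of `T'M` is open. -/
theorem isOpen_image_base [I.Boundaryless] {O : Set (ReducedTangentBundle I M)} (hO : IsOpen O) :
    IsOpen ((fun v : ReducedTangentBundle I M => (v : TangentBundle I M).1) '' O) := by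
  rw [isOpen_iff_mem_nhds]
  rintro _ ⟨v, hv, rfl⟩
  set u := (v : TangentBundle I M) with hu
  have hs := mem_chart_source H u.1
  set ξ := (tcoord I u.1 u).2
  -- The local field with the components of `u` is a section of the projection through `u`, so the
  -- base points near that of `u` are all hit by `O`.
  have h1 : ContinuousAt (fun y : M => tpoint I u.1 (extChartAt I u.1 y, ξ)) u.1 := by
    refine ContinuousAt.comp (g := tpoint I u.1) (f := fun y : M => (extChartAt I u.1 y, ξ))
      (contMDiffAt_tpoint (mem_extChartAt_target (I := I) u.1)).continuousAt
      ((continuousAt_extChartAt u.1).prodMk continuousAt_const)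
  have h2 : tpoint I u.1 (extChartAt I u.1 u.1, ξ) = u := tpoint_tcoord hs
  have h3 : ((↑) '' O : Set (TangentBundle I M)) ∈
      𝓝 (tpoint I u.1 (extChartAt I u.1 u.1, ξ)) := by
    rw [h2]
    exact ((ReducedTangentBundle I M).isOpen.isOpenMap_subtype_val O hO).mem_nhds ⟨v, hv, rfl⟩
  filter_upwards [h1.eventually h3, (chartAt H u.1).open_source.mem_nhds hs] with y ⟨w, hw, hwy⟩ hy
  refine ⟨w, hw, ?_⟩
  dsimp only
  rw [hwy]
  exact (extChartAt I u.1).left_inv (by rwa [extChartAt_source])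

/-- A saturated clopen subset of `T'M` contains each fibre which it meets. -/
theorem mem_of_base_eq {A : Set (ReducedTangentBundle I M)} (hA : IsClopen A)
    (hs : ∀ v w : ReducedTangentBundle I M, ∀ c : ℝ, c ≠ 0 →
      (w : TangentBundle I M) = smulT c v → v ∈ A → w ∈ A)
    {v w : ReducedTangentBundle I M} (hvw : (v : TangentBundle I M).1 = (w : TangentBundle I M).1)
    (hv : v ∈ A) : w ∈ A := by
  obtain ⟨⟨x, ξ⟩, hξ⟩ := v
  obtain ⟨⟨y, η⟩, hη⟩ := w
  dsimp only at hvw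
  subst hvw
  -- Independent vectors are joined by a segment that misses zero. For dependent ones saturation is
  -- needed: in dimension one the nonzero vectors of a fibre are not connected.
  by_cases h : ∃ c : ℝ, η = c • ξ
  · obtain ⟨c, rfl⟩ := h
    refine hs _ _ c ?_ rfl hv
    rintro rfl
    exact hη (zero_smul ℝ ξ)
  · have hne : ∀ t : ℝ, (1 - t) • ξ + t • η ≠ 0 := by
      intro t ht
      by_cases h0 : t = 0
      · rw [h0, sub_zero, one_smul, zero_smul, add_zero] at ht
        exact hξ ht
      · refine h ⟨-(t⁻¹ * (1 - t)), ?_⟩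
        have h1 : t • η = -((1 - t) • ξ) := eq_neg_of_add_eq_zero_right ht
        rw [neg_smul, mul_smul, ← smul_neg, ← h1, inv_smul_smul₀ h0]
    let f : ℝ → ReducedTangentBundle I M := fun t =>
      ⟨(⟨x, (1 - t) • ξ + t • η⟩ : TangentBundle I M), hne t⟩
    have hf : Continuous f := by
      refine Continuous.subtype_mk ?_ _
      refine (FiberBundle.continuous_totalSpaceMk E (TangentSpace I : M → Type _) x).comp ?_
      exact ((continuous_const.sub continuous_id).smul continuous_const).add
        (continuous_id.smul continuous_const)
    have h0 : f 0 = ⟨⟨x, ξ⟩, hξ⟩ := by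
      simp only [f, sub_zero, one_smul, zero_smul, add_zero]
    have h1 : f 1 = ⟨⟨x, η⟩, hη⟩ := by
      simp only [f, sub_self, one_smul, zero_smul, zero_add]
    have h2 : f ⁻¹' A = univ := (isClopen_iff.1 (hA.preimage hf)).resolve_left
      (Nonempty.ne_empty ⟨0, by rw [mem_preimage, h0]; exact hv⟩)
    rw [← h1]
    exact (h2 ▸ mem_univ (1 : ℝ) : (1 : ℝ) ∈ f ⁻¹' A)

variable [I.Boundaryless] [T2Space M]

theorem connectedSpace_spaceOfGeodesics [Nontrivial E] [ConnectedSpace M] :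
    ConnectedSpace (SpaceOfGeodesics cov) := by
  obtain ⟨ξ, hξ⟩ := exists_ne (0 : E)
  have hfib : ∀ x : M, ∃ v : ReducedTangentBundle I M, (v : TangentBundle I M).1 = x := fun x =>
    ⟨⟨(⟨x, ξ⟩ : TangentBundle I M), hξ⟩, rfl⟩
  have hne : Nonempty (SpaceOfGeodesics cov) := by
    obtain ⟨x⟩ : Nonempty M := inferInstance
    exact ⟨geodesicProj cov (hfib x).choose⟩
  have hpre : PreconnectedSpace (SpaceOfGeodesics cov) := by
    rw [preconnectedSpace_iff_clopen]
    intro A hA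
    have hA' := hA.preimage (continuous_geodesicProj (cov := cov))
    have hs : ∀ v w : ReducedTangentBundle I M, ∀ c : ℝ, c ≠ 0 →
        (w : TangentBundle I M) = smulT c v → geodesicProj cov v = geodesicProj cov w :=
      fun v w c hc h => congrArg (Quot.mk _) (Quotient.sound ⟨c, hc, h⟩)
    have key : ∀ v w : ReducedTangentBundle I M,
        (v : TangentBundle I M).1 = (w : TangentBundle I M).1 →
        v ∈ geodesicProj cov ⁻¹' A → w ∈ geodesicProj cov ⁻¹' A := fun v w hvw hv =>
      mem_of_base_eq hA' (fun v w c hc h (hv : _ ∈ A) => show _ ∈ A by rwa [← hs v w c hc h]) hvw hv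
    by_contra! h
    obtain ⟨h1, h2⟩ := h
    obtain ⟨g, hg⟩ := h1
    obtain ⟨g', hg'⟩ := (ne_univ_iff_exists_notMem A).1 h2
    obtain ⟨v, rfl⟩ := surjective_geodesicProj g
    obtain ⟨v', rfl⟩ := surjective_geodesicProj g'
    -- The base points of the two complementary clopen sets form open sets covering M. By
    -- connectedness they meet, and then both sets meet one fibre.
    obtain ⟨x, -, ⟨w, hw, hwx⟩, w', hw', hwx'⟩ := isPreconnected_univ (α := M) _ _
      (isOpen_image_base hA'.isOpen) (isOpen_image_base hA'.compl.isOpen)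
      (fun x _ => by
        obtain ⟨w, rfl⟩ := hfib x
        by_cases hw : w ∈ geodesicProj cov ⁻¹' A
        · exact Or.inl ⟨w, hw, rfl⟩
        · exact Or.inr ⟨w, hw, rfl⟩)
      ⟨_, mem_univ _, v, hg, rfl⟩ ⟨_, mem_univ _, v', hg', rfl⟩
    exact hw' (key w w' (hwx.trans hwx'.symm) hw)
  exact ⟨hne⟩

/-- The space of geodesics of a nonreturning pseudoconvex manifold is a manifold. -/
theorem spaceOfGeodesics_manifold [ConnectedSpace M] [SigmaCompactSpace M]
    [SecondCountableTopology H] [Nontrivial E] (hcov : SmoothSymbols cov) (hN : Nonreturning cov)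
    (hP : Pseudoconvex cov) {F : Type*} [NormedAddCommGroup F] [NormedSpace ℝ F]
    [FiniteDimensional ℝ F] (hF : Module.finrank ℝ F = 2 * Module.finrank ℝ E - 2) :
    T2Space (SpaceOfGeodesics cov) ∧ ParacompactSpace (SpaceOfGeodesics cov) ∧
      ConnectedSpace (SpaceOfGeodesics cov) ∧ ∃ _ : ChartedSpace F (SpaceOfGeodesics cov),
        IsManifold 𝓘(ℝ, F) ∞ (SpaceOfGeodesics cov) ∧
        ContMDiff I.tangent 𝓘(ℝ, F) ∞ (geodesicProj cov) ∧
        ∀ v : ReducedTangentBundle I M,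
          Function.Surjective (mfderiv I.tangent 𝓘(ℝ, F) (geodesicProj cov) v) := by
  have hT2 := t2Space_spaceOfGeodesics hcov hN hP
  have hq := isOpenQuotientMap_geodesicProj hcov
  obtain ⟨cs, h1, h2, h3⟩ := exists_quotient_manifold (F := F) hq
    (fun v => exists_localSlice hN hcov hF v) fun v w h => exists_local_map hcov h
  -- Second countability descends from the tangent bundle through the open quotient map, and with
  -- local compactness and Hausdorffness it yields paracompactness.
  have hTM := secondCountableTopology_tangentBundle I M
  have hT'M : SecondCountableTopology (ReducedTangentBundle I M) :=
    TopologicalSpace.Subtype.secondCountableTopology _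
  have hsc : SecondCountableTopology (SpaceOfGeodesics cov) :=
    hq.isQuotientMap.secondCountableTopology hq.isOpenMap
  have hlc : LocallyCompactSpace (SpaceOfGeodesics cov) :=
    Manifold.locallyCompact_of_finiteDimensional 𝓘(ℝ, F)
  exact ⟨hT2, inferInstance, connectedSpace_spaceOfGeodesics, cs, h1, h2, h3⟩

end Geodesics

end Geod

/-! ### Smoothness of the symbols, also for the product connection -/

namespace Geod

section SmoothConnection

variable {E : Type*} [NormedAddCommGroup E] [NormedSpace ℝ E] [FiniteDimensional ℝ E]
  {H : Type*} [TopologicalSpace H] {I : ModelWithCorners ℝ E H}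
  {M : Type*} [TopologicalSpace M] [ChartedSpace H M] [IsManifold I ∞ M]

theorem contMDiffAt_constSec {x₀ y : M} (hy : y ∈ (chartAt H x₀).source) (ξ : E) :
    ContMDiffAt I I.tangent ∞ (fun z => (⟨z, constSec I x₀ ξ z⟩ : TangentBundle I M)) y := by
  refine contMDiffAt_tangent (x₀ := x₀)
    (f := fun z => (⟨z, constSec I x₀ ξ z⟩ : TangentBundle I M)) hy contMDiffAt_id ?_
  refine (contMDiffAt_const (c := ξ)).congr_of_eventuallyEq ?_
  filter_upwards [(chartAt H x₀).open_source.mem_nhds hy] with z hz using coordL_constSec hz ξ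

theorem hasMFDerivAt_prodMk_space {F G : Type*} [NormedAddCommGroup F] [NormedSpace ℝ F]
    [NormedAddCommGroup G] [NormedSpace ℝ G] {f : M → F} {g : M → G} {x : M} {f' : E →L[ℝ] F}
    {g' : E →L[ℝ] G} (hf : HasMFDerivAt I 𝓘(ℝ, F) f x f') (hg : HasMFDerivAt I 𝓘(ℝ, G) g x g') :
    HasMFDerivAt I 𝓘(ℝ, F × G) (fun y => (f y, g y)) x (f'.prod g') :=
  ⟨hf.1.prodMk hg.1, hf.2.prodMk hg.2⟩

theorem mvfderiv_eq_zero {F : Type*} [NormedAddCommGroup F] [NormedSpace ℝ F] {f : M → F} {c : F}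
    {x : M} (h : f =ᶠ[𝓝 x] fun _ => c) : mvfderiv I f x = 0 :=
  ((hasMFDerivAt_const (I := I) (I' := 𝓘(ℝ, F)) c x).congr_of_eventuallyEq h).mfderiv

variable [T2Space M]

/-- The Christoffel symbols of a smooth connection are smooth. -/
theorem smoothSymbols_of_contMDiff
    {cov : CovariantDerivative I E (TangentSpace I : M → Type _)}
    (hcov : CovariantDerivative.ContMDiffCovariantDerivative cov ∞) : SmoothSymbols cov := by
  intro x₀ ξ η y hy
  refine ContMDiffAt.contMDiffWithinAt ?_
  -- Smoothness of the connection is applied to global smooth fields, so the constant field is cut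
  -- off inside the chart domain. The connection is local, so the cutoff does not matter near `y`.
  obtain ⟨f, -, hf⟩ := (SmoothBumpFunction.nhds_basis_tsupport (I := I) y).mem_iff.1
    ((chartAt H x₀).open_source.mem_nhds hy)
  set σ : Π z : M, TangentSpace I z := (f : M → ℝ) • constSec I x₀ ξ with hσ
  have hσs : ContMDiff I I.tangent ∞ (fun z => (⟨z, σ z⟩ : TangentBundle I M)) := by
    intro z
    by_cases hz : z ∈ tsupport f
    · exact ContMDiffAt.smul_section f.contMDiffAt (contMDiffAt_constSec (hf hz) ξ)
    · refine (contMDiffAt_constSec (mem_chart_source H z) 0).congr_of_eventuallyEq ?_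
      filter_upwards [(isClosed_tsupport f).isOpen_compl.mem_nhds hz] with w hw
      have h1 : σ w = 0 := by
        rw [hσ, Pi.smul_apply', image_eq_zero_of_notMem_tsupport hw, zero_smul]
      have h2 : constSec I z 0 w = 0 := map_zero _
      rw [h1, h2]
  have h1 : ContMDiffAt I (I.prod 𝓘(ℝ, E →L[ℝ] E)) ∞ (fun z =>
      (⟨z, cov σ z⟩ : TotalSpace (E →L[ℝ] E) fun z : M => TangentSpace I z →L[ℝ] TangentSpace I z))
      y :=
    (hcov.contMDiff.contMDiff (σ := σ) hσs.contMDiffOn).contMDiffAt Filter.univ_mem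
  have h2 : ContMDiffAt I I.tangent ∞
      (fun z => (⟨z, cov σ z (constSec I x₀ η z)⟩ : TangentBundle I M)) y :=
    ContMDiffAt.clm_bundle_apply (F₁ := E) (F₂ := E) h1 (contMDiffAt_constSec hy η)
  have h3 : ContMDiffAt I 𝓘(ℝ, E) ∞
      (fun z => coordL I x₀ z (cov σ z (constSec I x₀ η z))) y :=
    ContMDiffAt.comp (I' := 𝓘(ℝ, E × E)) (g := fun p : E × E => p.2)
      (f := fun z => tcoord I x₀ ⟨z, cov σ z (constSec I x₀ η z)⟩) y
      contDiffAt_snd.contMDiffAt (ContMDiffAt.comp (g := tcoord I x₀) y (contMDiffAt_tcoord hy) h2)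
  refine h3.congr_of_eventuallyEq ?_
  filter_upwards [f.eventuallyEq_one.eventuallyEq_nhds, (chartAt H x₀).open_source.mem_nhds hy]
    with z hz hzs
  have h4 : cov (constSec I x₀ ξ) z = cov σ z := by
    refine cov.isCovariantDerivativeOnUniv.congr_of_eventuallyEq
      ((contMDiffAt_constSec hzs ξ).mdifferentiableAt (by simp))
      ((hσs z).mdifferentiableAt (by simp)) Filter.univ_mem ?_
    filter_upwards [hz] with w hw
    rw [hσ, Pi.smul_apply', hw, Pi.one_apply, one_smul]
  rw [h4]

end SmoothConnection

section Product

variable {E₁ : Type*} [NormedAddCommGroup E₁] [NormedSpace ℝ E₁] [FiniteDimensional ℝ E₁]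
  {H₁ : Type*} [TopologicalSpace H₁] {I₁ : ModelWithCorners ℝ E₁ H₁}
  {M₁ : Type*} [TopologicalSpace M₁] [ChartedSpace H₁ M₁] [IsManifold I₁ ∞ M₁]
  {E₂ : Type*} [NormedAddCommGroup E₂] [NormedSpace ℝ E₂] [FiniteDimensional ℝ E₂]
  {H₂ : Type*} [TopologicalSpace H₂] {I₂ : ModelWithCorners ℝ E₂ H₂}
  {M₂ : Type*} [TopologicalSpace M₂] [ChartedSpace H₂ M₂] [IsManifold I₂ ∞ M₂]

theorem coordL_prod {x₀ y : M₁ × M₂} (h₁ : y.1 ∈ (chartAt H₁ x₀.1).source)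
    (h₂ : y.2 ∈ (chartAt H₂ x₀.2).source) (v : TangentSpace (I₁.prod I₂) y) :
    coordL (I₁.prod I₂) x₀ y v =
      (coordL I₁ x₀.1 y.1 (tfst y v), coordL I₂ x₀.2 y.2 (tsnd y v)) := by
  have h : y ∈ (chartAt (ModelProd H₁ H₂) x₀).source := by
    rw [prodChartedSpace_chartAt]
    exact ⟨h₁, h₂⟩
  have a₁ := (mdifferentiableAt_extChartAt (I := I₁) h₁).hasMFDerivAt.comp y
    (hasMFDerivAt_fst (I := I₁) (I' := I₂) y)
  have a₂ := (mdifferentiableAt_extChartAt (I := I₂) h₂).hasMFDerivAt.comp y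
    (hasMFDerivAt_snd (I := I₁) (I' := I₂) y)
  have h3 := hasMFDerivAt_prodMk_space a₁ a₂
  have h4 : (extChartAt (I₁.prod I₂) x₀ : M₁ × M₂ → E₁ × E₂) =
      fun y => ((extChartAt I₁ x₀.1 ∘ Prod.fst) y, (extChartAt I₂ x₀.2 ∘ Prod.snd) y) := by
    rw [extChartAt_prod]
    rfl
  rw [← h4] at h3
  have h6 := (TangentBundle.continuousLinearMapAt_trivializationAt h).trans h3.mfderiv
  have h7 := TangentBundle.continuousLinearMapAt_trivializationAt (I := I₁) h₁
  have h8 := TangentBundle.continuousLinearMapAt_trivializationAt (I := I₂) h₂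
  refine (congrArg (fun f : E₁ × E₂ →L[ℝ] E₁ × E₂ => f v) h6).trans ?_
  exact Prod.ext (congrArg (fun f : E₁ →L[ℝ] E₁ => f (tfst y v)) h7).symm
    (congrArg (fun f : E₂ →L[ℝ] E₂ => f (tsnd y v)) h8).symm

theorem mem_chart_source_prod {x₀ y : M₁ × M₂} :
    y ∈ (chartAt (ModelProd H₁ H₂) x₀).source ↔
      y.1 ∈ (chartAt H₁ x₀.1).source ∧ y.2 ∈ (chartAt H₂ x₀.2).source := by
  rw [prodChartedSpace_chartAt]
  exact Iff.rfl

theorem constSec_prod {x₀ y : M₁ × M₂} (h₁ : y.1 ∈ (chartAt H₁ x₀.1).source)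
    (h₂ : y.2 ∈ (chartAt H₂ x₀.2).source) (ξ : E₁ × E₂) :
    tfst y (constSec (I₁.prod I₂) x₀ ξ y) = constSec I₁ x₀.1 ξ.1 y.1 ∧
      tsnd y (constSec (I₁.prod I₂) x₀ ξ y) = constSec I₂ x₀.2 ξ.2 y.2 := by
  have h := coordL_prod h₁ h₂ (constSec (I₁.prod I₂) x₀ ξ y)
  rw [coordL_constSec (mem_chart_source_prod.2 ⟨h₁, h₂⟩), Prod.ext_iff] at h
  constructor
  · refine coordL_injective h₁ ?_
    rw [coordL_constSec h₁]
    exact h.1.symm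
  · refine coordL_injective h₂ ?_
    rw [coordL_constSec h₂]
    exact h.2.symm

variable {cov₁ : CovariantDerivative I₁ E₁ (TangentSpace I₁ : M₁ → Type _)}
  {cov₂ : CovariantDerivative I₂ E₂ (TangentSpace I₂ : M₂ → Type _)}

/-- The product connection, on vector fields with constant components. -/
theorem prodConnection_constSec {x₀ y : M₁ × M₂} (h₁ : y.1 ∈ (chartAt H₁ x₀.1).source)
    (h₂ : y.2 ∈ (chartAt H₂ x₀.2).source) (ξ : E₁ × E₂) (u : TangentSpace (I₁.prod I₂) y) :
    prodConnection cov₁ cov₂ (constSec (I₁.prod I₂) x₀ ξ) y u =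
      tinl y (cov₁ (constSec I₁ x₀.1 ξ.1) y.1 (tfst y u)) +
        tinr y (cov₂ (constSec I₂ x₀.2 ξ.2) y.2 (tsnd y u)) := by
  have hs : MDiffAt (T% (constSec (I₁.prod I₂) x₀ ξ)) y :=
    (contMDiffAt_constSec (mem_chart_source_prod.2 ⟨h₁, h₂⟩) ξ).mdifferentiableAt (by simp)
  have e1 : cov₁ (fun x => tfst (x, y.2) (constSec (I₁.prod I₂) x₀ ξ (x, y.2))) y.1 =
      cov₁ (constSec I₁ x₀.1 ξ.1) y.1 := by
    refine cov₁.isCovariantDerivativeOnUniv.congr_of_eventuallyEq (mdiffAt_fst_slice hs)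
      ((contMDiffAt_constSec h₁ ξ.1).mdifferentiableAt (by simp)) Filter.univ_mem ?_
    filter_upwards [(chartAt H₁ x₀.1).open_source.mem_nhds h₁] with x hx
    exact (constSec_prod (y := (x, y.2)) hx h₂ ξ).1
  have e2 : cov₂ (fun x => tsnd (y.1, x) (constSec (I₁.prod I₂) x₀ ξ (y.1, x))) y.2 =
      cov₂ (constSec I₂ x₀.2 ξ.2) y.2 := by
    refine cov₂.isCovariantDerivativeOnUniv.congr_of_eventuallyEq (mdiffAt_snd_slice hs)
      ((contMDiffAt_constSec h₂ ξ.2).mdifferentiableAt (by simp)) Filter.univ_mem ?_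
    filter_upwards [(chartAt H₂ x₀.2).open_source.mem_nhds h₂] with x hx
    exact (constSec_prod (y := (y.1, x)) h₁ hx ξ).2
  -- In a product chart the first component of a constant field depends only on the first coordinate
  -- of the point, and likewise for the second; hence the mixed derivatives vanish.
  have d1 : dFiberFst (constSec (I₁.prod I₂) x₀ ξ) y = 0 := by
    have h : (fun x : M₂ => (tfst (y.1, x) (constSec (I₁.prod I₂) x₀ ξ (y.1, x)) : E₁)) =ᶠ[𝓝 y.2]
        fun _ => constSec I₁ x₀.1 ξ.1 y.1 := by
      filter_upwards [(chartAt H₂ x₀.2).open_source.mem_nhds h₂] with x hx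
      exact (constSec_prod (y := (y.1, x)) h₁ hx ξ).1
    exact mvfderiv_eq_zero h
  have d2 : dFiberSnd (constSec (I₁.prod I₂) x₀ ξ) y = 0 := by
    have h : (fun x : M₁ => (tsnd (x, y.2) (constSec (I₁.prod I₂) x₀ ξ (x, y.2)) : E₂)) =ᶠ[𝓝 y.1]
        fun _ => constSec I₂ x₀.2 ξ.2 y.2 := by
      filter_upwards [(chartAt H₁ x₀.1).open_source.mem_nhds h₁] with x hx
      exact (constSec_prod (y := (x, y.2)) hx h₂ ξ).2
    exact mvfderiv_eq_zero h
  change prodFun cov₁ cov₂ _ y u = _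
  unfold prodFun
  rw [e1, e2, d1, d2]
  simp only [add_apply, ContinuousLinearMap.comp_apply, ContinuousLinearMap.zero_comp, add_zero]

theorem coordL_prodConnection {x₀ y : M₁ × M₂} (h₁ : y.1 ∈ (chartAt H₁ x₀.1).source)
    (h₂ : y.2 ∈ (chartAt H₂ x₀.2).source) (ξ η : E₁ × E₂) :
    coordL (I₁.prod I₂) x₀ y (prodConnection cov₁ cov₂ (constSec (I₁.prod I₂) x₀ ξ) y
        (constSec (I₁.prod I₂) x₀ η y)) =
      (coordL I₁ x₀.1 y.1 (cov₁ (constSec I₁ x₀.1 ξ.1) y.1 (constSec I₁ x₀.1 η.1 y.1)),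
        coordL I₂ x₀.2 y.2 (cov₂ (constSec I₂ x₀.2 ξ.2) y.2 (constSec I₂ x₀.2 η.2 y.2))) := by
  rw [coordL_prod h₁ h₂, prodConnection_constSec h₁ h₂, (constSec_prod h₁ h₂ η).1,
    (constSec_prod h₁ h₂ η).2]
  have t1 : ∀ (a : TangentSpace I₁ y.1) (b : TangentSpace I₂ y.2),
      tfst y (tinl y a + tinr y b) = a := fun a b => add_zero (a : E₁)
  have t2 : ∀ (a : TangentSpace I₁ y.1) (b : TangentSpace I₂ y.2),
      tsnd y (tinl y a + tinr y b) = b := fun a b => zero_add (b : E₂)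
  rw [t1, t2]

/-- The Christoffel symbols of a product of smooth connections are smooth. -/
theorem SmoothSymbols.prod (hcov₁ : SmoothSymbols cov₁) (hcov₂ : SmoothSymbols cov₂) :
    SmoothSymbols (prodConnection cov₁ cov₂) := by
  intro x₀ ξ η
  have h1 := (hcov₁ x₀.1 ξ.1 η.1).comp (t := (chartAt H₁ x₀.1).source)
    (s := (chartAt (ModelProd H₁ H₂) x₀).source)
    (contMDiffOn_fst (I := I₁) (J := I₂) (M := M₁) (N := M₂))
    fun y hy => (mem_chart_source_prod.1 hy).1
  have h2 := (hcov₂ x₀.2 ξ.2 η.2).comp (t := (chartAt H₂ x₀.2).source)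
    (s := (chartAt (ModelProd H₁ H₂) x₀).source)
    (contMDiffOn_snd (I := I₁) (J := I₂) (M := M₁) (N := M₂))
    fun y hy => (mem_chart_source_prod.1 hy).2
  refine (h1.prodMk_space h2).congr fun y hy => ?_
  exact coordL_prodConnection (mem_chart_source_prod.1 hy).1 (mem_chart_source_prod.1 hy).2 ξ η

end Product

end Geod

/-! ### Geodesics of a product, and inheritance of the two hypotheses -/

namespace Geod

section Product

variable {E₁ : Type*} [NormedAddCommGroup E₁] [NormedSpace ℝ E₁] [FiniteDimensional ℝ E₁]
  {H₁ : Type*} [TopologicalSpace H₁] {I₁ : ModelWithCorners ℝ E₁ H₁}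
  {M₁ : Type*} [TopologicalSpace M₁] [ChartedSpace H₁ M₁] [IsManifold I₁ ∞ M₁]
  {E₂ : Type*} [NormedAddCommGroup E₂] [NormedSpace ℝ E₂] [FiniteDimensional ℝ E₂]
  {H₂ : Type*} [TopologicalSpace H₂] {I₂ : ModelWithCorners ℝ E₂ H₂}
  {M₂ : Type*} [TopologicalSpace M₂] [ChartedSpace H₂ M₂] [IsManifold I₂ ∞ M₂]
  {cov₁ : CovariantDerivative I₁ E₁ (TangentSpace I₁ : M₁ → Type _)}
  {cov₂ : CovariantDerivative I₂ E₂ (TangentSpace I₂ : M₂ → Type _)}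

theorem symbols_eq_coordL {E : Type*} [NormedAddCommGroup E] [NormedSpace ℝ E]
    [FiniteDimensional ℝ E] {H : Type*} [TopologicalSpace H] {I : ModelWithCorners ℝ E H}
    {M : Type*} [TopologicalSpace M] [ChartedSpace H M] [IsManifold I ∞ M]
    (cov : CovariantDerivative I E (TangentSpace I : M → Type _)) {x₀ y : M}
    (hy : y ∈ (chartAt H x₀).source) (ξ η : E) :
    symbols cov x₀ (extChartAt I x₀ y) ξ η =
      coordL I x₀ y (cov (constSec I x₀ ξ) y (constSec I x₀ η y)) := by
  unfold symbols
  rw [(extChartAt I x₀).left_inv (by rwa [extChartAt_source]), cov_constSec cov hy]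

theorem tcoord_prod {x₀ : M₁ × M₂} {v : TangentBundle (I₁.prod I₂) (M₁ × M₂)}
    (h₁ : v.1.1 ∈ (chartAt H₁ x₀.1).source) (h₂ : v.1.2 ∈ (chartAt H₂ x₀.2).source) :
    tcoord (I₁.prod I₂) x₀ v =
      ((extChartAt I₁ x₀.1 v.1.1, extChartAt I₂ x₀.2 v.1.2),
        (coordL I₁ x₀.1 v.1.1 (tfst v.1 v.2), coordL I₂ x₀.2 v.1.2 (tsnd v.1 v.2))) := by
  unfold tcoord
  rw [coordL_prod h₁ h₂, extChartAt_prod]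
  rfl

/-- The symbols of the product connection have no mixed terms, so the spray decouples into those of
the factors. -/
theorem sprayField_prod {x₀ y : M₁ × M₂} (h₁ : y.1 ∈ (chartAt H₁ x₀.1).source)
    (h₂ : y.2 ∈ (chartAt H₂ x₀.2).source) (ξ : E₁ × E₂) :
    sprayField (prodConnection cov₁ cov₂) x₀ (extChartAt (I₁.prod I₂) x₀ y, ξ) =
      (ξ, (sprayField cov₁ x₀.1 (extChartAt I₁ x₀.1 y.1, ξ.1)).2,
        (sprayField cov₂ x₀.2 (extChartAt I₂ x₀.2 y.2, ξ.2)).2) := by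
  simp only [sprayField]
  rw [symbols_eq_coordL _ (mem_chart_source_prod.2 ⟨h₁, h₂⟩), symbols_eq_coordL _ h₁,
    symbols_eq_coordL _ h₂, coordL_prodConnection h₁ h₂]
  rfl

theorem lift_fst {γ : ℝ → M₁ × M₂} {t : ℝ}
    (hγ : MDifferentiableAt 𝓘(ℝ, ℝ) (I₁.prod I₂) γ t) :
    lift I₁ (fun s => (γ s).1) t = ⟨(γ t).1, tfst (γ t) (velocity (I₁.prod I₂) γ t)⟩ := by
  have h := ((hasMFDerivAt_fst (I := I₁) (I' := I₂) (γ t)).comp t hγ.hasMFDerivAt).mfderiv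
  exact congrArg (fun f : ℝ →L[ℝ] E₁ => (⟨(γ t).1, f 1⟩ : TangentBundle I₁ M₁)) h

theorem lift_snd {γ : ℝ → M₁ × M₂} {t : ℝ}
    (hγ : MDifferentiableAt 𝓘(ℝ, ℝ) (I₁.prod I₂) γ t) :
    lift I₂ (fun s => (γ s).2) t = ⟨(γ t).2, tsnd (γ t) (velocity (I₁.prod I₂) γ t)⟩ := by
  have h := ((hasMFDerivAt_snd (I := I₁) (I' := I₂) (γ t)).comp t hγ.hasMFDerivAt).mfderiv
  exact congrArg (fun f : ℝ →L[ℝ] E₂ => (⟨(γ t).2, f 1⟩ : TangentBundle I₂ M₂)) h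

theorem IsGeodesicOn.tcoord_eventuallyEq {γ : ℝ → M₁ × M₂} {J : Set ℝ}
    (hγ : IsGeodesicOn (prodConnection cov₁ cov₂) γ J) {t : ℝ} (ht : t ∈ J) :
    (fun s => tcoord (I₁.prod I₂) (γ t) (lift (I₁.prod I₂) γ s)) =ᶠ[𝓝 t] fun s =>
      (((tcoord I₁ (γ t).1 (lift I₁ (fun r => (γ r).1) s)).1,
        (tcoord I₂ (γ t).2 (lift I₂ (fun r => (γ r).2) s)).1),
      ((tcoord I₁ (γ t).1 (lift I₁ (fun r => (γ r).1) s)).2,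
        (tcoord I₂ (γ t).2 (lift I₂ (fun r => (γ r).2) s)).2)) := by
  have hs : ∀ s ∈ J, ContMDiffAt 𝓘(ℝ, ℝ) (I₁.prod I₂) ∞ γ s := fun s hs =>
    hγ.contMDiffOn.contMDiffAt (hγ.isOpen.mem_nhds hs)
  have hn : (chartAt (ModelProd H₁ H₂) (γ t)).source ∈ 𝓝 (γ t) :=
    (chartAt (ModelProd H₁ H₂) (γ t)).open_source.mem_nhds (mem_chart_source _ _)
  filter_upwards [hγ.isOpen.mem_nhds ht, (hs t ht).continuousAt.eventually hn] with s h1 h2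
  replace h2 := mem_chart_source_prod.1 h2
  have hd := (hs s h1).mdifferentiableAt (by simp)
  rw [lift_fst hd, lift_snd hd, tcoord_prod (v := lift (I₁.prod I₂) γ s) h2.1 h2.2]
  rfl

/-- The components of a geodesic of the product are geodesics. -/
theorem IsGeodesicOn.fst_snd {γ : ℝ → M₁ × M₂} {J : Set ℝ}
    (hγ : IsGeodesicOn (prodConnection cov₁ cov₂) γ J) :
    IsGeodesicOn cov₁ (fun t => (γ t).1) J ∧ IsGeodesicOn cov₂ (fun t => (γ t).2) J := by
  have key : ∀ t ∈ J, GeodesicEq cov₁ (fun t => (γ t).1) t ∧ GeodesicEq cov₂ (fun t => (γ t).2) t := by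
    intro t ht
    have h := hγ.hasDerivAt ht (mem_chart_source (ModelProd H₁ H₂) (γ t))
    have he := hγ.tcoord_eventuallyEq ht
    have h2 := h.congr_of_eventuallyEq he.symm
    have h3 : sprayField (prodConnection cov₁ cov₂) (γ t)
        (tcoord (I₁.prod I₂) (γ t) (lift (I₁.prod I₂) γ t)) = _ :=
      sprayField_prod (x₀ := γ t) (y := γ t) (mem_chart_source H₁ _) (mem_chart_source H₂ _)
        (tcoord (I₁.prod I₂) (γ t) (lift (I₁.prod I₂) γ t)).2
    have e := he.self_of_nhds
    dsimp only at e
    rw [e] at h3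
    rw [e, h3] at h2
    exact ⟨h2.fst.fst.prodMk h2.snd.fst, h2.fst.snd.prodMk h2.snd.snd⟩
  obtain ⟨h1, h2, h3, h4, -⟩ := isGeodesicOn_iff.1 hγ
  exact ⟨isGeodesicOn_iff.2 ⟨h1, h2, h3, contMDiff_fst.comp_contMDiffOn h4, fun t ht => (key t ht).1⟩,
    isGeodesicOn_iff.2 ⟨h1, h2, h3, contMDiff_snd.comp_contMDiffOn h4, fun t ht => (key t ht).2⟩⟩

section Complete

variable {E : Type*} [NormedAddCommGroup E] [NormedSpace ℝ E] [FiniteDimensional ℝ E]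
  {H : Type*} [TopologicalSpace H] {I : ModelWithCorners ℝ E H}
  {M : Type*} [TopologicalSpace M] [ChartedSpace H M] [IsManifold I ∞ M] [I.Boundaryless]
  [T2Space M] {cov : CovariantDerivative I E (TangentSpace I : M → Type _)}

/-- The defining condition concerns inextendible geodesics, but a component of an inextendible
geodesic of a product may be extendible when the other component cannot be continued. Extending it
first removes the restriction; the same is done for pseudoconvexity below. -/
theorem IsGeodesicOn.notMem_of_nonreturning (hcov : SmoothSymbols cov) {U : Set M}
    (hU : ∀ (γ : ℝ → M) (J : Set ℝ), IsInextendibleGeodesic cov γ J →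
      ∀ r ∈ J, ∀ s ∈ J, ∀ t ∈ J, r < s → s < t → γ r ∈ U → γ s ∉ U → γ t ∉ U)
    {γ : ℝ → M} {J : Set ℝ} (hγ : IsGeodesicOn cov γ J) {r s t : ℝ} (hr : r ∈ J) (hs : s ∈ J)
    (ht : t ∈ J) (hrs : r < s) (hst : s < t) (h1 : γ r ∈ U) (h2 : γ s ∉ U) : γ t ∉ U := by
  obtain ⟨γ', J', hγ', hJ, he⟩ := hγ.exists_extension hcov
  rw [he hr] at h1
  rw [he hs] at h2
  rw [he ht]
  exact hU γ' J' hγ' r (hJ hr) s (hJ hs) t (hJ ht) hrs hst h1 h2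

theorem IsGeodesicOn.mem_of_pseudoconvex (hcov : SmoothSymbols cov) {K K' : Set M}
    (hK : ∀ (γ : ℝ → M) (J : Set ℝ), IsInextendibleGeodesic cov γ J →
      ∀ a ∈ J, ∀ b ∈ J, a ≤ b → γ a ∈ K → γ b ∈ K → ∀ t ∈ Icc a b, γ t ∈ K')
    {γ : ℝ → M} {J : Set ℝ} (hγ : IsGeodesicOn cov γ J) {a b t : ℝ} (ha : a ∈ J) (hb : b ∈ J)
    (hab : a ≤ b) (h1 : γ a ∈ K) (h2 : γ b ∈ K) (ht : t ∈ Icc a b) : γ t ∈ K' := by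
  obtain ⟨γ', J', hγ', hJ, he⟩ := hγ.exists_extension hcov
  rw [he ha] at h1
  rw [he hb] at h2
  rw [he (hγ.ordConnected.out ha hb ht)]
  exact hK γ' J' hγ' a (hJ ha) b (hJ hb) hab h1 h2 t ht

end Complete

variable [I₁.Boundaryless] [I₂.Boundaryless] [T2Space M₁] [T2Space M₂]

/-- A product of nonreturning neighbourhoods works: a point outside it has a component outside its
factor, and the geodesic of that component, possibly constant otherwise, cannot come back. -/
theorem Nonreturning.prod (hcov₁ : SmoothSymbols cov₁) (hcov₂ : SmoothSymbols cov₂)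
    (h₁ : Nonreturning cov₁) (h₂ : Nonreturning cov₂) :
    Nonreturning (prodConnection cov₁ cov₂) := by
  rintro p V hV
  obtain ⟨V₁, hV₁, V₂, hV₂, hVV⟩ := mem_nhds_prod_iff.1 hV
  obtain ⟨U₁, hU₁, hUV₁, hr₁⟩ := h₁ p.1 V₁ hV₁
  obtain ⟨U₂, hU₂, hUV₂, hr₂⟩ := h₂ p.2 V₂ hV₂
  refine ⟨U₁ ×ˢ U₂, prod_mem_nhds hU₁ hU₂, (prod_mono hUV₁ hUV₂).trans hVV, ?_⟩
  intro γ J hγ r hr s hs t ht hrs hst h1 h2 h3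
  obtain ⟨g₁, g₂⟩ := hγ.toIsGeodesicOn.fst_snd
  refine h2 ⟨?_, ?_⟩
  · by_contra h4
    exact g₁.notMem_of_nonreturning hcov₁ hr₁ hr hs ht hrs hst h1.1 h4 h3.1
  · by_contra h4
    exact g₂.notMem_of_nonreturning hcov₂ hr₂ hr hs ht hrs hst h1.2 h4 h3.2

/-- The projections of `K` are compact, and the product of the compact sets that they yield in the
factors contains the segments. -/
theorem Pseudoconvex.prod (hcov₁ : SmoothSymbols cov₁) (hcov₂ : SmoothSymbols cov₂)
    (h₁ : Pseudoconvex cov₁) (h₂ : Pseudoconvex cov₂) :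
    Pseudoconvex (prodConnection cov₁ cov₂) := by
  intro K hK
  obtain ⟨K₁, hK₁, hs₁⟩ := h₁ (Prod.fst '' K) (hK.image continuous_fst)
  obtain ⟨K₂, hK₂, hs₂⟩ := h₂ (Prod.snd '' K) (hK.image continuous_snd)
  refine ⟨K₁ ×ˢ K₂, hK₁.prod hK₂, ?_⟩
  intro γ J hγ a ha b hb hab haK hbK t ht
  obtain ⟨g₁, g₂⟩ := hγ.toIsGeodesicOn.fst_snd
  exact ⟨g₁.mem_of_pseudoconvex hcov₁ hs₁ ha hb hab ⟨_, haK, rfl⟩ ⟨_, hbK, rfl⟩ ht,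
    g₂.mem_of_pseudoconvex hcov₂ hs₂ ha hb hab ⟨_, haK, rfl⟩ ⟨_, hbK, rfl⟩ ht⟩

end Product

end Geod

end

theorem mainTheorem6 {n₁ n₂ : ℕ} (hn : 0 < n₁ + n₂)
    {M₁ : Type*} [TopologicalSpace M₁] [ChartedSpace (EuclideanSpace ℝ (Fin n₁)) M₁]
    [IsManifold (𝓡 n₁) ∞ M₁] [T2Space M₁] [ParacompactSpace M₁] [ConnectedSpace M₁]
    {M₂ : Type*} [TopologicalSpace M₂] [ChartedSpace (EuclideanSpace ℝ (Fin n₂)) M₂]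
    [IsManifold (𝓡 n₂) ∞ M₂] [T2Space M₂] [ParacompactSpace M₂] [ConnectedSpace M₂]
    (cov₁ : CovariantDerivative (𝓡 n₁) (EuclideanSpace ℝ (Fin n₁))
      (TangentSpace (𝓡 n₁) : M₁ → Type _))
    (hcov₁ : CovariantDerivative.ContMDiffCovariantDerivative cov₁ ∞)
    (cov₂ : CovariantDerivative (𝓡 n₂) (EuclideanSpace ℝ (Fin n₂))
      (TangentSpace (𝓡 n₂) : M₂ → Type _))
    (hcov₂ : CovariantDerivative.ContMDiffCovariantDerivative cov₂ ∞)
    (hN₁ : Geod.Nonreturning cov₁) (hP₁ : Geod.Pseudoconvex cov₁)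
    (hN₂ : Geod.Nonreturning cov₂) (hP₂ : Geod.Pseudoconvex cov₂) :
    T2Space (Geod.SpaceOfGeodesics (Geod.prodConnection cov₁ cov₂)) ∧
    ParacompactSpace (Geod.SpaceOfGeodesics (Geod.prodConnection cov₁ cov₂)) ∧
    ConnectedSpace (Geod.SpaceOfGeodesics (Geod.prodConnection cov₁ cov₂)) ∧
    ∃ _ : ChartedSpace (EuclideanSpace ℝ (Fin (2 * (n₁ + n₂) - 2)))
        (Geod.SpaceOfGeodesics (Geod.prodConnection cov₁ cov₂)),
      IsManifold (𝓡 (2 * (n₁ + n₂) - 2)) ∞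
        (Geod.SpaceOfGeodesics (Geod.prodConnection cov₁ cov₂)) ∧
      ContMDiff ((𝓡 n₁).prod (𝓡 n₂)).tangent (𝓡 (2 * (n₁ + n₂) - 2)) ∞
        (Geod.geodesicProj (Geod.prodConnection cov₁ cov₂)) ∧
      ∀ v : Geod.ReducedTangentBundle ((𝓡 n₁).prod (𝓡 n₂)) (M₁ × M₂),
        Function.Surjective (mfderiv ((𝓡 n₁).prod (𝓡 n₂)).tangent (𝓡 (2 * (n₁ + n₂) - 2))
          (Geod.geodesicProj (Geod.prodConnection cov₁ cov₂)) v) := by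
  have hs₁ := Geod.smoothSymbols_of_contMDiff hcov₁
  have hs₂ := Geod.smoothSymbols_of_contMDiff hcov₂
  have hl₁ : LocallyCompactSpace M₁ := Manifold.locallyCompact_of_finiteDimensional (𝓡 n₁)
  have hl₂ : LocallyCompactSpace M₂ := Manifold.locallyCompact_of_finiteDimensional (𝓡 n₂)
  -- Paracompactness alone does not pass through the quotient here; with connectedness it gives
  -- σ-compactness, from which countability of the tangent bundle follows.
  have hσ₁ := sigmaCompactSpace_of_paracompactSpace_of_connectedSpace M₁
  have hσ₂ := sigmaCompactSpace_of_paracompactSpace_of_connectedSpace M₂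
  have hH : SecondCountableTopology
      (ModelProd (EuclideanSpace ℝ (Fin n₁)) (EuclideanSpace ℝ (Fin n₂))) :=
    inferInstanceAs (SecondCountableTopology
      (EuclideanSpace ℝ (Fin n₁) × EuclideanSpace ℝ (Fin n₂)))
  have hrank : Module.finrank ℝ (EuclideanSpace ℝ (Fin n₁) × EuclideanSpace ℝ (Fin n₂)) =
      n₁ + n₂ := by
    rw [Module.finrank_prod, finrank_euclideanSpace_fin, finrank_euclideanSpace_fin]
  -- Positive dimension provides nonzero tangent vectors over every point, which the connectedness
  -- argument requires.
  have hnt : Nontrivial (EuclideanSpace ℝ (Fin n₁) × EuclideanSpace ℝ (Fin n₂)) :=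
    Module.nontrivial_of_finrank_pos (R := ℝ) (by rwa [hrank])
  exact Geod.spaceOfGeodesics_manifold (hs₁.prod hs₂) (hN₁.prod hs₁ hs₂ hN₂) (hP₁.prod hs₁ hs₂ hP₂)
    (by rw [hrank, finrank_euclideanSpace_fin])
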